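/- Let $\mathbf C^3_1$ be $\mathbf C^3$ with the Hermitian form $b(z,w)=-\bar z_1w_1+\bar z_2w_2+\bar z_3w_3$, let $S^5_2(1)=\{z\in\mathbf C^3: b(z,z)=1\}$, and let $\pi:S^5_2(1)\to CP^2_1(4)$, $z\mapsto z\cdot\mathbf C^*$, be the Hopf fibration onto the Lorentzian complex projective plane, which carries its standard complex structure $J$ and the pseudo-Riemannian metric $\langle\cdot,\cdot\rangle$ for which $\pi$ is a pseudo-Riemannian submersion ($S^5_2(1)$ having the metric induced by $\operatorname{Re} b$). Let $M$ be a connected smooth surface and let $L:M\to CP^2_1(4)$ be a smooth immersion whose induced metric is Lorentzian. Assume that $L$ is slant, i.e. its Wirtinger angle is a constant $\theta$: at each point the tangent plane has a basis $e_1,e_2$ with $\langle e_1,e_1\rangle=\langle e_2,e_2\rangle=0$, $\langle e_1,e_2\rangle=-1$ such that the tangential components of $Je_1,Je_2$ are $\sinh\theta\,e_1$ and $-\sinh\theta\,e_2$. Assume also that $L$ is minimal (its mean curvature vector vanishes) and flat (the induced metric has zero curvature). Then $L$ is Lagrangian, i.e. $J$ maps every tangent plane of $L$ into the normal plane. Moreover,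 $L$ is congruent to $\pi\circ\tilde L$, where for some nonzero real number $a$ $$\tilde L(x,y)=\frac1{\sqrt3}\Big(\sqrt2\,e^{\frac{i}{2a}(x-a^2y)}\sinh\big(\tfrac{\sqrt3}{2a}(x+a^2y)\big),\ e^{\frac{i}{a}(a^2y-x)},\ \sqrt2\,e^{\frac{i}{2a}(x-a^2y)}\cosh\big(\tfrac{\sqrt3}{2a}(x+a^2y)\big)\Big)\in S^5_2(1).$$ That is, there are a real number $a\neq0$ and an isometry $\Phi$ of $CP^2_1(4)$ induced by a complex linear automorphism of $\mathbf C^3$ preserving $b$ such that every point of $M$ has an open neighbourhood with smooth coordinates $(x,y)$ on which $L=\Phi\circ\pi\circ\tilde L(x,y)$. -/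

import Mathlib

open scoped Manifold ContDiff ComplexConjugate

noncomputable section

namespace SlantCP

/-! ### Pseudo-Riemannian geometry in coordinates

A metric on an open subset of a real vector space `E` is a field of bilinear forms. All the
functions below are only used at interior points of the domain, where the field is smooth and
nondegenerate. -/

section Coordinates

variable {E : Type*} [NormedAddCommGroup E] [NormedSpace ℝ E]
variable {F : Type*} [NormedAddCommGroup F] [NormedSpace ℝ F]

/-- The Levi-Civita connection of `G` on constant vector fields: `christoffel G x v w = ∇_v w`
is the vector characterized by the Koszul formula
`G x (∇_v w) u = (1/2) (∂_v (G w u) + ∂_w (G v u) - ∂_u (G v w))` for all `u`. -/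
def christoffel (G : E → E →L[ℝ] E →L[ℝ] ℝ) (x v w : E) : E :=
  (G x).inverse ((1 / 2 : ℝ) •
    (fderiv ℝ G x v w + fderiv ℝ G x w v - ((fderiv ℝ G x).flip v).flip w))

/-- The Riemann curvature tensor `R(v, w) z = ∇_v ∇_w z - ∇_w ∇_v z` of the Levi-Civita connection
of `G`, on constant vector fields `v`, `w`, `z`. -/
def curvature (G : E → E →L[ℝ] E →L[ℝ] ℝ) (x v w z : E) : E :=
  fderiv ℝ (fun y => christoffel G y w z) x v - fderiv ℝ (fun y => christoffel G y v z) x w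
    + christoffel G x v (christoffel G x w z) - christoffel G x w (christoffel G x v z)

/-- The metric induced by `g` through the map `f`. -/
def inducedMetric (g : F → F →L[ℝ] F →L[ℝ] ℝ) (f : E → F) (x : E) : E →L[ℝ] E →L[ℝ] ℝ :=
  (g (f x)).bilinearComp (fderiv ℝ f x) (fderiv ℝ f x)

/-- The second fundamental form `h(v, w) = ∇̃_v (df w) - df (∇_v w)` of the immersion `f`
(formula of Gauss), where `∇̃` is the Levi-Civita connection of the ambient metric `g` and `∇` the
one of the induced metric. -/
def secondFundamentalForm (g : F → F →L[ℝ] F →L[ℝ] ℝ) (f : E → F) (x v w : E) : F :=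
  fderiv ℝ (fun y => fderiv ℝ f y w) x v
    + christoffel g (f x) (fderiv ℝ f x v) (fderiv ℝ f x w)
    - fderiv ℝ f x (christoffel (inducedMetric g f) x v w)

/-- The mean curvature vector `H = (1/2) trace h = (1/2) ∑ᵢⱼ Gⁱʲ h(∂ᵢ, ∂ⱼ)` of a surface, where
`Gⁱʲ` is the inverse of the matrix of the induced metric. -/
def meanCurvature (g : F → F →L[ℝ] F →L[ℝ] ℝ) (f : EuclideanSpace ℝ (Fin 2) → F)
    (x : EuclideanSpace ℝ (Fin 2)) : F :=
  (1 / 2 : ℝ) • ∑ i : Fin 2, ∑ j : Fin 2,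
    (Matrix.of fun k l : Fin 2 => inducedMetric g f x
        (EuclideanSpace.single k 1) (EuclideanSpace.single l 1))⁻¹ i j •
      secondFundamentalForm g f x (EuclideanSpace.single i 1) (EuclideanSpace.single j 1)

end Coordinates

/-! ### The Lorentzian complex projective plane -/

/-- The Hermitian form `b(z, w) = - z̄₁ w₁ + z̄₂ w₂ + z̄₃ w₃` on `ℂ³`. -/
def herm (z w : Fin 3 → ℂ) : ℂ :=
  -(conj (z 0) * w 0) + conj (z 1) * w 1 + conj (z 2) * w 2

/-- The real part of `herm`, a flat metric on `ℂ³`, as a bilinear form. -/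
def reHerm : (Fin 3 → ℂ) →L[ℝ] (Fin 3 → ℂ) →L[ℝ] ℝ :=
  (LinearMap.mk₂ ℝ (fun z w => (herm z w).re)
    (by intros; simp [herm]; ring) (by intros; simp [herm]; ring)
    (by intros; simp [herm]; ring) (by intros; simp [herm]; ring)).toContinuousBilinearMap

/-- The pseudosphere `S⁵₂(1) = {z ∈ ℂ³ : b(z, z) = 1}`. -/
def S52 : Type := {z : Fin 3 → ℂ // herm z z = 1}

instance : TopologicalSpace S52 := inferInstanceAs (TopologicalSpace {z : Fin 3 → ℂ // herm z z = 1})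

/-- Two points of the pseudosphere are related if they span the same complex line. -/
instance hopfSetoid : Setoid S52 where
  r z w := ∃ c : ℂ, c ≠ 0 ∧ w.1 = c • z.1
  iseqv :=
    ⟨fun z => ⟨1, one_ne_zero, by simp⟩,
      fun {z w} ⟨c, hc, h⟩ => ⟨c⁻¹, inv_ne_zero hc, by rw [h, smul_smul, inv_mul_cancel₀ hc, one_smul]⟩,
      fun {z w u} ⟨c, hc, h⟩ ⟨d, hd, h'⟩ => ⟨d * c, mul_ne_zero hd hc, by rw [h', h, smul_smul]⟩⟩

/-- The Lorentzian complex projective plane `CP²₁(4)`, as the set of complex lines spanned by the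
points of the pseudosphere, with the quotient topology. -/
def CP21 : Type := Quotient hopfSetoid

instance : TopologicalSpace CP21 := inferInstanceAs (TopologicalSpace (Quotient hopfSetoid))

/-- The Hopf fibration `π : S⁵₂(1) → CP²₁(4)`. -/
def hopf (z : S52) : CP21 := Quotient.mk hopfSetoid z

/-- The linear embedding of `ℂ²` as the coordinate plane `z₂ = 0` (`k = 0`) or `z₃ = 0`
(`k = 1`) of `ℂ³`. -/
def planeIncl : Fin 2 → (ℂ × ℂ →ₗ[ℂ] Fin 3 → ℂ)
  | 0 => { toFun := fun w => ![w.1, 0, w.2]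
           map_add' := by intro v w; ext i; fin_cases i <;> simp
           map_smul' := by intro c w; ext i; fin_cases i <;> simp }
  | 1 => { toFun := fun w => ![w.1, w.2, 0]
           map_add' := by intro v w; ext i; fin_cases i <;> simp
           map_smul' := by intro c w; ext i; fin_cases i <;> simp }

/-- The homogeneous coordinates `(w₁, 1, w₂)` (`k = 0`) or `(w₁, w₂, 1)` (`k = 1`) of the point
with affine coordinates `w`. -/
def homog (k : Fin 2) (w : ℂ × ℂ) : Fin 3 → ℂ := planeIncl k w + Pi.single k.succ 1

/-- The affine coordinates of the line through `z`: `(z₁/z₂, z₃/z₂)` for `k = 0` and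
`(z₁/z₃, z₂/z₃)` for `k = 1`. -/
def affineOf : Fin 2 → (Fin 3 → ℂ) → ℂ × ℂ
  | 0, z => (z 0 / z 1, z 2 / z 1)
  | 1, z => (z 0 / z 2, z 1 / z 2)

/-- The squared length `b(homog k w, homog k w)`. -/
def lenSq (k : Fin 2) (w : ℂ × ℂ) : ℝ := (herm (homog k w) (homog k w)).re

lemma herm_self (z : Fin 3 → ℂ) : herm z z = ((herm z z).re : ℂ) := by
  apply Complex.ext <;> simp [herm]
  ring

lemma herm_smul_smul (c : ℂ) (z w : Fin 3 → ℂ) :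
    herm (c • z) (c • w) = (conj c * c) * herm z w := by
  simp [herm]; ring

lemma homog_succ (k : Fin 2) (w : ℂ × ℂ) : homog k w k.succ = 1 := by
  fin_cases k <;> simp [homog, planeIncl]

lemma affineOf_smul (k : Fin 2) {c : ℂ} (hc : c ≠ 0) (z : Fin 3 → ℂ) :
    affineOf k (c • z) = affineOf k z := by
  fin_cases k <;> simp [affineOf, mul_div_mul_left _ _ hc]

lemma affineOf_homog (k : Fin 2) (w : ℂ × ℂ) : affineOf k (homog k w) = w := by
  fin_cases k <;> simp [affineOf, homog, planeIncl]

lemma homog_affineOf (k : Fin 2) {z : Fin 3 → ℂ} (hz : z k.succ ≠ 0) :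
    homog k (affineOf k z) = (z k.succ)⁻¹ • z := by
  ext i
  fin_cases k <;> fin_cases i <;>
    simp_all [affineOf, homog, planeIncl, div_eq_inv_mul]

/-- The point of the pseudosphere on the ray through `homog k w`, when there is one. -/
def unitPoint (k : Fin 2) (w : ℂ × ℂ) : S52 :=
  if h : 0 < lenSq k w then
    ⟨((Real.sqrt (lenSq k w) : ℂ)⁻¹) • homog k w, by
      rw [herm_smul_smul, herm_self]
      change _ * ((lenSq k w : ℝ) : ℂ) = 1
      rw [map_inv₀, Complex.conj_ofReal, ← mul_inv, ← Complex.ofReal_mul,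
        Real.mul_self_sqrt h.le]
      exact inv_mul_cancel₀ (by exact_mod_cast h.ne')⟩
  else ⟨Pi.single 1 1, by simp [herm]⟩

lemma unitPoint_val (k : Fin 2) {w : ℂ × ℂ} (h : 0 < lenSq k w) :
    (unitPoint k w).1 = ((Real.sqrt (lenSq k w) : ℂ)⁻¹) • homog k w := by
  simp [unitPoint, h]

/-- The lines on which the coordinate `z₂` (`k = 0`) or `z₃` (`k = 1`) does not vanish. -/
def affineDomain (k : Fin 2) : Set CP21 := {l | ∃ z : S52, hopf z = l ∧ z.1 k.succ ≠ 0}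

/-- The affine coordinates on `CP²₁(4)`, meaningful on `affineDomain k`. -/
def affineCoord (k : Fin 2) : CP21 → ℂ × ℂ :=
  Quotient.lift (fun z : S52 => affineOf k z.1) (by
    rintro z w ⟨c, hc, h⟩
    rw [h, affineOf_smul k hc])

lemma hopf_mem_affineDomain (k : Fin 2) (z : S52) :
    hopf z ∈ affineDomain k ↔ z.1 k.succ ≠ 0 := by
  constructor
  · rintro ⟨w, hw, h⟩
    obtain ⟨c, hc, h'⟩ := Quotient.exact hw
    rw [h']
    simpa using ⟨hc, h⟩
  · exact fun h => ⟨z, rfl, h⟩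

lemma continuous_hopf : Continuous hopf := continuous_quotient_mk'

lemma isQuotientMap_hopf : Topology.IsQuotientMap hopf := isQuotientMap_quotient_mk'

lemma continuous_S52_val : Continuous (fun z : S52 => z.1) := continuous_subtype_val

lemma isOpen_affineDomain (k : Fin 2) : IsOpen (affineDomain k) := by
  rw [← isQuotientMap_hopf.isOpen_preimage]
  have : hopf ⁻¹' affineDomain k = {z : S52 | z.1 k.succ ≠ 0} := by
    ext z; exact hopf_mem_affineDomain k z
  rw [this]
  exact isOpen_ne_fun ((continuous_apply _).comp continuous_S52_val) continuous_const

lemma contDiff_homog (k : Fin 2) : ContDiff ℝ ∞ (homog k) := by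
  rw [contDiff_pi]
  intro i
  fin_cases k <;> fin_cases i <;> simp [homog, planeIncl] <;> fun_prop

lemma continuous_lenSq (k : Fin 2) : Continuous (lenSq k) := by
  have h := (contDiff_homog k).continuous
  have h' : ∀ i, Continuous fun w => homog k w i := fun i => (continuous_apply i).comp h
  unfold lenSq herm
  have h0 := h' 0
  have h1 := h' 1
  have h2 := h' 2
  fun_prop

lemma lenSq_affineOf_pos (k : Fin 2) (z : S52) (hz : z.1 k.succ ≠ 0) :
    0 < lenSq k (affineOf k z.1) := by
  rw [lenSq, homog_affineOf k hz, herm_smul_smul, z.2, mul_one, Complex.conj_mul']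
  have : 0 < ‖(z.1 k.succ)⁻¹‖ := norm_pos_iff.mpr (inv_ne_zero hz)
  norm_cast
  positivity

/-- The affine charts of `CP²₁(4)`; the two domains cover it. -/
def affineChart (k : Fin 2) : OpenPartialHomeomorph CP21 (ℂ × ℂ) where
  toFun := affineCoord k
  invFun w := hopf (unitPoint k w)
  source := affineDomain k
  target := {w | 0 < lenSq k w}
  map_source' := by
    rintro _ ⟨z, rfl, hz⟩
    exact lenSq_affineOf_pos k z hz
  map_target' := by
    intro w hw
    have hw : 0 < lenSq k w := hw
    rw [hopf_mem_affineDomain, unitPoint_val k hw]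
    simpa [homog_succ] using (Real.sqrt_pos.mpr hw).ne'
  left_inv' := by
    rintro _ ⟨z, rfl, hz⟩
    have hp := lenSq_affineOf_pos k z hz
    refine Quotient.sound (Setoid.symm ⟨(Real.sqrt (lenSq k (affineOf k z.1)) : ℂ)⁻¹ * (z.1 k.succ)⁻¹,
      mul_ne_zero (inv_ne_zero ?_) (inv_ne_zero hz), ?_⟩)
    · exact_mod_cast (Real.sqrt_pos.mpr hp).ne'
    · refine (unitPoint_val k hp).trans ?_
      rw [homog_affineOf k hz, smul_smul]
  right_inv' := by
    intro w hw
    have hw : 0 < lenSq k w := hw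
    change affineOf k (unitPoint k w).1 = w
    rw [unitPoint_val k hw, affineOf_smul, affineOf_homog]
    exact inv_ne_zero (by exact_mod_cast (Real.sqrt_pos.mpr hw).ne')
  open_source := isOpen_affineDomain k
  open_target := isOpen_lt continuous_const (continuous_lenSq k)
  continuousOn_toFun := by
    rw [isQuotientMap_hopf.continuousOn_isOpen_iff (isOpen_affineDomain k)]
    have hc : ∀ i, ContinuousOn (fun z : S52 => z.1 i) (hopf ⁻¹' affineDomain k) := fun i =>
      ((continuous_apply i).comp continuous_S52_val).continuousOn
    have hne : ∀ z ∈ hopf ⁻¹' affineDomain k, z.1 k.succ ≠ 0 := fun z hz =>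
      (hopf_mem_affineDomain k z).mp hz
    fin_cases k
    · exact ((hc 0).div (hc 1) hne).prodMk ((hc 2).div (hc 1) hne)
    · exact ((hc 0).div (hc 2) hne).prodMk ((hc 1).div (hc 2) hne)
  continuousOn_invFun := by
    refine continuous_hopf.comp_continuousOn ?_
    rw [continuousOn_iff_continuous_domRestrict]
    refine Continuous.subtype_mk (f := fun w : {w | 0 < lenSq k w} => (unitPoint k w.1).1) ?_ _
    have : (fun w : {w | 0 < lenSq k w} => (unitPoint k w.1).1)
        = fun w => ((Real.sqrt (lenSq k w.1) : ℂ)⁻¹) • homog k w.1 :=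
      funext fun w => unitPoint_val k w.2
    rw [this]
    have hs : Continuous fun w : {w | 0 < lenSq k w} => ((Real.sqrt (lenSq k w.1) : ℝ) : ℂ) :=
      Complex.continuous_ofReal.comp
        (Real.continuous_sqrt.comp ((continuous_lenSq k).comp continuous_subtype_val))
    have hi : Continuous fun w : {w | 0 < lenSq k w} => ((Real.sqrt (lenSq k w.1) : ℝ) : ℂ)⁻¹ :=
      hs.inv₀ fun w => by exact_mod_cast (Real.sqrt_pos.mpr w.2).ne'
    exact hi.smul ((contDiff_homog k).continuous.comp continuous_subtype_val)

lemma exists_mem_affineDomain (l : CP21) : ∃ k, l ∈ affineDomain k := by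
  obtain ⟨z, rfl⟩ := isQuotientMap_hopf.surjective l
  by_contra! h
  have h1 : z.1 1 = 0 := by simpa using (hopf_mem_affineDomain 0 z).not.mp (h 0)
  have h2 : z.1 2 = 0 := by simpa using (hopf_mem_affineDomain 1 z).not.mp (h 1)
  have h3 := congrArg Complex.re z.2
  simp [herm, h1, h2] at h3
  nlinarith [mul_self_nonneg (z.1 0).re, mul_self_nonneg (z.1 0).im]

instance : ChartedSpace (ℂ × ℂ) CP21 where
  atlas := Set.range affineChart
  chartAt l := affineChart (exists_mem_affineDomain l).choose
  mem_chart_source l := (exists_mem_affineDomain l).choose_spec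
  chart_mem_atlas _ := Set.mem_range_self _

instance : IsManifold 𝓘(ℝ, ℂ × ℂ) ∞ CP21 := by
  apply isManifold_of_contDiffOn
  rintro _ _ ⟨k, rfl⟩ ⟨l, rfl⟩
  have key : ∀ w ∈ ((affineChart k).symm ≫ₕ affineChart l).source,
      ((affineChart k).symm ≫ₕ affineChart l) w = affineOf l (homog k w) ∧
        homog k w l.succ ≠ 0 := by
    intro w hw
    rw [OpenPartialHomeomorph.trans_source] at hw
    have hw1 : 0 < lenSq k w := hw.1
    have hw2 : (unitPoint k w).1 l.succ ≠ 0 := (hopf_mem_affineDomain l _).mp hw.2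
    have hc : ((Real.sqrt (lenSq k w) : ℂ)⁻¹) ≠ 0 :=
      inv_ne_zero (by exact_mod_cast (Real.sqrt_pos.mpr hw1).ne')
    refine ⟨?_, ?_⟩
    · change affineOf l (unitPoint k w).1 = _
      rw [unitPoint_val k hw1, affineOf_smul l hc]
    · rw [unitPoint_val k hw1] at hw2
      exact fun h0 => hw2 (by simp [h0])
  have hsm : ∀ i, ContDiff ℝ ∞ fun w => homog k w i := contDiff_pi.mp (contDiff_homog k)
  simp only [modelWithCornersSelf_coe, modelWithCornersSelf_coe_symm, Function.id_comp,
    Function.comp_id, Set.preimage_id, Set.range_id, Set.inter_univ]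
  refine ContDiffOn.congr (f := fun w => affineOf l (homog k w)) ?_ fun w hw => (key w hw).1
  have hne := fun w hw => (key w hw).2
  have hdiv : ∀ i, ContDiffOn ℝ ∞ (fun w => homog k w i / homog k w l.succ)
      ((affineChart k).symm ≫ₕ affineChart l).source := fun i => by
    simp only [div_eq_mul_inv]
    exact (hsm i).contDiffOn.mul ((hsm l.succ).contDiffOn.inv hne)
  fin_cases l
  · exact (hdiv 0).prodMk (hdiv 2)
  · exact (hdiv 0).prodMk (hdiv 1)

/-- The horizontal lift of the coordinate vector `v` at `w` to the point `z = s / √N` of the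
pseudosphere over `w`, where `s = homog k w` and `N = b(s, s)`: the vector of `ℂ³` that is
`b`-orthogonal to `z` and is sent to `v` by the differential of `z ↦ affineOf k z`. -/
def horizontalLift (k : Fin 2) (w : ℂ × ℂ) : ℂ × ℂ →L[ℝ] Fin 3 → ℂ :=
  (LinearMap.toContinuousLinearMap
    ({ toFun := fun v => ((Real.sqrt (lenSq k w) : ℂ)⁻¹) •
        (planeIncl k v - (herm (homog k w) (planeIncl k v) / lenSq k w) • homog k w)
       map_add' := by
        intro u v
        ext i
        simp [herm]
        ring
       map_smul' := by
        intro c v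
        ext i
        simp [herm]
        ring } : ℂ × ℂ →ₗ[ℂ] Fin 3 → ℂ)).restrictScalars ℝ

/-- The metric of `CP²₁(4)` in the chart `affineChart k`, for which the Hopf fibration is a
pseudo-Riemannian submersion. -/
def fubiniStudy (k : Fin 2) (w : ℂ × ℂ) : ℂ × ℂ →L[ℝ] ℂ × ℂ →L[ℝ] ℝ :=
  reHerm.bilinearComp (horizontalLift k w) (horizontalLift k w)

/-- The complex linear automorphisms of `ℂ³` preserving the form `b`. -/
structure U12 where
  toEquiv : (Fin 3 → ℂ) ≃ₗ[ℂ] (Fin 3 → ℂ)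
  map_herm : ∀ z w, herm (toEquiv z) (toEquiv w) = herm z w

/-- The holomorphic isometry of `CP²₁(4)` induced by an element of `U(1,2)`. -/
def U12.congruence (A : U12) : CP21 → CP21 :=
  Quotient.map (fun z : S52 => (⟨A.toEquiv z.1, (A.map_herm _ _).trans z.2⟩ : S52)) (by
    rintro z w ⟨c, hc, h⟩
    exact ⟨c, hc, by simp [h]⟩)

/-! ### Surfaces in the Lorentzian complex projective plane -/

section Surfaces

variable {M : Type*} [TopologicalSpace M] [ChartedSpace (EuclideanSpace ℝ (Fin 2)) M]

/-- The property `P` of a metric and a parametrized surface at a point of its domain holds for all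
the expressions of `L` in the charts of the surface `M` and the affine charts of `CP²₁(4)`. -/
def InCharts (L : M → CP21)
    (P : (ℂ × ℂ → ℂ × ℂ →L[ℝ] ℂ × ℂ →L[ℝ] ℝ) → (EuclideanSpace ℝ (Fin 2) → ℂ × ℂ) →
      EuclideanSpace ℝ (Fin 2) → Prop) : Prop :=
  ∀ φ ∈ IsManifold.maximalAtlas (𝓡 2) ∞ M, ∀ k : Fin 2, ∀ u ∈ φ.target,
    L (φ.symm u) ∈ (affineChart k).source →
      P (fubiniStudy k) (fun y => affineChart k (L (φ.symm y))) u

/-- `e₁, e₂` is a pseudo-orthonormal frame at `u` for the metric induced by `g` through `f`, and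
`P e₁ = sinh α • e₁`, `P e₂ = - sinh α • e₂`, where `P X` is the tangential part of `J X`; that is,
`α` is the Wirtinger angle. Here `J` is the multiplication by `i` in affine coordinates. -/
def IsWirtingerAngle (α : ℝ) (g : ℂ × ℂ → ℂ × ℂ →L[ℝ] ℂ × ℂ →L[ℝ] ℝ)
    (f : EuclideanSpace ℝ (Fin 2) → ℂ × ℂ) (u : EuclideanSpace ℝ (Fin 2)) : Prop :=
  ∃ e₁ e₂ : EuclideanSpace ℝ (Fin 2),
    inducedMetric g f u e₁ e₁ = 0 ∧ inducedMetric g f u e₂ e₂ = 0 ∧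
    inducedMetric g f u e₁ e₂ = -1 ∧
    (∀ X, g (f u) (Complex.I • fderiv ℝ f u e₁ - fderiv ℝ f u (Real.sinh α • e₁))
      (fderiv ℝ f u X) = 0) ∧
    (∀ X, g (f u) (Complex.I • fderiv ℝ f u e₂ - fderiv ℝ f u (-Real.sinh α • e₂))
      (fderiv ℝ f u X) = 0)

/-- A slant surface: a Lorentzian surface with constant Wirtinger angle. -/
def IsSlant (L : M → CP21) : Prop := ∃ θ : ℝ, InCharts L (IsWirtingerAngle θ)

/-- The mean curvature vector vanishes identically. -/
def IsMinimal (L : M → CP21) : Prop := InCharts L fun g f u => meanCurvature g f u = 0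

/-- The curvature tensor of the induced metric vanishes identically. -/
def IsFlat (L : M → CP21) : Prop :=
  InCharts L fun g f u => ∀ X Y Z, curvature (inducedMetric g f) u X Y Z = 0

/-- `J` maps each tangent plane of the surface into the normal plane. -/
def IsLagrangian (L : M → CP21) : Prop :=
  InCharts L fun g f u => ∀ X Y, g (f u) (Complex.I • fderiv ℝ f u X) (fderiv ℝ f u Y) = 0

end Surfaces

/-- The explicit map
`(x, y) ↦ (1/√3) (√2 e^{i(x-a²y)/(2a)} sinh (√3(x+a²y)/(2a)), e^{i(a²y-x)/a},
  √2 e^{i(x-a²y)/(2a)} cosh (√3(x+a²y)/(2a)))` into the pseudosphere. -/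
def Ltilde (a x y : ℝ) : S52 :=
  ⟨((1 / Real.sqrt 3 : ℝ) : ℂ) •
    ![((Real.sqrt 2 : ℝ) : ℂ) * Complex.exp ((((x - a ^ 2 * y) / (2 * a) : ℝ) : ℂ) * Complex.I)
        * ((Real.sinh (Real.sqrt 3 * (x + a ^ 2 * y) / (2 * a)) : ℝ) : ℂ),
      Complex.exp ((((a ^ 2 * y - x) / a : ℝ) : ℂ) * Complex.I),
      ((Real.sqrt 2 : ℝ) : ℂ) * Complex.exp ((((x - a ^ 2 * y) / (2 * a) : ℝ) : ℂ) * Complex.I)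
        * ((Real.cosh (Real.sqrt 3 * (x + a ^ 2 * y) / (2 * a)) : ℝ) : ℂ)], by
    have h3 : (1 / Real.sqrt 3) * (1 / Real.sqrt 3) = 1 / 3 := by
      rw [div_mul_div_comm, Real.mul_self_sqrt (by norm_num)]; norm_num
    have h2 : Real.sqrt 2 * Real.sqrt 2 = 2 := Real.mul_self_sqrt (by norm_num)
    have hcs := Real.cosh_sq (Real.sqrt 3 * (x + a ^ 2 * y) / (2 * a))
    rw [herm_smul_smul, Complex.conj_ofReal, ← Complex.ofReal_mul, h3]
    generalize Real.sqrt 3 * (x + a ^ 2 * y) / (2 * a) = t at *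
    have he : ∀ s : ℝ, conj (Complex.exp ((s : ℂ) * Complex.I)) * Complex.exp ((s : ℂ) * Complex.I)
        = 1 := by
      intro s
      rw [Complex.conj_mul', Complex.norm_exp_ofReal_mul_I]; simp
    have h2' : ((Real.sqrt 2 : ℝ) : ℂ) * ((Real.sqrt 2 : ℝ) : ℂ) = 2 := by exact_mod_cast h2
    have hcs' : ((Real.cosh t : ℝ) : ℂ) ^ 2 = ((Real.sinh t : ℝ) : ℂ) ^ 2 + 1 := by
      exact_mod_cast hcs
    have e1 := he ((x - a ^ 2 * y) / (2 * a))
    have e2 := he ((a ^ 2 * y - x) / a)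
    generalize Complex.exp ((((x - a ^ 2 * y) / (2 * a) : ℝ) : ℂ) * Complex.I) = p at *
    generalize Complex.exp ((((a ^ 2 * y - x) / a : ℝ) : ℂ) * Complex.I) = q at *
    simp only [herm, Matrix.cons_val_zero, Matrix.cons_val_one, Matrix.cons_val, map_mul,
      Complex.conj_ofReal]
    push_cast at hcs' h2' ⊢
    linear_combination (1 / 3 : ℂ) * (Complex.cosh t ^ 2 - Complex.sinh t ^ 2) *
      ((((Real.sqrt 2 : ℝ) : ℂ) * ((Real.sqrt 2 : ℝ) : ℂ)) * e1 + h2') + (1 / 3 : ℂ) * e2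
      + (2 / 3 : ℂ) * hcs'⟩

end SlantCP

end

open scoped Manifold ContDiff ComplexConjugate

noncomputable section

namespace SlantCP

/-! ### The Hermitian form -/

/-! Locally a flat Lorentzian surface has null coordinates x, y in which its metric is -(dx⊗dy +
dy⊗dx) (`exists_flat_null_coordinates`). Take a lift z to the pseudosphere and write z_x = X + a₁z,
z_y = Y + a₂z with X, Y horizontal. Then b(X,X) = b(Y,Y) = 0 and b(X,Y) = β = -1 + iκ, where κ is
constant and κ² = sinh²θ, because the slant condition fixes the Kähler function up to sign. So z, X,
Y is a frame of ℂ³ with constant Gram matrix. Minimality says that the ambient covariant derivative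
of ∂y along ∂x vanishes, and the frame equations become X_x = a₁X + qY, X_y = a₂X - β̄z, Y_x = a₁Y -
βz, Y_y = a₂Y + rX with only two unknown coefficients q, r (`coeffX`, `coeffY`).

Equality of mixed partials gives ∂ₓa₂ - ∂ᵧa₁ = β - β̄ from z, then q_y = 0 and qr = β - 2β̄ from X,
and r_x = 0 and qr = β̄ - 2β from Y (`gauss_codazzi_X`, `gauss_codazzi_Y`). The two values of qr
agree only if β is real, so κ = 0: the surface is Lagrangian. Now qr = 1, hence q and r are
constant, and b(X,X) = 0 makes q imaginary. The connection form a₁dx + a₂dy is closed, so a phase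
change of z removes it; the isometry (x, y) ↦ (sx, s⁻¹y) normalises q to i. What remains is a linear
system with constant coefficients whose solutions are determined by their initial frame, so any two
differ by an element of U(1,2) (`IsModelSolution.exists_unitary`), and `Ltilde 1` is one solution.

To use one congruence for all of M, compare overlapping model charts. Their transition map preserves
the metric and the cubic form, so its differential at a point is the identity or (x, y) ↦ (-y, -x);
uniqueness for the linear system turns this first order information into an affine change of
coordinates valid on the whole chart (`IsModelSolution.exists_affine_change`). The points having a
model chart for a fixed congruence therefore form a clopen set.

The coordinate definitions of connection and second fundamental form are tied to the lift by
`hmetric_christoffel`: the Levi-Civita connection of the quotient is the horizontal part of the flat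
derivative upstairs. -/

lemma herm_add_left (x y z : Fin 3 → ℂ) : herm (x + y) z = herm x z + herm y z := by
  simp [herm]; ring

lemma herm_add_right (x y z : Fin 3 → ℂ) : herm x (y + z) = herm x y + herm x z := by
  simp [herm]; ring

lemma herm_sub_left (x y z : Fin 3 → ℂ) : herm (x - y) z = herm x z - herm y z := by
  simp [herm]; ring

lemma herm_sub_right (x y z : Fin 3 → ℂ) : herm x (y - z) = herm x y - herm x z := by
  simp [herm]; ring

lemma herm_smul_left (c : ℂ) (x y : Fin 3 → ℂ) : herm (c • x) y = conj c * herm x y := by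
  simp [herm]; ring

lemma herm_smul_right (c : ℂ) (x y : Fin 3 → ℂ) : herm x (c • y) = c * herm x y := by
  simp [herm]; ring

lemma herm_real_smul_left (c : ℝ) (x y : Fin 3 → ℂ) : herm (c • x) y = c * herm x y := by
  simp [herm]; ring

lemma herm_real_smul_right (c : ℝ) (x y : Fin 3 → ℂ) : herm x (c • y) = c * herm x y := by
  simp [herm]; ring

lemma herm_neg_left (x y : Fin 3 → ℂ) : herm (-x) y = -herm x y := by
  simp [herm]; ring

lemma herm_neg_right (x y : Fin 3 → ℂ) : herm x (-y) = -herm x y := by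
  simp [herm]; ring

@[simp] lemma herm_zero_right (x : Fin 3 → ℂ) : herm x 0 = 0 := by simp [herm]

lemma conj_herm (x y : Fin 3 → ℂ) : conj (herm x y) = herm y x := by
  simp [herm]; ring

lemma herm_re_comm (x y : Fin 3 → ℂ) : (herm x y).re = (herm y x).re := by
  rw [← conj_herm, Complex.conj_re]

/-- `herm` as a continuous real bilinear map. -/
def hermL : (Fin 3 → ℂ) →L[ℝ] (Fin 3 → ℂ) →L[ℝ] ℂ :=
  (LinearMap.mk₂ ℝ herm herm_add_left (fun c x y => by rw [herm_real_smul_left, Complex.real_smul])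
    herm_add_right (fun c x y => by rw [herm_real_smul_right, Complex.real_smul])
    ).toContinuousBilinearMap

@[simp] lemma hermL_apply (x y : Fin 3 → ℂ) : hermL x y = herm x y := rfl

/-! ### Null frames of ℂ³ -/

/-- The vectors `z, X, Y` are unitarily equivalent to a frame whose only nonzero products are
`b(z, z) = 1` and `b(X, Y) = β`. -/
structure IsNullFrame (β : ℂ) (z X Y : Fin 3 → ℂ) : Prop where
  zz : herm z z = 1
  zX : herm z X = 0
  zY : herm z Y = 0
  XX : herm X X = 0
  YY : herm Y Y = 0
  XY : herm X Y = β

namespace IsNullFrame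

variable {β : ℂ} {z X Y : Fin 3 → ℂ}

lemma Xz (h : IsNullFrame β z X Y) : herm X z = 0 := by rw [← conj_herm, h.zX, map_zero]

lemma Yz (h : IsNullFrame β z X Y) : herm Y z = 0 := by rw [← conj_herm, h.zY, map_zero]

lemma YX (h : IsNullFrame β z X Y) : herm Y X = conj β := by rw [← conj_herm, h.XY]

/-- The Gram matrix of the frame has determinant -|β|² ≠ 0. It factors as P * Q, where P is the
matrix of the functionals b(z, ·), b(X, ·), b(Y, ·), so these functionals are independent. -/
lemma eq_zero (h : IsNullFrame β z X Y) (hβ : β ≠ 0) {v : Fin 3 → ℂ} (h0 : herm z v = 0)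
    (h1 : herm X v = 0) (h2 : herm Y v = 0) : v = 0 := by
  let row : (Fin 3 → ℂ) → Fin 3 → ℂ := fun x => ![-conj (x 0), conj (x 1), conj (x 2)]
  have hrow : ∀ x y : Fin 3 → ℂ, row x 0 * y 0 + row x 1 * y 1 + row x 2 * y 2 = herm x y := by
    intro x y; simp [row, herm]
  let fr : Fin 3 → Fin 3 → ℂ := ![z, X, Y]
  let P : Matrix (Fin 3) (Fin 3) ℂ := Matrix.of fun i => row (fr i)
  let Q : Matrix (Fin 3) (Fin 3) ℂ := Matrix.of fun i j => fr j i
  have hPQ : P * Q = !![1, 0, 0; 0, 0, β; 0, conj β, 0] := by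
    ext i j
    rw [Matrix.mul_apply, Fin.sum_univ_three]
    change row (fr i) 0 * fr j 0 + row (fr i) 1 * fr j 1 + row (fr i) 2 * fr j 2 = _
    rw [hrow]
    fin_cases i <;> fin_cases j <;>
      simp [fr, h.zz, h.zX, h.zY, h.XX, h.YY, h.XY, h.Xz, h.Yz, h.YX]
  have hdet : P.det ≠ 0 := by
    intro hP
    have := congrArg Matrix.det hPQ
    rw [Matrix.det_mul, hP, zero_mul, Matrix.det_fin_three] at this
    simp [hβ] at this
  refine Matrix.eq_zero_of_mulVec_eq_zero hdet ?_
  ext i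
  rw [Matrix.mulVec, dotProduct, Fin.sum_univ_three]
  change row (fr i) 0 * v 0 + row (fr i) 1 * v 1 + row (fr i) 2 * v 2 = _
  rw [hrow]
  fin_cases i <;> simp [fr, h0, h1, h2]

lemma ext (h : IsNullFrame β z X Y) (hβ : β ≠ 0) {v w : Fin 3 → ℂ} (h0 : herm z v = herm z w)
    (h1 : herm X v = herm X w) (h2 : herm Y v = herm Y w) : v = w := by
  refine sub_eq_zero.mp (h.eq_zero hβ ?_ ?_ ?_) <;> rw [herm_sub_right, sub_eq_zero] <;> assumption

lemma expand (h : IsNullFrame (-1) z X Y) (v : Fin 3 → ℂ) :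
    herm z v • z - herm Y v • X - herm X v • Y = v := by
  apply h.ext (by simp) <;>
    simp [herm_sub_right, herm_smul_right, h.zz, h.zX, h.zY, h.XX, h.YY, h.XY, h.Xz, h.Yz, h.YX]

/-- Parseval's identity for a null frame; X and Y trade places because each is dual to minus the
other. -/
lemma herm_eq (h : IsNullFrame (-1) z X Y) (v w : Fin 3 → ℂ) :
    herm v w = conj (herm z v) * herm z w - conj (herm Y v) * herm X w
      - conj (herm X v) * herm Y w := by
  conv_lhs => rw [← h.expand w]
  simp only [herm_sub_right, herm_smul_right, conj_herm]
  ring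

end IsNullFrame

/-- A linear map preserving `herm`, as an element of the unitary group. -/
def U12.ofMapHerm (A : (Fin 3 → ℂ) →ₗ[ℂ] (Fin 3 → ℂ)) (hA : ∀ v w, herm (A v) (A w) = herm v w) :
    U12 where
  toEquiv := LinearEquiv.ofInjectiveEndo A (by
    rw [injective_iff_map_eq_zero]
    intro v hv
    have h : ∀ w, herm w v = 0 := fun w => by rw [← hA, hv, herm_zero_right]
    have h0 := h (Pi.single 0 1)
    have h1 := h (Pi.single 1 1)
    have h2 := h (Pi.single 2 1)
    simp [herm] at h0 h1 h2
    ext i; fin_cases i <;> simp [*])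
  map_herm := hA

@[simp] lemma U12.ofMapHerm_apply (A : (Fin 3 → ℂ) →ₗ[ℂ] (Fin 3 → ℂ))
    (hA : ∀ v w, herm (A v) (A w) = herm v w) (v : Fin 3 → ℂ) :
    (U12.ofMapHerm A hA).toEquiv v = A v := rfl

lemma U12.congruence_hopf (A : U12) (z : S52) :
    A.congruence (hopf z) = hopf ⟨A.toEquiv z.1, (A.map_herm _ _).trans z.2⟩ := rfl

lemma hopf_eq_iff {z w : S52} : hopf z = hopf w ↔ ∃ c : ℂ, c ≠ 0 ∧ w.1 = c • z.1 :=
  Quotient.eq (r := hopfSetoid)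

/-! ### Partial derivatives in the plane -/

section Gradient

variable {E : Type*} [NormedAddCommGroup E] [NormedSpace ℝ E]
variable {E' : Type*} [NormedAddCommGroup E'] [NormedSpace ℝ E']
variable {E'' : Type*} [NormedAddCommGroup E''] [NormedSpace ℝ E'']

/-- The linear map on the plane with values `P` and `Q` on the two basis vectors. -/
def gradMap (P Q : E) : EuclideanSpace ℝ (Fin 2) →L[ℝ] E :=
  (EuclideanSpace.proj (𝕜 := ℝ) (0 : Fin 2)).smulRight P
    + (EuclideanSpace.proj (𝕜 := ℝ) (1 : Fin 2)).smulRight Q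

lemma gradMap_apply (P Q : E) (v : EuclideanSpace ℝ (Fin 2)) :
    gradMap P Q v = v 0 • P + v 1 • Q := rfl

@[simp] lemma gradMap_single_zero (P Q : E) : gradMap P Q (EuclideanSpace.single 0 1) = P := by
  simp [gradMap_apply]

@[simp] lemma gradMap_single_one (P Q : E) : gradMap P Q (EuclideanSpace.single 1 1) = Q := by
  simp [gradMap_apply]

lemma plane_eq (v : EuclideanSpace ℝ (Fin 2)) :
    v = v 0 • EuclideanSpace.single 0 (1 : ℝ) + v 1 • EuclideanSpace.single 1 (1 : ℝ) := by
  ext i; fin_cases i <;> simp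

lemma map_plane (A : EuclideanSpace ℝ (Fin 2) →L[ℝ] E) (v : EuclideanSpace ℝ (Fin 2)) :
    A v = v 0 • A (EuclideanSpace.single 0 1) + v 1 • A (EuclideanSpace.single 1 1) := by
  conv_lhs => rw [plane_eq v]
  simp

lemma eq_gradMap (A : EuclideanSpace ℝ (Fin 2) →L[ℝ] E) :
    A = gradMap (A (EuclideanSpace.single 0 1)) (A (EuclideanSpace.single 1 1)) := by
  ext v
  rw [gradMap_apply, ← map_plane]

/-- `F` is differentiable at `u`, with partial derivatives `P` and `Q`. -/
def HasGradAt (F : EuclideanSpace ℝ (Fin 2) → E) (P Q : E) (u : EuclideanSpace ℝ (Fin 2)) : Prop :=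
  HasFDerivAt F (gradMap P Q) u

variable {F G : EuclideanSpace ℝ (Fin 2) → E} {P Q P' Q' : E} {u : EuclideanSpace ℝ (Fin 2)}

lemma _root_.DifferentiableAt.hasGradAt (h : DifferentiableAt ℝ F u) :
    HasGradAt F (fderiv ℝ F u (EuclideanSpace.single 0 1))
      (fderiv ℝ F u (EuclideanSpace.single 1 1)) u := by
  rw [HasGradAt, ← eq_gradMap]
  exact h.hasFDerivAt

namespace HasGradAt

lemma congr (h : HasGradAt F P Q u) (hP : P = P') (hQ : Q = Q') : HasGradAt F P' Q' u := by
  rwa [← hP, ← hQ]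

lemma fderiv_zero (h : HasGradAt F P Q u) : fderiv ℝ F u (EuclideanSpace.single 0 1) = P := by
  rw [HasFDerivAt.fderiv h, gradMap_single_zero]

lemma fderiv_one (h : HasGradAt F P Q u) : fderiv ℝ F u (EuclideanSpace.single 1 1) = Q := by
  rw [HasFDerivAt.fderiv h, gradMap_single_one]

lemma unique (h : HasGradAt F P Q u) (h' : HasGradAt F P' Q' u) : P = P' ∧ Q = Q' :=
  ⟨h.fderiv_zero.symm.trans h'.fderiv_zero, h.fderiv_one.symm.trans h'.fderiv_one⟩

lemma congr_of_eventuallyEq (h : HasGradAt F P Q u) (hG : G =ᶠ[nhds u] F) : HasGradAt G P Q u :=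
  HasFDerivAt.congr_of_eventuallyEq h hG

lemma of_hasFDerivAt {A : EuclideanSpace ℝ (Fin 2) →L[ℝ] E} (h : HasFDerivAt F A u)
    (hP : A (EuclideanSpace.single 0 1) = P) (hQ : A (EuclideanSpace.single 1 1) = Q) :
    HasGradAt F P Q u := by
  rwa [HasGradAt, ← hP, ← hQ, ← eq_gradMap]

lemma add (h : HasGradAt F P Q u) (h' : HasGradAt G P' Q' u) :
    HasGradAt (fun x => F x + G x) (P + P') (Q + Q') u :=
  of_hasFDerivAt (HasFDerivAt.fun_add h h') (by simp) (by simp)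

lemma sub (h : HasGradAt F P Q u) (h' : HasGradAt G P' Q' u) :
    HasGradAt (fun x => F x - G x) (P - P') (Q - Q') u :=
  of_hasFDerivAt (HasFDerivAt.fun_sub h h') (by simp) (by simp)

lemma bilin (B : E →L[ℝ] E' →L[ℝ] E'') (h : HasGradAt F P Q u)
    {F' : EuclideanSpace ℝ (Fin 2) → E'} {R S : E'} (h' : HasGradAt F' R S u) :
    HasGradAt (fun x => B (F x) (F' x)) (B P (F' u) + B (F u) R) (B Q (F' u) + B (F u) S) u :=
  of_hasFDerivAt (B.hasFDerivAt_of_bilinear h h') (by simp [add_comm]) (by simp [add_comm])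

lemma clm (B : E →L[ℝ] E') (h : HasGradAt F P Q u) :
    HasGradAt (fun x => B (F x)) (B P) (B Q) u :=
  of_hasFDerivAt (B.hasFDerivAt.comp u h) (by simp) (by simp)

lemma herm {F G : EuclideanSpace ℝ (Fin 2) → Fin 3 → ℂ} {P Q P' Q' : Fin 3 → ℂ}
    (h : HasGradAt F P Q u) (h' : HasGradAt G P' Q' u) :
    HasGradAt (fun x => herm (F x) (G x)) (SlantCP.herm P (G u) + SlantCP.herm (F u) P')
      (SlantCP.herm Q (G u) + SlantCP.herm (F u) Q') u :=
  h.bilin hermL h'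

lemma smul [NormedSpace ℂ E] {c : EuclideanSpace ℝ (Fin 2) → ℂ} {c₁ c₂ : ℂ}
    (hc : HasGradAt c c₁ c₂ u) (h : HasGradAt F P Q u) :
    HasGradAt (fun x => c x • F x) (c₁ • F u + c u • P) (c₂ • F u + c u • Q) u := by
  exact hc.bilin (ContinuousLinearMap.lsmul ℝ ℂ (E := E)) h

lemma const_smul [NormedSpace ℂ E] (c : ℂ) (h : HasGradAt F P Q u) :
    HasGradAt (fun x => c • F x) (c • P) (c • Q) u :=
  h.clm (ContinuousLinearMap.lsmul ℝ ℂ (E := E) c)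

lemma mul {c d : EuclideanSpace ℝ (Fin 2) → ℂ} {c₁ c₂ d₁ d₂ : ℂ}
    (hc : HasGradAt c c₁ c₂ u) (hd : HasGradAt d d₁ d₂ u) :
    HasGradAt (fun x => c x * d x) (c₁ * d u + c u * d₁) (c₂ * d u + c u * d₂) u :=
  hc.smul hd

lemma const (c : E) : HasGradAt (fun _ => c) 0 0 u :=
  of_hasFDerivAt (hasFDerivAt_const c u) rfl rfl

end HasGradAt

/-- Symmetry of mixed partial derivatives. -/
lemma mixed_partials {D : Set (EuclideanSpace ℝ (Fin 2))} (hD : IsOpen D)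
    {P Q : EuclideanSpace ℝ (Fin 2) → E} (hF : ∀ u ∈ D, HasGradAt F (P u) (Q u) u)
    (hu : u ∈ D) {P₁ P₂ Q₁ Q₂ : E} (hP : HasGradAt P P₁ P₂ u) (hQ : HasGradAt Q Q₁ Q₂ u) :
    P₂ = Q₁ := by
  have h : HasFDerivAt (fun x => gradMap (P x) (Q x))
      ((ContinuousLinearMap.smulRightL ℝ _ E (EuclideanSpace.proj (𝕜 := ℝ) (0 : Fin 2))).comp
        (gradMap P₁ P₂) + (ContinuousLinearMap.smulRightL ℝ _ E
          (EuclideanSpace.proj (𝕜 := ℝ) (1 : Fin 2))).comp (gradMap Q₁ Q₂)) u :=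
    HasFDerivAt.add (((ContinuousLinearMap.smulRightL ℝ _ E
        (EuclideanSpace.proj (𝕜 := ℝ) (0 : Fin 2))).hasFDerivAt).comp u hP)
      (((ContinuousLinearMap.smulRightL ℝ _ E
        (EuclideanSpace.proj (𝕜 := ℝ) (1 : Fin 2))).hasFDerivAt).comp u hQ)
  have := second_derivative_symmetric_of_eventually
    (Filter.eventually_of_mem (hD.mem_nhds hu) hF) h (EuclideanSpace.single 0 1)
      (EuclideanSpace.single 1 1)
  simpa using this.symm

/-- A function with vanishing partial derivatives on a convex set is constant. -/
lemma eq_of_grad_eq_zero {D : Set (EuclideanSpace ℝ (Fin 2))} (hD : Convex ℝ D)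
    (hF : ∀ u ∈ D, HasGradAt F 0 0 u) {u v : EuclideanSpace ℝ (Fin 2)} (hu : u ∈ D) (hv : v ∈ D) :
    F u = F v := by
  have h0 : gradMap (0 : E) 0 = 0 := by ext v; simp [gradMap_apply]
  have h := hD.norm_image_sub_le_of_norm_hasFDerivWithin_le (C := 0)
    (fun x hx => HasFDerivAt.hasFDerivWithinAt (hF x hx)) (fun x _ => by simp [h0]) hv hu
  simpa [sub_eq_zero] using h

end Gradient

/-! ### The structure equations of the model surface -/

/-- The functions `F, X, Y` solve the structure equations of `Ltilde 1` on the set `D`. -/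
structure IsModelSolution (D : Set (EuclideanSpace ℝ (Fin 2)))
    (F X Y : EuclideanSpace ℝ (Fin 2) → Fin 3 → ℂ) : Prop where
  frame : ∀ u ∈ D, IsNullFrame (-1) (F u) (X u) (Y u)
  dF : ∀ u ∈ D, HasGradAt F (X u) (Y u) u
  dX : ∀ u ∈ D, HasGradAt X (Complex.I • Y u) (F u) u
  dY : ∀ u ∈ D, HasGradAt Y (F u) (-Complex.I • X u) u

/-- The linear map that sends the null frame `F₀, X₀, Y₀` to `F, X, Y`. -/
def frameTransfer (F₀ X₀ Y₀ F X Y : Fin 3 → ℂ) : (Fin 3 → ℂ) →ₗ[ℂ] (Fin 3 → ℂ) where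
  toFun v := herm F₀ v • F - herm Y₀ v • X - herm X₀ v • Y
  map_add' v w := by simp only [herm_add_right, add_smul]; abel
  map_smul' c v := by simp only [herm_smul_right, mul_smul, smul_sub, RingHom.id_apply]

lemma frameTransfer_apply (F₀ X₀ Y₀ F X Y v : Fin 3 → ℂ) :
    frameTransfer F₀ X₀ Y₀ F X Y v = herm F₀ v • F - herm Y₀ v • X - herm X₀ v • Y := rfl

namespace IsNullFrame

variable {F X Y F₀ X₀ Y₀ : Fin 3 → ℂ}

lemma frameTransfer_base (h₀ : IsNullFrame (-1) F₀ X₀ Y₀) :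
    frameTransfer F₀ X₀ Y₀ F X Y F₀ = F := by
  simp [frameTransfer_apply, h₀.zz, h₀.Xz, h₀.Yz]

lemma herm_frameTransfer (h : IsNullFrame (-1) F X Y) (h₀ : IsNullFrame (-1) F₀ X₀ Y₀)
    (v w : Fin 3 → ℂ) :
    herm (frameTransfer F₀ X₀ Y₀ F X Y v) (frameTransfer F₀ X₀ Y₀ F X Y w) = herm v w := by
  rw [h₀.herm_eq v w]
  simp only [frameTransfer_apply, herm_sub_left, herm_sub_right, herm_smul_left, herm_smul_right,
    h.zz, h.zX, h.zY, h.XX, h.YY, h.XY, h.Xz, h.Yz, h.YX]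
  simp only [map_neg, map_one]
  ring

end IsNullFrame

namespace IsModelSolution

variable {D : Set (EuclideanSpace ℝ (Fin 2))}
  {F X Y F₀ X₀ Y₀ : EuclideanSpace ℝ (Fin 2) → Fin 3 → ℂ}

/-- Both frames obey the same linear system, whose coefficient matrices are skew for b. In the
derivative of the transfer map the terms from the source frame therefore cancel those from the
target frame. -/
lemma frameTransfer_const (hD : Convex ℝ D) (h : IsModelSolution D F X Y)
    (h₀ : IsModelSolution D F₀ X₀ Y₀) {u v : EuclideanSpace ℝ (Fin 2)} (hu : u ∈ D) (hv : v ∈ D) :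
    frameTransfer (F₀ u) (X₀ u) (Y₀ u) (F u) (X u) (Y u)
      = frameTransfer (F₀ v) (X₀ v) (Y₀ v) (F v) (X v) (Y v) := by
  refine LinearMap.ext fun x => ?_
  refine eq_of_grad_eq_zero (F := fun u => frameTransfer (F₀ u) (X₀ u) (Y₀ u) (F u) (X u) (Y u) x)
    hD (fun w hw => ?_) hu hv
  have hx := HasGradAt.const (u := w) x
  refine HasGradAt.congr (((((h₀.dF w hw).herm hx).smul (h.dF w hw)).sub
    (((h₀.dY w hw).herm hx).smul (h.dX w hw))).sub (((h₀.dX w hw).herm hx).smul (h.dY w hw))) ?_ ?_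
  · simp only [herm_zero_right, add_zero, herm_smul_left, smul_smul, Complex.conj_I]
    module
  · simp only [herm_zero_right, add_zero, herm_smul_left, smul_smul, map_neg, Complex.conj_I]
    module

lemma exists_unitary (hD : Convex ℝ D) (h : IsModelSolution D F X Y)
    (h₀ : IsModelSolution D F₀ X₀ Y₀) (hne : D.Nonempty) :
    ∃ A : U12, ∀ u ∈ D, F u = A.toEquiv (F₀ u) := by
  obtain ⟨u₀, hu₀⟩ := hne
  refine ⟨U12.ofMapHerm _ ((h.frame u₀ hu₀).herm_frameTransfer (h₀.frame u₀ hu₀)), fun u hu => ?_⟩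
  rw [U12.ofMapHerm_apply, h.frameTransfer_const hD h₀ hu₀ hu, (h₀.frame u hu).frameTransfer_base]

/-- Uniqueness for the initial value problem: equal frames at one point make the constant transfer
map the identity. -/
lemma eqOn (hD : Convex ℝ D) (h : IsModelSolution D F X Y) (h₀ : IsModelSolution D F₀ X₀ Y₀)
    {u₀ : EuclideanSpace ℝ (Fin 2)} (hu₀ : u₀ ∈ D) (hF : F u₀ = F₀ u₀) (hX : X u₀ = X₀ u₀)
    (hY : Y u₀ = Y₀ u₀) {u : EuclideanSpace ℝ (Fin 2)} (hu : u ∈ D) : F u = F₀ u := by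
  rw [← (h₀.frame u hu).frameTransfer_base (F := F u) (X := X u) (Y := Y u),
    h.frameTransfer_const hD h₀ hu hu₀, hF, hX, hY, frameTransfer_apply,
    (h₀.frame u₀ hu₀).expand]

end IsModelSolution

lemma hasGradAt_coord_zero (u : EuclideanSpace ℝ (Fin 2)) :
    HasGradAt (fun u => ((u 0 : ℝ) : ℂ)) 1 0 u :=
  (HasGradAt.of_hasFDerivAt (P := (1 : ℝ)) (Q := 0)
    (EuclideanSpace.proj (𝕜 := ℝ) (0 : Fin 2)).hasFDerivAt (by simp) (by simp)).clm
      Complex.ofRealCLM |>.congr (by simp) (by simp)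

lemma hasGradAt_coord_one (u : EuclideanSpace ℝ (Fin 2)) :
    HasGradAt (fun u => ((u 1 : ℝ) : ℂ)) 0 1 u :=
  (HasGradAt.of_hasFDerivAt (P := (0 : ℝ)) (Q := 1)
    (EuclideanSpace.proj (𝕜 := ℝ) (1 : Fin 2)).hasFDerivAt (by simp) (by simp)).clm
      Complex.ofRealCLM |>.congr (by simp) (by simp)

lemma HasGradAt.cexp {c : EuclideanSpace ℝ (Fin 2) → ℂ} {c₁ c₂ : ℂ}
    {u : EuclideanSpace ℝ (Fin 2)} (h : HasGradAt c c₁ c₂ u) :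
    HasGradAt (fun u => Complex.exp (c u)) (Complex.exp (c u) * c₁) (Complex.exp (c u) * c₂) u :=
  of_hasFDerivAt (HasFDerivAt.cexp h) (by simp) (by simp)

lemma HasGradAt.vec3 {c d e : EuclideanSpace ℝ (Fin 2) → ℂ} {c₁ c₂ d₁ d₂ e₁ e₂ : ℂ}
    {u : EuclideanSpace ℝ (Fin 2)} (hc : HasGradAt c c₁ c₂ u) (hd : HasGradAt d d₁ d₂ u)
    (he : HasGradAt e e₁ e₂ u) :
    HasGradAt (fun u => ![c u, d u, e u]) ![c₁, d₁, e₁] ![c₂, d₂, e₂] u := by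
  refine hasFDerivAt_pi'.mpr fun i => ?_
  fin_cases i
  · exact HasFDerivAt.congr_fderiv hc (by ext v; simp [gradMap_apply])
  · exact HasFDerivAt.congr_fderiv hd (by ext v; simp [gradMap_apply])
  · exact HasFDerivAt.congr_fderiv he (by ext v; simp [gradMap_apply])

/-! ### The model surface -/

/-- The cube root `e^{iπ/6}` of `i`. -/
def modelRoot : ℂ := (((Real.sqrt 3 : ℝ) : ℂ) + Complex.I) / 2

lemma sqrt_three_sq : ((Real.sqrt 3 : ℝ) : ℂ) ^ 2 = 3 := by
  rw [← Complex.ofReal_pow, Real.sq_sqrt (by norm_num)]; norm_num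

lemma sqrt_two_sq : ((Real.sqrt 2 : ℝ) : ℂ) ^ 2 = 2 := by
  rw [← Complex.ofReal_pow, Real.sq_sqrt (by norm_num)]; norm_num

lemma conj_modelRoot : conj modelRoot = (((Real.sqrt 3 : ℝ) : ℂ) - Complex.I) / 2 := by
  have h : conj (2 : ℂ) = 2 := Complex.conj_ofNat 2
  simp [modelRoot, sub_eq_add_neg, h]

lemma modelRoot_mul_conj : modelRoot * conj modelRoot = 1 := by
  rw [conj_modelRoot, modelRoot]
  linear_combination sqrt_three_sq / 4 - Complex.I_sq / 4

lemma modelRoot_sq : modelRoot ^ 2 = Complex.I * conj modelRoot := by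
  rw [conj_modelRoot, modelRoot]
  linear_combination sqrt_three_sq / 4 + 3 * Complex.I_sq / 4

lemma conj_modelRoot_sq : conj modelRoot ^ 2 = -(Complex.I * modelRoot) := by
  rw [conj_modelRoot, modelRoot]
  linear_combination sqrt_three_sq / 4 + 3 * Complex.I_sq / 4

/-- The exponential `e^{μx + νy}`. -/
def planeExp (μ ν : ℂ) (u : EuclideanSpace ℝ (Fin 2)) : ℂ :=
  Complex.exp (μ * (u 0 : ℝ) + ν * (u 1 : ℝ))

lemma hasGradAt_planeExp (μ ν : ℂ) (u : EuclideanSpace ℝ (Fin 2)) :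
    HasGradAt (planeExp μ ν) (μ * planeExp μ ν u) (ν * planeExp μ ν u) u :=
  (((hasGradAt_coord_zero u).const_smul μ).add
    ((hasGradAt_coord_one u).const_smul ν)).cexp.congr
      (by simp [planeExp, mul_comm]) (by simp [planeExp, mul_comm])

lemma conj_planeExp (μ ν : ℂ) (u : EuclideanSpace ℝ (Fin 2)) :
    conj (planeExp μ ν u) = planeExp (conj μ) (conj ν) u := by
  simp [planeExp, ← Complex.exp_conj]

lemma planeExp_mul (μ ν μ' ν' : ℂ) (u : EuclideanSpace ℝ (Fin 2)) :
    planeExp μ ν u * planeExp μ' ν' u = planeExp (μ + μ') (ν + ν') u := by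
  simp only [planeExp, ← Complex.exp_add]; congr 1; ring

/-- The combination of the three basic exponentials with coefficients `c, d, e`. -/
def modelCurve (c d e : ℂ) (u : EuclideanSpace ℝ (Fin 2)) : Fin 3 → ℂ :=
  (((Real.sqrt 3 : ℝ) : ℂ)⁻¹ * ((Real.sqrt 2 : ℝ) : ℂ) / 2) •
    ![c * planeExp modelRoot (conj modelRoot) u
        - d * planeExp (-conj modelRoot) (-modelRoot) u,
      ((Real.sqrt 2 : ℝ) : ℂ) * e * planeExp (-Complex.I) Complex.I u,
      c * planeExp modelRoot (conj modelRoot) u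
        + d * planeExp (-conj modelRoot) (-modelRoot) u]

lemma hasGradAt_modelCurve (c d e : ℂ) (u : EuclideanSpace ℝ (Fin 2)) :
    HasGradAt (modelCurve c d e)
      (modelCurve (modelRoot * c) (-conj modelRoot * d) (-Complex.I * e) u)
      (modelCurve (conj modelRoot * c) (-modelRoot * d) (Complex.I * e) u) u := by
  have h1 := (hasGradAt_planeExp modelRoot (conj modelRoot) u).const_smul c
  have h2 := (hasGradAt_planeExp (-conj modelRoot) (-modelRoot) u).const_smul d
  have h3 := (hasGradAt_planeExp (-Complex.I) Complex.I u).const_smul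
    (((Real.sqrt 2 : ℝ) : ℂ) * e)
  refine (((h1.sub h2).vec3 h3 (h1.add h2)).const_smul _).congr ?_ ?_ <;>
  · rw [modelCurve]
    congr 1
    ext i; fin_cases i <;> simp <;> ring

/-- The first two exponentials are conjugate-inverse to each other and the third has modulus one, so
all dependence on the point cancels. The first and third coordinates, difference and sum of the c
and d terms, are null coordinates for the Lorentzian part of b. -/
lemma herm_modelCurve (c d e c' d' e' : ℂ) (u : EuclideanSpace ℝ (Fin 2)) :
    herm (modelCurve c d e u) (modelCurve c' d' e' u)
      = (conj c * d' + conj d * c' + conj e * e') / 3 := by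
  have h1 : conj (planeExp modelRoot (conj modelRoot) u)
      * planeExp (-conj modelRoot) (-modelRoot) u = 1 := by
    rw [conj_planeExp, planeExp_mul]; simp [planeExp]
  have h2 : conj (planeExp (-conj modelRoot) (-modelRoot) u)
      * planeExp modelRoot (conj modelRoot) u = 1 := by
    rw [conj_planeExp, planeExp_mul]; simp [planeExp]
  have h3 : conj (planeExp (-Complex.I) Complex.I u) * planeExp (-Complex.I) Complex.I u = 1 := by
    rw [conj_planeExp, planeExp_mul]; simp [planeExp]
  have h4 := sqrt_three_sq
  have h5 := sqrt_two_sq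
  have h6 : ((Real.sqrt 3 : ℝ) : ℂ) ≠ 0 := by
    intro h; rw [h] at h4; norm_num at h4
  rw [modelCurve, modelCurve, herm_smul_smul]
  simp only [herm, Matrix.cons_val_zero, Matrix.cons_val_one, Matrix.cons_val, map_mul, map_sub,
    map_add, map_div₀, map_inv₀, Complex.conj_ofReal]
  have h7 : conj (2 : ℂ) = 2 := Complex.conj_ofNat 2
  rw [h7]
  generalize planeExp modelRoot (conj modelRoot) u = p at *
  generalize planeExp (-conj modelRoot) (-modelRoot) u = q at *
  generalize planeExp (-Complex.I) Complex.I u = r at *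
  generalize ((Real.sqrt 3 : ℝ) : ℂ) = s at *
  generalize ((Real.sqrt 2 : ℝ) : ℂ) = t at *
  have h8 : s⁻¹ ^ 2 = 1 / 3 := by rw [inv_pow, h4]; norm_num
  have h9 : s⁻¹ * t / 2 * (s⁻¹ * t / 2) = 1 / 6 := by
    linear_combination t ^ 2 / 4 * h8 + h5 / 12
  rw [h9]
  linear_combination (conj c * d' / 3) * h1 + (conj d * c' / 3) * h2
    + conj e * e' * (conj r * r / 6 * h5 + h3 / 3)

lemma modelCurve_eq_Ltilde (u : EuclideanSpace ℝ (Fin 2)) :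
    modelCurve 1 1 1 u = (Ltilde 1 (u 0) (u 1)).1 := by
  -- Splitting sinh and cosh into exponentials and absorbing the common phase gives the exponents of
  -- `modelCurve`.
  have key : ∀ x y : ℝ, Complex.exp ((((x - 1 ^ 2 * y) / (2 * 1) : ℝ) : ℂ) * Complex.I)
      * Complex.exp (((Real.sqrt 3 * (x + 1 ^ 2 * y) / (2 * 1) : ℝ) : ℂ))
      = Complex.exp (modelRoot * x + conj modelRoot * y) := by
    intro x y
    rw [← Complex.exp_add, conj_modelRoot, modelRoot]
    congr 1; push_cast; ring
  have key' : ∀ x y : ℝ, Complex.exp ((((x - 1 ^ 2 * y) / (2 * 1) : ℝ) : ℂ) * Complex.I)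
      * Complex.exp (-((Real.sqrt 3 * (x + 1 ^ 2 * y) / (2 * 1) : ℝ) : ℂ))
      = Complex.exp (-conj modelRoot * x + -modelRoot * y) := by
    intro x y
    rw [← Complex.exp_add, conj_modelRoot, modelRoot]
    congr 1; push_cast; ring
  have key'' : ∀ x y : ℝ, Complex.exp ((((1 ^ 2 * y - x) / 1 : ℝ) : ℂ) * Complex.I)
      = Complex.exp (-Complex.I * x + Complex.I * y) := by
    intro x y
    congr 1; push_cast; ring
  have h5 := sqrt_two_sq
  simp only [modelCurve, Ltilde, planeExp, ← key, ← key', ← key'', Complex.ofReal_sinh,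
    Complex.ofReal_cosh, Complex.sinh, Complex.cosh]
  ext i
  simp only [Pi.smul_apply, smul_eq_mul, one_div, Complex.ofReal_inv]
  fin_cases i
  · simp; ring
  · simp
    linear_combination ((Real.sqrt 3 : ℝ) : ℂ)⁻¹ * Complex.exp ((u.ofLp 1 - u.ofLp 0) * Complex.I) / 2 * h5
  · simp; ring

lemma smul_modelCurve (a c d e : ℂ) (u : EuclideanSpace ℝ (Fin 2)) :
    a • modelCurve c d e u = modelCurve (a * c) (a * d) (a * e) u := by
  ext i; fin_cases i <;> simp [modelCurve] <;> ring

/-- The system implies F_xxx = iF, F_yyy = -iF and F_xy = F. Its exponential solutions are e^{μx +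
μ̄y} with μ³ = i, that is μ = e^{iπ/6}, -e^{-iπ/6}, -i; the model combines all three. -/
lemma isModelSolution_modelCurve (D : Set (EuclideanSpace ℝ (Fin 2))) :
    IsModelSolution D (modelCurve 1 1 1)
      (modelCurve modelRoot (-conj modelRoot) (-Complex.I))
      (modelCurve (conj modelRoot) (-modelRoot) Complex.I) where
  frame u _ := by
    constructor <;> rw [herm_modelCurve] <;>
      simp only [map_neg, map_one, Complex.conj_I, Complex.conj_conj, neg_neg] <;>
      try rw [conj_modelRoot, modelRoot]
    · norm_num
    · ring
    · ring
    · linear_combination -1 / 6 * sqrt_three_sq - Complex.I_sq / 2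
    · linear_combination -1 / 6 * sqrt_three_sq - Complex.I_sq / 2
    · linear_combination -1 / 6 * sqrt_three_sq + Complex.I_sq / 2
  dF u _ := (hasGradAt_modelCurve _ _ _ u).congr (by simp) (by simp)
  dX u _ := by
    refine (hasGradAt_modelCurve _ _ _ u).congr ?_ ?_
    · rw [smul_modelCurve]
      congr 1
      · linear_combination modelRoot_sq
      · linear_combination conj_modelRoot_sq
      · ring
    · congr 1
      · linear_combination modelRoot_mul_conj
      · linear_combination modelRoot_mul_conj
      · linear_combination -Complex.I_sq
  dY u _ := by
    refine (hasGradAt_modelCurve _ _ _ u).congr ?_ ?_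
    · congr 1
      · linear_combination modelRoot_mul_conj
      · linear_combination modelRoot_mul_conj
      · linear_combination -Complex.I_sq
    · rw [smul_modelCurve]
      congr 1
      · linear_combination conj_modelRoot_sq
      · linear_combination modelRoot_sq
      · ring

/-! ### Minimal slant surfaces in flat null coordinates -/

lemma HasGradAt.eq_zero_of_const {E : Type*} [NormedAddCommGroup E] [NormedSpace ℝ E]
    {D : Set (EuclideanSpace ℝ (Fin 2))} (hD : IsOpen D) {F : EuclideanSpace ℝ (Fin 2) → E}
    {P Q c : E} {u : EuclideanSpace ℝ (Fin 2)} (h : HasGradAt F P Q u) (hu : u ∈ D)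
    (hc : ∀ v ∈ D, F v = c) : P = 0 ∧ Q = 0 :=
  h.unique ((HasGradAt.const c).congr_of_eventuallyEq
    (Filter.eventually_of_mem (hD.mem_nhds hu) hc))

/-- The lift `z` to the pseudosphere of a minimal surface in flat null coordinates with slant
invariant `k`. The horizontal parts of its partial derivatives are `X` and `Y`, and `a₁, a₂` are
the coefficients of the pulled back connection form of the Hopf fibration. -/
structure IsMinimalSlantLift (D : Set (EuclideanSpace ℝ (Fin 2))) (k : ℝ)
    (z X Y : EuclideanSpace ℝ (Fin 2) → Fin 3 → ℂ) (a₁ a₂ : EuclideanSpace ℝ (Fin 2) → ℂ) :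
    Prop where
  isOpen : IsOpen D
  smoothX : ContDiffOn ℝ ∞ X D
  smoothY : ContDiffOn ℝ ∞ Y D
  smooth₁ : ContDiffOn ℝ ∞ a₁ D
  smooth₂ : ContDiffOn ℝ ∞ a₂ D
  frame : ∀ u ∈ D, IsNullFrame (-1 + k * Complex.I) (z u) (X u) (Y u)
  dz : ∀ u ∈ D, HasGradAt z (X u + a₁ u • z u) (Y u + a₂ u • z u) u
  minX : ∀ u ∈ D, herm (X u) (fderiv ℝ Y u (EuclideanSpace.single 0 1) - a₁ u • Y u) = 0
  minY : ∀ u ∈ D, herm (Y u) (fderiv ℝ Y u (EuclideanSpace.single 0 1) - a₁ u • Y u) = 0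

/-! ### Frame equations of the lift and their integrability conditions -/

namespace IsMinimalSlantLift

variable {D : Set (EuclideanSpace ℝ (Fin 2))} {k : ℝ}
  {z X Y : EuclideanSpace ℝ (Fin 2) → Fin 3 → ℂ} {a₁ a₂ : EuclideanSpace ℝ (Fin 2) → ℂ}
  {u : EuclideanSpace ℝ (Fin 2)}

lemma slant_ne_zero (k : ℝ) : -1 + k * Complex.I ≠ 0 := by
  intro h
  have := congrArg Complex.re h
  simp at this

section

variable {E : Type*} [NormedAddCommGroup E] [NormedSpace ℝ E]

lemma _root_.ContDiffOn.hasGradAt {F : EuclideanSpace ℝ (Fin 2) → E} (h : ContDiffOn ℝ ∞ F D)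
    (hD : IsOpen D) (hu : u ∈ D) :
    HasGradAt F (fderiv ℝ F u (EuclideanSpace.single 0 1))
      (fderiv ℝ F u (EuclideanSpace.single 1 1)) u :=
  ((h.contDiffAt (hD.mem_nhds hu)).differentiableAt (by simp)).hasGradAt

lemma _root_.ContDiffOn.fderiv_apply_const {F : EuclideanSpace ℝ (Fin 2) → E}
    (h : ContDiffOn ℝ ∞ F D) (hD : IsOpen D) (v : EuclideanSpace ℝ (Fin 2)) :
    ContDiffOn ℝ ∞ (fun u => fderiv ℝ F u v) D :=
  (h.fderiv_of_isOpen hD (m := ∞) (by simp)).clm_apply contDiffOn_const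

end

/-- Differentiating b(z, z) = 1 shows that the connection coefficients are purely imaginary. -/
lemma conj_coeff (h : IsMinimalSlantLift D k z X Y a₁ a₂) (hu : u ∈ D) :
    conj (a₁ u) = -a₁ u ∧ conj (a₂ u) = -a₂ u := by
  have hf := h.frame u hu
  have := ((h.dz u hu).herm (h.dz u hu)).eq_zero_of_const h.isOpen hu fun v hv => (h.frame v hv).zz
  simp only [herm_add_left, herm_add_right, herm_smul_left, herm_smul_right, hf.zz, hf.zX, hf.zY,
    hf.Xz, hf.Yz] at this
  exact ⟨by linear_combination this.1, by linear_combination this.2⟩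

/-- Minimality kills the horizontal part of Y_x - a₁Y, and differentiating b(z, Y) = 0 gives its
z-component, -β. -/
lemma dY_zero (h : IsMinimalSlantLift D k z X Y a₁ a₂) (hu : u ∈ D) :
    fderiv ℝ Y u (EuclideanSpace.single 0 1) = a₁ u • Y u - (-1 + k * Complex.I) • z u := by
  have hf := h.frame u hu
  have h1 := (((h.dz u hu).herm (h.smoothY.hasGradAt h.isOpen hu)).eq_zero_of_const h.isOpen hu
    fun v hv => (h.frame v hv).zY).1
  have h2 := h.minX u hu
  have h3 := h.minY u hu
  have h4 := slant_ne_zero k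
  simp only [herm_add_left, herm_smul_left, herm_sub_right, herm_smul_right, hf.zY, hf.XY,
    hf.YY] at h1 h2 h3
  refine hf.ext h4 ?_ ?_ ?_ <;>
    simp only [herm_sub_right, herm_smul_right, hf.zz, hf.zY, hf.XY, hf.YY, hf.Xz, hf.Yz]
  · linear_combination h1
  · linear_combination h2
  · linear_combination h3

/-- Equality of the mixed partials of z expresses X_y through Y_x. Its z-component is compared with
the one obtained from b(z, X) = 0; the difference is the curvature of the Hopf connection, pulled
back to the surface. -/
lemma dX_one_and_curvature (h : IsMinimalSlantLift D k z X Y a₁ a₂) (hu : u ∈ D) :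
    fderiv ℝ X u (EuclideanSpace.single 1 1) = a₂ u • X u - conj (-1 + k * Complex.I) • z u ∧
    fderiv ℝ a₂ u (EuclideanSpace.single 0 1) - fderiv ℝ a₁ u (EuclideanSpace.single 1 1)
      = (-1 + k * Complex.I) - conj (-1 + k * Complex.I) := by
  have hf := h.frame u hu
  have hX := h.smoothX.hasGradAt h.isOpen hu
  have hY := h.smoothY.hasGradAt h.isOpen hu
  have h₁ := h.smooth₁.hasGradAt h.isOpen hu
  have h₂ := h.smooth₂.hasGradAt h.isOpen hu
  have h1 := (((h.dz u hu).herm hX).eq_zero_of_const h.isOpen hu fun v hv => (h.frame v hv).zX).2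
  have h2 := mixed_partials h.isOpen h.dz hu (hX.add (h₁.smul (h.dz u hu)))
    (hY.add (h₂.smul (h.dz u hu)))
  rw [h.dY_zero hu] at h2
  have hc : conj (-1 + k * Complex.I) = herm (Y u) (X u) := hf.YX.symm
  simp only [herm_add_left, herm_smul_left, hf.zX] at h1
  have h3 := congrArg (herm (z u)) h2
  simp only [herm_add_right, herm_sub_right, herm_smul_right, hf.zz, hf.zX, hf.zY] at h3
  have h4 : fderiv ℝ a₂ u (EuclideanSpace.single 0 1) - fderiv ℝ a₁ u (EuclideanSpace.single 1 1)
      = (-1 + k * Complex.I) - conj (-1 + k * Complex.I) := by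
    rw [hc]; linear_combination -h3 + h1
  refine ⟨?_, h4⟩
  rw [← sub_eq_zero] at h2 ⊢
  rw [← h2, sub_eq_iff_eq_add.mp h4]
  module

/-- The coefficient of `∇_x X` with respect to `Y`. -/
def coeffX (k : ℝ) (X : EuclideanSpace ℝ (Fin 2) → Fin 3 → ℂ) (u : EuclideanSpace ℝ (Fin 2)) : ℂ :=
  (-1 + k * Complex.I)⁻¹ * herm (X u) (fderiv ℝ X u (EuclideanSpace.single 0 1))

/-- The coefficient of `∇_y Y` with respect to `X`. -/
def coeffY (k : ℝ) (Y : EuclideanSpace ℝ (Fin 2) → Fin 3 → ℂ) (u : EuclideanSpace ℝ (Fin 2)) : ℂ :=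
  (conj (-1 + k * Complex.I))⁻¹ * herm (Y u) (fderiv ℝ Y u (EuclideanSpace.single 1 1))

/-- The pairings with z and Y come from differentiating b(z, X) = 0 and b(Y, X) = β̄; only the
pairing with X stays free, and it is recorded by `coeffX`. -/
lemma dX_zero (h : IsMinimalSlantLift D k z X Y a₁ a₂) (hu : u ∈ D) :
    fderiv ℝ X u (EuclideanSpace.single 0 1) = a₁ u • X u + coeffX k X u • Y u := by
  have hf := h.frame u hu
  have hX := h.smoothX.hasGradAt h.isOpen hu
  have hY := h.smoothY.hasGradAt h.isOpen hu
  have h4 := slant_ne_zero k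
  have h1 := (((h.dz u hu).herm hX).eq_zero_of_const h.isOpen hu fun v hv => (h.frame v hv).zX).1
  have h2 := ((hY.herm hX).eq_zero_of_const h.isOpen hu fun v hv => (h.frame v hv).YX).1
  rw [h.dY_zero hu] at h2
  simp only [herm_add_left, herm_sub_left, herm_smul_left, hf.zX, hf.XX, hf.YX,
    (h.conj_coeff hu).1] at h1 h2
  refine hf.ext h4 ?_ ?_ ?_ <;>
    simp only [herm_add_right, herm_smul_right, hf.zX, hf.XX, hf.YX, hf.zY, hf.XY, hf.YY]
  · linear_combination h1
  · rw [coeffX]; field_simp; ring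
  · linear_combination h2

lemma dY_one (h : IsMinimalSlantLift D k z X Y a₁ a₂) (hu : u ∈ D) :
    fderiv ℝ Y u (EuclideanSpace.single 1 1) = a₂ u • Y u + coeffY k Y u • X u := by
  have hf := h.frame u hu
  have hX := h.smoothX.hasGradAt h.isOpen hu
  have hY := h.smoothY.hasGradAt h.isOpen hu
  have h4 := slant_ne_zero k
  have h5 : conj (-1 + k * Complex.I) ≠ 0 := (map_ne_zero _).mpr h4
  have h1 := (((h.dz u hu).herm hY).eq_zero_of_const h.isOpen hu fun v hv => (h.frame v hv).zY).2
  have h2 := ((hX.herm hY).eq_zero_of_const h.isOpen hu fun v hv => (h.frame v hv).XY).2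
  rw [(h.dX_one_and_curvature hu).1] at h2
  simp only [herm_add_left, herm_sub_left, herm_smul_left, hf.zY, hf.YY, hf.XY,
    (h.conj_coeff hu).2] at h1 h2
  refine hf.ext h4 ?_ ?_ ?_ <;>
    simp only [herm_add_right, herm_smul_right, hf.zX, hf.XX, hf.YX, hf.zY, hf.XY, hf.YY]
  · linear_combination h1
  · linear_combination h2
  · rw [coeffY, mul_right_comm, inv_mul_cancel₀ h5]; ring

/-- The quantity is b(X, X_x), whose real part vanishes because b(X, X) = 0 is constant. -/
lemma conj_coeffX (h : IsMinimalSlantLift D k z X Y a₁ a₂) (hu : u ∈ D) :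
    conj ((-1 + k * Complex.I) * coeffX k X u) = -((-1 + k * Complex.I) * coeffX k X u) := by
  have hX := h.smoothX.hasGradAt h.isOpen hu
  have h1 := ((hX.herm hX).eq_zero_of_const h.isOpen hu fun v hv => (h.frame v hv).XX).1
  rw [coeffX, mul_inv_cancel_left₀ (slant_ne_zero k), conj_herm]
  linear_combination h1

lemma smooth_coeffX (h : IsMinimalSlantLift D k z X Y a₁ a₂) : ContDiffOn ℝ ∞ (coeffX k X) D := by
  have h1 := h.smoothX.fderiv_apply_const h.isOpen (EuclideanSpace.single 0 1)
  exact contDiffOn_const.mul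
    (hermL.isBoundedBilinearMap.contDiff.comp_contDiffOn (h.smoothX.prodMk h1))

lemma smooth_coeffY (h : IsMinimalSlantLift D k z X Y a₁ a₂) : ContDiffOn ℝ ∞ (coeffY k Y) D := by
  have h1 := h.smoothY.fderiv_apply_const h.isOpen (EuclideanSpace.single 1 1)
  exact contDiffOn_const.mul
    (hermL.isBoundedBilinearMap.contDiff.comp_contDiffOn (h.smoothY.prodMk h1))

/-- These are the Y- and X-components of X_xy = X_yx, extracted by pairing with X and Y
respectively. The first is a Codazzi equation, the second a Gauss equation into which the curvature
of the Hopf connection enters. -/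
lemma gauss_codazzi_X (h : IsMinimalSlantLift D k z X Y a₁ a₂) (hu : u ∈ D) :
    fderiv ℝ (coeffX k X) u (EuclideanSpace.single 1 1) = 0 ∧
    coeffX k X u * coeffY k Y u = (-1 + k * Complex.I) - 2 * conj (-1 + k * Complex.I) := by
  have hf := h.frame u hu
  have h4 := slant_ne_zero k
  have h5 : conj (-1 + k * Complex.I) ≠ 0 := (map_ne_zero _).mpr h4
  have hX := h.smoothX.hasGradAt h.isOpen hu
  have hY := h.smoothY.hasGradAt h.isOpen hu
  have h₁ := h.smooth₁.hasGradAt h.isOpen hu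
  have h₂ := h.smooth₂.hasGradAt h.isOpen hu
  have hq := h.smooth_coeffX.hasGradAt h.isOpen hu
  have h2 := mixed_partials h.isOpen (fun v hv => (h.smoothX.hasGradAt h.isOpen hv).congr
      (h.dX_zero hv) (h.dX_one_and_curvature hv).1) hu ((h₁.smul hX).add (hq.smul hY))
    ((h₂.smul hX).sub ((h.dz u hu).const_smul _))
  rw [(h.dX_one_and_curvature hu).1, h.dX_zero hu, h.dY_one hu] at h2
  have h6 := (h.dX_one_and_curvature hu).2
  have hx := congrArg (herm (X u)) h2
  have hy := congrArg (herm (Y u)) h2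
  simp only [herm_add_right, herm_sub_right, herm_smul_right, hf.XX, hf.YX, hf.XY, hf.YY,
    hf.Xz, hf.Yz] at hx hy
  constructor
  · exact (mul_eq_zero.mp (by linear_combination hx)).resolve_right h4
  · apply mul_right_cancel₀ h5
    linear_combination hy + conj (-1 + k * Complex.I) * h6

/-- The same integrability condition for Y. It yields a second value of the product with β and β̄
interchanged, and the clash between the two forces the slant invariant to vanish. -/
lemma gauss_codazzi_Y (h : IsMinimalSlantLift D k z X Y a₁ a₂) (hu : u ∈ D) :
    fderiv ℝ (coeffY k Y) u (EuclideanSpace.single 0 1) = 0 ∧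
    coeffX k X u * coeffY k Y u = conj (-1 + k * Complex.I) - 2 * (-1 + k * Complex.I) := by
  have hf := h.frame u hu
  have h4 := slant_ne_zero k
  have h5 : conj (-1 + k * Complex.I) ≠ 0 := (map_ne_zero _).mpr h4
  have hX := h.smoothX.hasGradAt h.isOpen hu
  have hY := h.smoothY.hasGradAt h.isOpen hu
  have h₁ := h.smooth₁.hasGradAt h.isOpen hu
  have h₂ := h.smooth₂.hasGradAt h.isOpen hu
  have hq := h.smooth_coeffY.hasGradAt h.isOpen hu
  have h2 := mixed_partials h.isOpen (fun v hv => (h.smoothY.hasGradAt h.isOpen hv).congr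
      (h.dY_zero hv) (h.dY_one hv)) hu ((h₁.smul hY).sub ((h.dz u hu).const_smul _))
    ((h₂.smul hY).add (hq.smul hX))
  rw [h.dY_zero hu, h.dX_zero hu, h.dY_one hu] at h2
  have h6 := (h.dX_one_and_curvature hu).2
  have hx := congrArg (herm (X u)) h2
  have hy := congrArg (herm (Y u)) h2
  simp only [herm_add_right, herm_sub_right, herm_smul_right, hf.XX, hf.YX, hf.XY, hf.YY,
    hf.Xz, hf.Yz] at hx hy
  constructor
  · exact (mul_eq_zero.mp (by linear_combination -hy)).resolve_right h5
  · apply mul_right_cancel₀ h4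
    linear_combination -hx - (-1 + k * Complex.I) * h6

/-- A minimal slant surface with a flat metric is Lagrangian. -/
lemma slant_eq_zero (h : IsMinimalSlantLift D k z X Y a₁ a₂) (hne : D.Nonempty) : k = 0 := by
  obtain ⟨u, hu⟩ := hne
  have h1 := (h.gauss_codazzi_X hu).2.symm.trans (h.gauss_codazzi_Y hu).2
  have h2 := congrArg Complex.im h1
  simp at h2
  linarith

end IsMinimalSlantLift

/-! ### Normalisation of the cubic form and of the phase -/

lemma exists_pow_three_mul_eq_one {l : ℝ} (hl : l ≠ 0) : ∃ s : ℝ, s ≠ 0 ∧ s ^ 3 * l = 1 := by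
  have key : ∀ m : ℝ, 0 < m → ∃ s : ℝ, s ≠ 0 ∧ s ^ 3 * m = 1 := fun m hm =>
    ⟨m⁻¹ ^ ((3 : ℕ)⁻¹ : ℝ), (Real.rpow_pos_of_pos (inv_pos.mpr hm) _).ne', by
      rw [Real.rpow_inv_natCast_pow (inv_pos.mpr hm).le (by norm_num), inv_mul_cancel₀ hm.ne']⟩
  rcases hl.lt_or_gt with h | h
  · obtain ⟨s, hs, h'⟩ := key (-l) (neg_pos.mpr h)
    exact ⟨-s, neg_ne_zero.mpr hs, by linear_combination h'⟩
  · exact key l h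

/-- The linear change of coordinates `(x, y) ↦ (s x, s⁻¹ y)`. -/
def planeScale (s : ℝ) (hs : s ≠ 0) : EuclideanSpace ℝ (Fin 2) ≃L[ℝ] EuclideanSpace ℝ (Fin 2) :=
  (LinearEquiv.ofLinearMap
    ((gradMap (EuclideanSpace.single 0 s) (EuclideanSpace.single 1 s⁻¹) :
      EuclideanSpace ℝ (Fin 2) →L[ℝ] EuclideanSpace ℝ (Fin 2)) :
      EuclideanSpace ℝ (Fin 2) →ₗ[ℝ] EuclideanSpace ℝ (Fin 2))
    ((gradMap (EuclideanSpace.single 0 s⁻¹) (EuclideanSpace.single 1 s) :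
      EuclideanSpace ℝ (Fin 2) →L[ℝ] EuclideanSpace ℝ (Fin 2)) :
      EuclideanSpace ℝ (Fin 2) →ₗ[ℝ] EuclideanSpace ℝ (Fin 2))
    (by ext v i; fin_cases i <;> simp [gradMap_apply, hs])
    (by ext v i; fin_cases i <;> simp [gradMap_apply, hs])).toContinuousLinearEquiv

lemma planeScale_apply (s : ℝ) (hs : s ≠ 0) (v : EuclideanSpace ℝ (Fin 2)) :
    planeScale s hs v = gradMap (EuclideanSpace.single 0 s) (EuclideanSpace.single 1 s⁻¹) v := rfl

lemma HasGradAt.comp_planeScale {E : Type*} [NormedAddCommGroup E] [NormedSpace ℝ E]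
    {F : EuclideanSpace ℝ (Fin 2) → E} {P Q : E} {s : ℝ} {hs : s ≠ 0}
    {u : EuclideanSpace ℝ (Fin 2)} (h : HasGradAt F P Q (planeScale s hs u)) :
    HasGradAt (fun u => F (planeScale s hs u)) (s • P) (s⁻¹ • Q) u :=
  of_hasFDerivAt (HasFDerivAt.comp u h (planeScale s hs).hasFDerivAt)
    (by simp [planeScale_apply, gradMap_apply]) (by simp [planeScale_apply, gradMap_apply])

namespace IsMinimalSlantLift

variable {D : Set (EuclideanSpace ℝ (Fin 2))} {k : ℝ}
  {z X Y : EuclideanSpace ℝ (Fin 2) → Fin 3 → ℂ} {a₁ a₂ : EuclideanSpace ℝ (Fin 2) → ℂ}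
  {u : EuclideanSpace ℝ (Fin 2)}

/-- The cubic form of a minimal Lagrangian surface is constant in flat null coordinates. -/
lemma exists_coeff (h : IsMinimalSlantLift D 0 z X Y a₁ a₂) (hD : Convex ℝ D) (hne : D.Nonempty) :
    ∃ l : ℝ, l ≠ 0 ∧ ∀ u ∈ D, coeffX 0 X u = l * Complex.I ∧ coeffY 0 Y u = -((l : ℂ)⁻¹ * Complex.I) := by
  obtain ⟨u₀, hu₀⟩ := hne
  have hmul : ∀ u ∈ D, coeffX 0 X u * coeffY 0 Y u = 1 := fun u hu => by
    rw [(h.gauss_codazzi_X hu).2]; simp; norm_num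
  have hdX : ∀ u ∈ D, fderiv ℝ (coeffX 0 X) u (EuclideanSpace.single 1 1) = 0 := fun u hu =>
    (h.gauss_codazzi_X hu).1
  have hdY : ∀ u ∈ D, fderiv ℝ (coeffY 0 Y) u (EuclideanSpace.single 0 1) = 0 := fun u hu =>
    (h.gauss_codazzi_Y hu).1
  -- Differentiating qr = 1 along x and using r_x = 0 gives q_x r = 0, with r nonzero.
  have hdX' : ∀ u ∈ D, fderiv ℝ (coeffX 0 X) u (EuclideanSpace.single 0 1) = 0 := fun u hu => by
    have h1 := (((h.smooth_coeffX.hasGradAt h.isOpen hu).mul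
      (h.smooth_coeffY.hasGradAt h.isOpen hu)).eq_zero_of_const h.isOpen hu hmul).1
    rw [hdY u hu, mul_zero, add_zero] at h1
    exact (mul_eq_zero.mp h1).resolve_right (right_ne_zero_of_mul_eq_one (hmul u hu))
  have hconst : ∀ u ∈ D, coeffX 0 X u = coeffX 0 X u₀ := fun u hu =>
    eq_of_grad_eq_zero hD (fun v hv =>
      (h.smooth_coeffX.hasGradAt h.isOpen hv).congr (hdX' v hv) (hdX v hv)) hu hu₀
  -- Here β = -1, so that βq imaginary means q imaginary.
  have him := h.conj_coeffX hu₀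
  have hq : coeffX 0 X u₀ = ((coeffX 0 X u₀).im : ℂ) * Complex.I := by
    have h2 := congrArg Complex.re him
    simp at h2
    apply Complex.ext
    · simp; linarith
    · simp
  have hl : (coeffX 0 X u₀).im ≠ 0 := fun h0 => by
    have := hmul u₀ hu₀
    rw [hq, h0] at this
    simp at this
  refine ⟨(coeffX 0 X u₀).im, hl, fun u hu => ?_⟩
  have h1 : coeffX 0 X u = ((coeffX 0 X u₀).im : ℂ) * Complex.I := (hconst u hu).trans hq
  refine ⟨h1, ?_⟩
  have h2 := hmul u hu
  rw [h1] at h2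
  have h3 : ((coeffX 0 X u₀).im : ℂ) ≠ 0 := Complex.ofReal_ne_zero.mpr hl
  generalize ((coeffX 0 X u₀).im : ℂ) = c at *
  field_simp
  linear_combination -Complex.I * h2 + c * coeffY 0 Y u * Complex.I_sq

/-- The connection form of a Lagrangian surface is exact. -/
lemma exists_gauge (h : IsMinimalSlantLift D 0 z X Y a₁ a₂) (hD : Convex ℝ D) :
    ∃ c : EuclideanSpace ℝ (Fin 2) → ℂ, ∀ u ∈ D, conj (c u) * c u = 1 ∧
      HasGradAt c (-a₁ u * c u) (-a₂ u * c u) u := by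
  let w : EuclideanSpace ℝ (Fin 2) → EuclideanSpace ℝ (Fin 2) →L[ℝ] ℝ :=
    fun u => gradMap (a₁ u).im (a₂ u).im
  have hw : ∀ u ∈ D, HasFDerivAt w
      ((ContinuousLinearMap.smulRightL ℝ _ ℝ (EuclideanSpace.proj (𝕜 := ℝ) (0 : Fin 2))).comp
        (gradMap (fderiv ℝ a₁ u (EuclideanSpace.single 0 1)).im
          (fderiv ℝ a₁ u (EuclideanSpace.single 1 1)).im)
      + (ContinuousLinearMap.smulRightL ℝ _ ℝ (EuclideanSpace.proj (𝕜 := ℝ) (1 : Fin 2))).comp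
        (gradMap (fderiv ℝ a₂ u (EuclideanSpace.single 0 1)).im
          (fderiv ℝ a₂ u (EuclideanSpace.single 1 1)).im)) u := fun u hu =>
    HasFDerivAt.add
      (((ContinuousLinearMap.smulRightL ℝ _ ℝ (EuclideanSpace.proj (𝕜 := ℝ) (0 : Fin 2))
        ).hasFDerivAt).comp u ((h.smooth₁.hasGradAt h.isOpen hu).clm Complex.imCLM))
      (((ContinuousLinearMap.smulRightL ℝ _ ℝ (EuclideanSpace.proj (𝕜 := ℝ) (1 : Fin 2))
        ).hasFDerivAt).comp u ((h.smooth₂.hasGradAt h.isOpen hu).clm Complex.imCLM))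
  obtain ⟨f, hf⟩ := hD.exists_forall_hasFDerivAt_of_fderiv_symmetric h.isOpen
    (fun u hu => (hw u hu).differentiableAt.differentiableWithinAt) (by
      intro u hu v v'
      -- For κ = 0 the curvature β - β̄ is zero, which says that the real form Im a₁ dx + Im a₂ dy
      -- is closed; the gauge factor is e^{-if} for a primitive f.
      have h1 := (h.dX_one_and_curvature hu).2
      simp at h1
      have h2 := congrArg Complex.im h1
      simp at h2
      rw [(hw u hu).fderiv]
      simp [gradMap_apply]
      linear_combination (v' 1 * v 0 - v' 0 * v 1) * h2)
  refine ⟨fun u => Complex.exp (-Complex.I * f u), fun u hu => ⟨?_, ?_⟩⟩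
  · rw [← Complex.exp_conj, ← Complex.exp_add]
    simp
  · have h1 : HasGradAt f (a₁ u).im (a₂ u).im u := hf u hu
    have him : ∀ b : ℂ, conj b = -b → b = b.im * Complex.I := fun b hb => by
      have h2 := congrArg Complex.re hb
      simp at h2
      apply Complex.ext
      · simp; linarith
      · simp
    refine ((h1.clm Complex.ofRealCLM).const_smul (-Complex.I)).cexp.congr ?_ ?_
    · conv_rhs => rw [him _ (h.conj_coeff hu).1]
      simp; ring
    · conv_rhs => rw [him _ (h.conj_coeff hu).2]
      simp; ring

/-- A minimal Lagrangian surface is, in flat null coordinates, unitarily equivalent to the model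
surface up to a change of scale. -/
lemma exists_congruence (h : IsMinimalSlantLift D 0 z X Y a₁ a₂) (hD : Convex ℝ D)
    (hne : D.Nonempty) :
    ∃ s : ℝ, ∃ hs : s ≠ 0, ∃ A : U12, ∀ u, planeScale s hs u ∈ D →
      ∃ c : ℂ, c ≠ 0 ∧ A.toEquiv (modelCurve 1 1 1 u) = c • z (planeScale s hs u) := by
  obtain ⟨l, hl, hcoeff⟩ := h.exists_coeff hD hne
  obtain ⟨c, hc⟩ := h.exists_gauge hD
  -- The rescaling keeps the metric and multiplies the coefficient of the cubic form by s³, so this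
  -- choice turns li into i.
  obtain ⟨s, hs, hsl⟩ := exists_pow_three_mul_eq_one hl
  have hne' : ((planeScale s hs) ⁻¹' D).Nonempty := by
    obtain ⟨u, hu⟩ := hne
    exact ⟨(planeScale s hs).symm u, by simpa using hu⟩
  have hconv : Convex ℝ ((planeScale s hs) ⁻¹' D) :=
    (hD.linear_preimage (planeScale s hs).toLinearEquiv.toLinearMap :)
  have hl' : (l : ℂ) ≠ 0 := Complex.ofReal_ne_zero.mpr hl
  have hs' : (s : ℂ) ≠ 0 := Complex.ofReal_ne_zero.mpr hs
  have hsl' : (s : ℂ) ^ 3 * l = 1 := by exact_mod_cast hsl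
  have hsol : IsModelSolution ((planeScale s hs) ⁻¹' D)
      (fun u => c (planeScale s hs u) • z (planeScale s hs u))
      (fun u => (s : ℂ) • c (planeScale s hs u) • X (planeScale s hs u))
      (fun u => (s : ℂ)⁻¹ • c (planeScale s hs u) • Y (planeScale s hs u)) := by
    constructor
    · intro u hu
      have hf := h.frame _ hu
      have h1 := (hc _ hu).1
      constructor <;>
        simp only [herm_smul_left, herm_smul_right, hf.zz, hf.zX, hf.zY, hf.XX, hf.YY, hf.XY,
          mul_zero, mul_one, Complex.conj_ofReal]
      · rw [mul_comm, h1]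
      · field_simp
        rw [mul_comm (c _), h1]; simp
    · intro u hu
      refine ((hc _ hu).2.smul (h.dz _ hu)).comp_planeScale.congr ?_ ?_
      · rw [← Complex.coe_smul]; module
      · rw [← Complex.coe_smul, Complex.ofReal_inv]; module
    · intro u hu
      have h1 : HasGradAt X _ _ _ := (h.smoothX.hasGradAt h.isOpen hu).congr (h.dX_zero hu)
        (h.dX_one_and_curvature hu).1
      refine (((hc _ hu).2.smul h1).const_smul (s : ℂ)).comp_planeScale.congr ?_ ?_
      · rw [(hcoeff _ hu).1, ← Complex.coe_smul]
        have h2 : Complex.I * (s : ℂ)⁻¹ = s * (s * (l * Complex.I)) := by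
          field_simp; linear_combination -hsl'
        match_scalars
        · ring
        · linear_combination - c (planeScale s hs u) * h2
      · rw [← Complex.coe_smul, Complex.ofReal_inv]
        simp only [Complex.ofReal_zero, zero_mul, add_zero, map_neg, map_one]
        match_scalars
        · field_simp; ring
        · field_simp
    · intro u hu
      have h1 : HasGradAt Y _ _ _ := (h.smoothY.hasGradAt h.isOpen hu).congr (h.dY_zero hu)
        (h.dY_one hu)
      refine (((hc _ hu).2.smul h1).const_smul (s : ℂ)⁻¹).comp_planeScale.congr ?_ ?_
      · rw [← Complex.coe_smul]
        simp only [Complex.ofReal_zero, zero_mul, add_zero]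
        match_scalars
        · field_simp; ring
        · field_simp
      · rw [(hcoeff _ hu).2, ← Complex.coe_smul, Complex.ofReal_inv]
        have h2 : Complex.I * (s : ℂ) = (s : ℂ)⁻¹ * ((s : ℂ)⁻¹ * ((l : ℂ)⁻¹ * Complex.I)) := by
          field_simp; linear_combination hsl'
        match_scalars
        · ring
        · linear_combination c (planeScale s hs u) * h2
  obtain ⟨A, hA⟩ := (isModelSolution_modelCurve _).exists_unitary hconv hsol hne'
  -- The transfer A carries the normalised lift to the model; the statement wants the opposite
  -- direction.
  refine ⟨s, hs, ⟨A.toEquiv.symm, fun v w => ?_⟩, fun u hu => ⟨c (planeScale s hs u), ?_, ?_⟩⟩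
  · rw [← A.map_herm, A.toEquiv.apply_symm_apply, A.toEquiv.apply_symm_apply]
  · exact right_ne_zero_of_mul_eq_one (hc _ hu).1
  · rw [hA u hu]
    exact A.toEquiv.symm_apply_apply _

end IsMinimalSlantLift

/-! ### Coordinate changes between congruent pieces of the model surface -/

lemma HasGradAt.comp {E : Type*} [NormedAddCommGroup E] [NormedSpace ℝ E]
    {F : EuclideanSpace ℝ (Fin 2) → E} {P Q : E}
    {T : EuclideanSpace ℝ (Fin 2) → EuclideanSpace ℝ (Fin 2)}
    {p q : EuclideanSpace ℝ (Fin 2)} {u : EuclideanSpace ℝ (Fin 2)}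
    (h : HasGradAt F P Q (T u)) (hT : HasGradAt T p q u) :
    HasGradAt (fun u => F (T u)) (p 0 • P + p 1 • Q) (q 0 • P + q 1 • Q) u :=
  of_hasFDerivAt (HasFDerivAt.comp u h hT) (by simp [gradMap_apply]) (by simp [gradMap_apply])

/-- The linear change of coordinates `(x, y) ↦ (-y, -x)`. -/
def planeNegSwap : EuclideanSpace ℝ (Fin 2) ≃L[ℝ] EuclideanSpace ℝ (Fin 2) :=
  (LinearEquiv.ofLinearMap
    ((gradMap (EuclideanSpace.single 1 (-1)) (EuclideanSpace.single 0 (-1)) :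
      EuclideanSpace ℝ (Fin 2) →L[ℝ] EuclideanSpace ℝ (Fin 2)) :
      EuclideanSpace ℝ (Fin 2) →ₗ[ℝ] EuclideanSpace ℝ (Fin 2))
    ((gradMap (EuclideanSpace.single 1 (-1)) (EuclideanSpace.single 0 (-1)) :
      EuclideanSpace ℝ (Fin 2) →L[ℝ] EuclideanSpace ℝ (Fin 2)) :
      EuclideanSpace ℝ (Fin 2) →ₗ[ℝ] EuclideanSpace ℝ (Fin 2))
    (by ext v i; fin_cases i <;> simp [gradMap_apply])
    (by ext v i; fin_cases i <;> simp [gradMap_apply])).toContinuousLinearEquiv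

lemma planeNegSwap_apply (v : EuclideanSpace ℝ (Fin 2)) :
    planeNegSwap v = gradMap (EuclideanSpace.single 1 (-1)) (EuclideanSpace.single 0 (-1)) v := rfl

/-- An element of the unitary group as a continuous real linear map. -/
def U12.toCLM (A : U12) : (Fin 3 → ℂ) →L[ℝ] (Fin 3 → ℂ) :=
  (LinearMap.toContinuousLinearMap (A.toEquiv : (Fin 3 → ℂ) →ₗ[ℂ] (Fin 3 → ℂ))).restrictScalars ℝ

namespace IsModelSolution

variable {F X Y F' X' Y' : EuclideanSpace ℝ (Fin 2) → Fin 3 → ℂ}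
  {D : Set (EuclideanSpace ℝ (Fin 2))}

lemma map (h : IsModelSolution D F X Y) (A : U12) :
    IsModelSolution D (fun u => A.toEquiv (F u)) (fun u => A.toEquiv (X u))
      (fun u => A.toEquiv (Y u)) where
  frame u hu := by
    have hf := h.frame u hu
    constructor <;> rw [A.map_herm]
    exacts [hf.zz, hf.zX, hf.zY, hf.XX, hf.YY, hf.XY]
  dF u hu := (h.dF u hu).clm A.toCLM
  dX u hu := ((h.dX u hu).clm A.toCLM).congr (map_smul A.toEquiv _ _) rfl
  dY u hu := ((h.dY u hu).clm A.toCLM).congr rfl (map_smul A.toEquiv _ _)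

lemma phase_translate (h : IsModelSolution Set.univ F X Y) {c : ℂ} (hc : conj c * c = 1)
    (b : EuclideanSpace ℝ (Fin 2)) :
    IsModelSolution Set.univ (fun u => c • F (u + b)) (fun u => c • X (u + b))
      (fun u => c • Y (u + b)) := by
  have hT : ∀ u, HasGradAt (fun u : EuclideanSpace ℝ (Fin 2) => u + b) (EuclideanSpace.single 0 1)
      (EuclideanSpace.single 1 1) u := fun u =>
    HasGradAt.of_hasFDerivAt ((hasFDerivAt_id u).add_const b) rfl rfl
  have hc' : c * conj c = 1 := by rw [mul_comm, hc]
  constructor <;> intro u _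
  · have hf := h.frame (u + b) trivial
    constructor <;> simp [herm_smul_left, herm_smul_right, hf.zz, hf.zX, hf.zY, hf.XX, hf.YY,
      hf.XY, hc']
  · exact (((h.dF (u + b) trivial).comp (T := (· + b)) (hT u)).const_smul c).congr (by simp) (by simp)
  · exact (((h.dX (u + b) trivial).comp (T := (· + b)) (hT u)).const_smul c).congr (by simp [smul_comm c Complex.I])
      (by simp)
  · exact (((h.dY (u + b) trivial).comp (T := (· + b)) (hT u)).const_smul c).congr (by simp)
      (by simp [smul_comm c Complex.I])

/-- The map (x, y) ↦ (-y, -x) preserves both dx dy and dx³ - dy³, so it is a symmetry of the system;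
it replaces X and Y by -Y and -X. -/
lemma negSwap (h : IsModelSolution Set.univ F X Y) :
    IsModelSolution Set.univ (fun u => F (planeNegSwap u)) (fun u => (-1 : ℂ) • Y (planeNegSwap u))
      (fun u => (-1 : ℂ) • X (planeNegSwap u)) := by
  have hT : ∀ u, HasGradAt planeNegSwap (EuclideanSpace.single 1 (-1))
      (EuclideanSpace.single 0 (-1)) u := fun u =>
    HasGradAt.of_hasFDerivAt planeNegSwap.hasFDerivAt (by simp [planeNegSwap_apply])
      (by simp [planeNegSwap_apply])
  constructor <;> intro u _
  · have hf := h.frame (planeNegSwap u) trivial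
    constructor <;> simp [herm_neg_left, herm_neg_right, hf.zz, hf.zX, hf.zY, hf.XX, hf.YY, hf.YX]
  · exact ((h.dF _ trivial).comp (hT u)).congr (by simp) (by simp)
  · exact (((h.dY _ trivial).comp (hT u)).const_smul (-1)).congr (by simp) (by simp)
  · exact (((h.dX _ trivial).comp (hT u)).const_smul (-1)).congr (by simp) (by simp)

/-- The cubic form of the model surface restricts the coordinate changes. -/
lemma jet_cases {p q : EuclideanSpace ℝ (Fin 2)} (h0 : p 0 * p 1 = 0) (h1 : q 0 * q 1 = 0)
    (h2 : p 0 * q 1 + p 1 * q 0 = 1) (h3 : p 0 ^ 3 - p 1 ^ 3 = 1) :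
    (p = EuclideanSpace.single 0 1 ∧ q = EuclideanSpace.single 1 1) ∨
      (p = EuclideanSpace.single 1 (-1) ∧ q = EuclideanSpace.single 0 (-1)) := by
  have cube : ∀ t : ℝ, t ^ 3 = 1 → t = 1 := fun t ht => by
    have : (t - 1) * ((t + 1 / 2) ^ 2 + 3 / 4) = 0 := by linear_combination ht
    rcases mul_eq_zero.mp this with h | h
    · linarith
    · nlinarith [sq_nonneg (t + 1 / 2)]
  rcases mul_eq_zero.mp h0 with h | h
  · right
    have hp1 : -p 1 = 1 := cube _ (by rw [h] at h3; linear_combination h3)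
    have hq0 : q 0 = -1 := by rw [h] at h2; linear_combination -h2 - q 0 * hp1
    have hq1 : q 1 = 0 := by rw [hq0] at h1; linarith
    constructor <;> ext i <;> fin_cases i <;> simp [*]
    linarith
  · left
    have hp0 : p 0 = 1 := cube _ (by rw [h] at h3; linear_combination h3)
    have hq1 : q 1 = 1 := by rw [h, hp0] at h2; linarith
    have hq0 : q 0 = 0 := by rw [hq1] at h1; linarith
    constructor <;> ext i <;> fin_cases i <;> simp [*]

/-- If two solutions of the structure equations define projectively the same surface near a point,
up to a coordinate change, then they do so globally, up to an affine coordinate change. -/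
lemma exists_affine_change (h : IsModelSolution Set.univ F X Y)
    (h' : IsModelSolution Set.univ F' X' Y')
    {T : EuclideanSpace ℝ (Fin 2) → EuclideanSpace ℝ (Fin 2)} {D : Set (EuclideanSpace ℝ (Fin 2))}
    (hD : IsOpen D) (hT : ContDiffOn ℝ ∞ T D) (hne : D.Nonempty)
    (heq : ∀ u ∈ D, ∃ c : ℂ, F u = c • F' (T u)) :
    ∃ (R : EuclideanSpace ℝ (Fin 2) ≃L[ℝ] EuclideanSpace ℝ (Fin 2))
      (b : EuclideanSpace ℝ (Fin 2)) (c : ℂ), c ≠ 0 ∧ ∀ u, F u = c • F' (R u + b) := by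
  set c : EuclideanSpace ℝ (Fin 2) → ℂ := fun u => herm (F' (T u)) (F u) with hcdef
  set p : EuclideanSpace ℝ (Fin 2) → EuclideanSpace ℝ (Fin 2) :=
    fun u => fderiv ℝ T u (EuclideanSpace.single 0 1)
  set q : EuclideanSpace ℝ (Fin 2) → EuclideanSpace ℝ (Fin 2) :=
    fun u => fderiv ℝ T u (EuclideanSpace.single 1 1)
  have hTg : ∀ u ∈ D, HasGradAt T (p u) (q u) u := fun u hu => hT.hasGradAt hD hu
  have hF : ∀ u ∈ D, F u = c u • F' (T u) := fun u hu => by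
    obtain ⟨d, hd⟩ := heq u hu
    have h1 := (h'.frame (T u) trivial).zz
    simp only [hcdef]
    rw [hd, herm_smul_right, h1, mul_one]
  have hcc : ∀ u ∈ D, conj (c u) * c u = 1 := fun u hu => by
    have h1 := (h.frame u trivial).zz
    rw [hF u hu, herm_smul_smul, (h'.frame (T u) trivial).zz, mul_one] at h1
    exact h1
  have hF' : ∀ u ∈ D, HasGradAt (fun u => F' (T u)) _ _ u := fun u hu =>
    (h'.dF (T u) trivial).comp (hTg u hu)
  -- Both F and F' ∘ T have derivatives b-orthogonal to themselves. Pairing dF = dc · F' + c · dF'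
  -- with F leaves only the dc term, so the phase is locally constant.
  have hc : ∀ u ∈ D, HasGradAt c 0 0 u := fun u hu => by
    obtain ⟨c₁, c₂, h1⟩ : ∃ c₁ c₂, HasGradAt c c₁ c₂ u := ⟨_, _, (hF' u hu).herm (h.dF u trivial)⟩
    have h2 := (h1.smul (hF' u hu)).unique ((h.dF u trivial).congr_of_eventuallyEq
      (Filter.eventually_of_mem (hD.mem_nhds hu) fun v hv => (hF v hv).symm))
    have hf := h.frame u trivial
    have hf' := h'.frame (T u) trivial
    refine h1.congr ?_ ?_
    · have h3 := congrArg (herm (F u)) h2.1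
      rw [hf.zX, hF u hu] at h3
      simp only [herm_add_right, herm_smul_right, herm_smul_left, herm_real_smul_right, hf'.zX,
        hf'.zY, hf'.zz] at h3
      apply mul_left_cancel₀ (left_ne_zero_of_mul_eq_one (hcc u hu))
      linear_combination h3
    · have h3 := congrArg (herm (F u)) h2.2
      rw [hf.zY, hF u hu] at h3
      simp only [herm_add_right, herm_smul_right, herm_smul_left, herm_real_smul_right, hf'.zX,
        hf'.zY, hf'.zz] at h3
      apply mul_left_cancel₀ (left_ne_zero_of_mul_eq_one (hcc u hu))
      linear_combination h3
  have hXY : ∀ u ∈ D, X u = c u • (p u 0 • X' (T u) + p u 1 • Y' (T u)) ∧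
      Y u = c u • (q u 0 • X' (T u) + q u 1 • Y' (T u)) := fun u hu => by
    have h2 := ((hc u hu).smul (hF' u hu)).unique ((h.dF u trivial).congr_of_eventuallyEq
      (Filter.eventually_of_mem (hD.mem_nhds hu) fun v hv => (hF v hv).symm))
    exact ⟨by rw [← h2.1]; simp, by rw [← h2.2]; simp⟩
  obtain ⟨u, hu⟩ := hne
  have hf := h.frame u trivial
  have hf' := h'.frame (T u) trivial
  have hc1 := hcc u hu
  have hp : HasGradAt p _ _ u := (hT.fderiv_apply_const hD _).hasGradAt hD hu
  set P₁ := fderiv ℝ p u (EuclideanSpace.single 0 1)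
  have hp' : ∀ i : Fin 2, HasGradAt (fun u => p u i) (P₁ i) _ u := fun i =>
    hp.clm (EuclideanSpace.proj (𝕜 := ℝ) i)
  -- Second derivative of F = c F'(T) along x; P₁ holds the second derivatives of T.
  have hXX : c u • ((P₁ 0 • X' (T u) + p u 0 • (p u 0 • Complex.I • Y' (T u) + p u 1 • F' (T u)))
      + (P₁ 1 • Y' (T u) + p u 1 • (p u 0 • F' (T u) + p u 1 • -Complex.I • X' (T u))))
      = Complex.I • Y u := by
    have h1 := (hc u hu).smul
      (((hp' 0).bilin (ContinuousLinearMap.lsmul ℝ ℝ) ((h'.dX (T u) trivial).comp (hTg u hu))).add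
      ((hp' 1).bilin (ContinuousLinearMap.lsmul ℝ ℝ) ((h'.dY (T u) trivial).comp (hTg u hu))))
    have h2 := (h1.unique ((h.dX u trivial).congr_of_eventuallyEq
      (Filter.eventually_of_mem (hD.mem_nhds hu) fun v hv => (hXY v hv).1.symm))).1
    rw [← h2]
    simp
  have hX := (hXY u hu).1
  have hY := (hXY u hu).2
  -- The next three relations say that the differential of T preserves the flat null metric at u.
  have e0 : p u 0 * p u 1 = 0 := by
    have h1 := hf.XX
    rw [hX] at h1
    simp only [herm_smul_smul, herm_add_left, herm_add_right, herm_real_smul_left,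
      herm_real_smul_right, hc1, hf'.XX, hf'.XY, hf'.YX, hf'.YY, map_neg, map_one] at h1
    have h2 : (p u 0 : ℂ) * p u 1 = 0 := by linear_combination -h1 / 2
    exact Complex.ofReal_injective (by simpa using h2)
  have e1 : q u 0 * q u 1 = 0 := by
    have h1 := hf.YY
    rw [hY] at h1
    simp only [herm_smul_smul, herm_add_left, herm_add_right, herm_real_smul_left,
      herm_real_smul_right, hc1, hf'.XX, hf'.XY, hf'.YX, hf'.YY, map_neg, map_one] at h1
    have h2 : (q u 0 : ℂ) * q u 1 = 0 := by linear_combination -h1 / 2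
    exact Complex.ofReal_injective (by simpa using h2)
  have e2 : p u 0 * q u 1 + p u 1 * q u 0 = 1 := by
    have h1 := hf.XY
    rw [hX, hY] at h1
    simp only [herm_smul_smul, herm_add_left, herm_add_right, herm_real_smul_left,
      herm_real_smul_right, hc1, hf'.XX, hf'.XY, hf'.YX, hf'.YY, map_neg, map_one] at h1
    have h2 : (p u 0 : ℂ) * q u 1 + p u 1 * q u 0 = 1 := by linear_combination -h1
    exact Complex.ofReal_injective (by simpa using h2)
  -- Preservation of the cubic form, read from the pairing of F_xx with X. The unknown second
  -- derivatives of T enter with real coefficients, so the imaginary part eliminates them.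
  have e3 : p u 0 ^ 3 - p u 1 ^ 3 = 1 := by
    have h1 := congrArg (herm (X u)) hXX
    rw [herm_smul_right (Complex.I), hf.XY, hX] at h1
    rw [herm_smul_smul, hc1, one_mul] at h1
    simp only [herm_add_left, herm_add_right, herm_real_smul_left, herm_real_smul_right,
      herm_smul_right, hf'.XX, hf'.XY, hf'.YX, hf'.YY, hf'.Xz, hf'.Yz,
      map_neg, map_one] at h1
    have h2 := congrArg Complex.im h1
    simp at h2
    linear_combination -h2
  -- In either case F and the affinely reparametrised F' have the same frame at u, so uniqueness for
  -- the system makes them equal on the whole plane. T itself need not be examined away from u.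
  rcases jet_cases e0 e1 e2 e3 with ⟨hp0, hq0⟩ | ⟨hp0, hq0⟩
  · refine ⟨ContinuousLinearEquiv.refl ℝ _, T u - u, c u, right_ne_zero_of_mul_eq_one hc1,
      fun v => ?_⟩
    refine h.eqOn convex_univ (h'.phase_translate hc1 (T u - u)) (u₀ := u) trivial ?_ ?_ ?_ trivial
    · rw [add_sub_cancel]; exact hF u hu
    · rw [add_sub_cancel, hX, hp0]; simp
    · rw [add_sub_cancel, hY, hq0]; simp
  · refine ⟨planeNegSwap, T u - planeNegSwap u, c u, right_ne_zero_of_mul_eq_one hc1,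
      fun v => ?_⟩
    have hR := (h'.phase_translate hc1 (T u - planeNegSwap u)).negSwap
    refine h.eqOn convex_univ hR (u₀ := u) trivial ?_ ?_ ?_ trivial
    · rw [add_sub_cancel]; exact hF u hu
    · rw [add_sub_cancel, hX, hp0]; simp
    · rw [add_sub_cancel, hY, hq0]; simp

end IsModelSolution

/-! ### The Levi-Civita connection in coordinates -/

section LeviCivita

set_option maxSynthPendingDepth 6

variable {E : Type*} [NormedAddCommGroup E] [NormedSpace ℝ E]

/-- The Christoffel map of `G` at `x` as a continuous bilinear map. -/
def christoffelL (G : E → E →L[ℝ] E →L[ℝ] ℝ) (x : E) : E →L[ℝ] E →L[ℝ] E :=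
  (ContinuousLinearMap.compL ℝ E (E →L[ℝ] ℝ) E (G x).inverse).comp
    ((1 / 2 : ℝ) • (fderiv ℝ G x + ContinuousLinearMap.flipₗᵢ ℝ E E (E →L[ℝ] ℝ) (fderiv ℝ G x)
      - (ContinuousLinearMap.flipₗᵢ ℝ E E ℝ : (E →L[ℝ] E →L[ℝ] ℝ) →L[ℝ] (E →L[ℝ] E →L[ℝ] ℝ)).comp
        (ContinuousLinearMap.flipₗᵢ ℝ E E (E →L[ℝ] ℝ) (fderiv ℝ G x))))

lemma christoffelL_apply (G : E → E →L[ℝ] E →L[ℝ] ℝ) (x v w : E) :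
    christoffelL G x v w = christoffel G x v w := by
  simp [christoffelL, christoffel]

variable {G : E → E →L[ℝ] E →L[ℝ] ℝ} {D : Set E} {x : E}

/-- `ContinuousLinearMap.inverse` is zero on maps that are not invertible, so the formulas for
`christoffel` carry meaning only after this. An injective map from E to its dual is invertible by
equality of dimensions. -/
lemma isInvertible_of_nondegenerate [FiniteDimensional ℝ E] {B : E →L[ℝ] E →L[ℝ] ℝ}
    (hB : ∀ t, (∀ u, B t u = 0) → t = 0) : B.IsInvertible := by
  have hinj : Function.Injective (B : E →ₗ[ℝ] E →L[ℝ] ℝ) := by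
    rw [injective_iff_map_eq_zero]
    intro t ht
    exact hB t fun u => by
      have : B t = 0 := ht
      rw [this]; rfl
  have hdim : Module.finrank ℝ E = Module.finrank ℝ (E →L[ℝ] ℝ) := by
    rw [← (LinearMap.toContinuousLinearMap : (E →ₗ[ℝ] ℝ) ≃ₗ[ℝ] (E →L[ℝ] ℝ)).finrank_eq,
      Subspace.dual_finrank_eq]
  exact ⟨(LinearEquiv.ofInjectiveOfFinrankEq _ hinj hdim).toContinuousLinearEquiv, by
    ext; rfl⟩

lemma christoffel_koszul (h : (G x).IsInvertible) (v w u : E) :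
    G x (christoffel G x v w) u
      = (1 / 2 : ℝ) * (fderiv ℝ G x v w u + fderiv ℝ G x w v u - fderiv ℝ G x u v w) := by
  obtain ⟨e, he⟩ := h
  rw [christoffel, ← he, ContinuousLinearMap.inverse_equiv]
  simp

lemma fderiv_metric_symm (hD : IsOpen D) (hG : DifferentiableOn ℝ G D)
    (hs : ∀ y ∈ D, ∀ v w, G y v w = G y w v) (hx : x ∈ D) (u v w : E) :
    fderiv ℝ G x u v w = fderiv ℝ G x u w v := by
  have hG' := (hG.differentiableAt (hD.mem_nhds hx)).hasFDerivAt
  have h1 : ∀ v w, HasFDerivAt (fun y => G y v w)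
      (((fderiv ℝ G x).flip v).flip w) x := fun v w => by
    have := (hG'.clm_apply (hasFDerivAt_const v x)).clm_apply (hasFDerivAt_const w x)
    refine this.congr_fderiv ?_
    ext; simp
  have h2 := (h1 v w).unique ((h1 w v).congr_of_eventuallyEq
    (Filter.eventually_of_mem (hD.mem_nhds hx) fun y hy => hs y hy v w))
  simpa using congrArg (fun A => A u) h2

lemma christoffel_symm (hD : IsOpen D) (hG : DifferentiableOn ℝ G D)
    (hs : ∀ y ∈ D, ∀ v w, G y v w = G y w v) (hx : x ∈ D) (v w : E) :
    christoffel G x v w = christoffel G x w v := by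
  have h : ((fderiv ℝ G x).flip v).flip w = ((fderiv ℝ G x).flip w).flip v := by
    ext u; simpa using fderiv_metric_symm hD hG hs hx u v w
  rw [christoffel, christoffel, h, add_comm (fderiv ℝ G x v w)]

/-- Metric compatibility: in the sum of the two Koszul formulas all terms other than the derivative
along v cancel. -/
lemma fderiv_metric (hD : IsOpen D) (hG : DifferentiableOn ℝ G D)
    (hs : ∀ y ∈ D, ∀ v w, G y v w = G y w v) (hi : (G x).IsInvertible) (hx : x ∈ D) (v w u : E) :
    fderiv ℝ G x v w u = G x (christoffel G x v w) u + G x w (christoffel G x v u) := by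
  rw [hs x hx w, christoffel_koszul hi, christoffel_koszul hi]
  rw [fderiv_metric_symm hD hG hs hx v u w]
  ring

lemma contDiffOn_christoffelL [CompleteSpace E] (hD : IsOpen D) (hG : ContDiffOn ℝ ∞ G D)
    (hi : ∀ y ∈ D, (G y).IsInvertible) : ContDiffOn ℝ ∞ (christoffelL G) D := by
  have h1 : ContDiffOn ℝ ∞ (fun y => (G y).inverse) D := fun y hy =>
    ((hi y hy).contDiffAt_map_inverse.comp y (hG.contDiffAt (hD.mem_nhds hy))).contDiffWithinAt
  have h2 : ContDiffOn ℝ ∞ (fderiv ℝ G) D := hG.fderiv_of_isOpen hD (by simp)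
  have h3 : ContDiffOn ℝ ∞ (fun y => ContinuousLinearMap.flipₗᵢ ℝ E E (E →L[ℝ] ℝ) (fderiv ℝ G y))
      D := (ContinuousLinearMap.flipₗᵢ ℝ E E (E →L[ℝ] ℝ)).contDiff.comp_contDiffOn h2
  exact ((ContinuousLinearMap.compL ℝ E (E →L[ℝ] ℝ) E).contDiff.comp_contDiffOn h1).clm_comp
    (((h2.add h3).sub (contDiffOn_const.clm_comp h3)).const_smul (1 / 2 : ℝ))

lemma curvature_eq [CompleteSpace E] (hD : IsOpen D) (hG : ContDiffOn ℝ ∞ G D)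
    (hi : ∀ y ∈ D, (G y).IsInvertible) (hx : x ∈ D) (v w z : E) :
    curvature G x v w z = fderiv ℝ (christoffelL G) x v w z - fderiv ℝ (christoffelL G) x w v z
      + christoffelL G x v (christoffelL G x w z) - christoffelL G x w (christoffelL G x v z) := by
  have h1 : HasFDerivAt (christoffelL G) _ x :=
    (((contDiffOn_christoffelL hD hG hi).contDiffAt (hD.mem_nhds hx)).differentiableAt
      (by simp)).hasFDerivAt
  have h2 : ∀ a b c : E, fderiv ℝ (fun y => christoffel G y a b) x c
      = fderiv ℝ (christoffelL G) x c a b := fun a b c => by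
    have := ((h1.clm_apply (hasFDerivAt_const a x)).clm_apply (hasFDerivAt_const b x)).fderiv
    simp only [christoffelL_apply] at this
    rw [this]; simp
  rw [curvature, h2, h2]
  simp only [christoffelL_apply]

end LeviCivita

/-! ### Null frames -/

section NullFrame

variable {E : Type*} [NormedAddCommGroup E] [NormedSpace ℝ E]

/-- A pair of null vectors with product `-1` extends smoothly to nearby points. -/
lemma exists_smooth_null_frame {G : E → E →L[ℝ] E →L[ℝ] ℝ} {D : Set E} (hD : IsOpen D)
    (hG : ContDiffOn ℝ ∞ G D) (hs : ∀ y ∈ D, ∀ v w, G y v w = G y w v) {x a b : E} (hx : x ∈ D)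
    (haa : G x a a = 0) (hbb : G x b b = 0) (hab : G x a b = -1) :
    ∃ (D' : Set E) (p q : E → E), IsOpen D' ∧ x ∈ D' ∧ D' ⊆ D ∧ ContDiffOn ℝ ∞ p D' ∧
      ContDiffOn ℝ ∞ q D' ∧ ∀ y ∈ D', G y (p y) (p y) = 0 ∧ G y (q y) (q y) = 0 ∧
        G y (p y) (q y) = -1 := by
  have hsm : ∀ v w, ContDiffOn ℝ ∞ (fun y => G y v w) D := fun v w =>
    (hG.clm_apply contDiffOn_const).clm_apply contDiffOn_const
  set d : E → ℝ := fun y => G y a b ^ 2 - G y a a * G y b b with hd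
  have hds : ContDiffOn ℝ ∞ d D := ((hsm a b).pow 2).sub ((hsm a a).mul (hsm b b))
  have hdx : d x = 1 := by simp [hd, haa, hbb, hab]
  -- the roots of the quadratic equations for null vectors
  set r : E → ℝ := fun y => -G y a b + Real.sqrt (d y) with hr
  set D₁ : Set E := D ∩ d ⁻¹' Set.Ioi 0 with hD₁
  have hD₁o : IsOpen D₁ := hds.continuousOn.isOpen_inter_preimage hD isOpen_Ioi
  have hrs : ContDiffOn ℝ ∞ r D₁ := ((hsm a b).mono Set.inter_subset_left).neg.add
    ((hds.mono Set.inter_subset_left).sqrt fun y hy => (ne_of_gt hy.2))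
  have hrx : r x = 2 := by simp [hr, hdx, hab]; norm_num
  set D₂ : Set E := D₁ ∩ r ⁻¹' Set.Ioi 0 with hD₂
  have hD₂o : IsOpen D₂ := hrs.continuousOn.isOpen_inter_preimage hD₁o isOpen_Ioi
  have hsub : D₂ ⊆ D := fun y hy => hy.1.1
  have hrs₂ := hrs.mono (Set.inter_subset_left : D₂ ⊆ D₁)
  have hr0 : ∀ y ∈ D₂, r y ≠ 0 := fun y hy => ne_of_gt hy.2
  -- The coefficient is the small root t of G(a + tb, a + tb) = 0 in rationalised form, which avoids
  -- dividing by G(b, b): that vanishes at x.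
  set p : E → E := fun y => a + (G y a a / r y) • b with hp
  set q : E → E := fun y => b + (G y b b / r y) • a with hq
  have hps : ContDiffOn ℝ ∞ p D₂ :=
    contDiffOn_const.add ((((hsm a a).mono hsub).div hrs₂ hr0).smul contDiffOn_const)
  have hqs : ContDiffOn ℝ ∞ q D₂ :=
    contDiffOn_const.add ((((hsm b b).mono hsub).div hrs₂ hr0).smul contDiffOn_const)
  set m : E → ℝ := fun y => -G y (p y) (q y) with hm
  have hms : ContDiffOn ℝ ∞ m D₂ := (((hG.mono hsub).clm_apply hps).clm_apply hqs).neg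
  have hmx : m x = 1 := by simp [hm, hp, hq, haa, hbb, hab]
  have hquad : ∀ y ∈ D₂, r y ^ 2 + 2 * G y a b * r y + G y a a * G y b b = 0 := fun y hy => by
    have h1 := Real.sq_sqrt (show 0 ≤ d y from le_of_lt hy.1.2)
    simp only [hr]
    linear_combination h1
  refine ⟨D₂ ∩ m ⁻¹' Set.Ioi 0, p, fun y => (m y)⁻¹ • q y,
    hms.continuousOn.isOpen_inter_preimage hD₂o isOpen_Ioi,
    ⟨⟨⟨hx, by simp [hdx]⟩, by simp [hrx]⟩, by simp [hmx]⟩, fun y hy => hsub hy.1,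
    hps.mono Set.inter_subset_left, ?_, fun y hy => ⟨?_, ?_, ?_⟩⟩
  · exact ((hms.mono Set.inter_subset_left).inv fun y hy => ne_of_gt hy.2).smul
      (hqs.mono Set.inter_subset_left)
  · have h1 := hquad y hy.1
    have h2 := hr0 y hy.1
    simp only [hp, map_add, map_smul, add_apply, smul_apply, smul_eq_mul, hs y (hsub hy.1) b a]
    field_simp
    linear_combination G y a a * h1
  · have h1 := hquad y hy.1
    have h2 := hr0 y hy.1
    have h3 : G y (q y) (q y) = 0 := by
      simp only [hq, map_add, map_smul, add_apply, smul_apply, smul_eq_mul, hs y (hsub hy.1) b a]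
      field_simp
      linear_combination G y b b * h1
    simp [h3]
  · have h1 : m y ≠ 0 := ne_of_gt hy.2
    have h2 : G y (p y) (q y) = -m y := by simp [hm]
    simp [h2, h1]

lemma null_expand {B : EuclideanSpace ℝ (Fin 2) →L[ℝ] EuclideanSpace ℝ (Fin 2) →L[ℝ] ℝ}
    (hs : ∀ v w, B v w = B w v) {p q : EuclideanSpace ℝ (Fin 2)} (hpp : B p p = 0)
    (hqq : B q q = 0) (hpq : B p q = -1) (v : EuclideanSpace ℝ (Fin 2)) :
    v = -B q v • p + -B p v • q := by
  have hqp : B q p = -1 := by rw [hs, hpq]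
  have hinj : Function.Injective (gradMap p q).toLinearMap := by
    rw [injective_iff_map_eq_zero]
    intro w hw
    have hw : w 0 • p + w 1 • q = 0 := hw
    have h0 := congrArg (B p) hw
    have h1 := congrArg (B q) hw
    simp [hpp, hpq, hqq, hqp] at h0 h1
    ext i; fin_cases i <;> simp [*]
  obtain ⟨w, hw⟩ := LinearMap.surjective_of_injective hinj v
  have hw : w 0 • p + w 1 • q = v := hw
  rw [← hw]
  simp [hpp, hpq, hqq, hqp]

lemma null_ext {B : EuclideanSpace ℝ (Fin 2) →L[ℝ] EuclideanSpace ℝ (Fin 2) →L[ℝ] ℝ}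
    (hs : ∀ v w, B v w = B w v) {p q : EuclideanSpace ℝ (Fin 2)} (hpp : B p p = 0)
    (hqq : B q q = 0) (hpq : B p q = -1) {v w : EuclideanSpace ℝ (Fin 2)} (h1 : B p v = B p w)
    (h2 : B q v = B q w) : v = w := by
  rw [null_expand hs hpp hqq hpq v, null_expand hs hpp hqq hpq w, h1, h2]

end NullFrame

/-! ### Flat Lorentzian metrics in the plane -/

section Flat

set_option maxSynthPendingDepth 6 in
lemma _root_.ContDiffOn.clm_flip {E F₁ F₂ F₃ : Type*} [NormedAddCommGroup E] [NormedSpace ℝ E]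
    [NormedAddCommGroup F₁] [NormedSpace ℝ F₁] [NormedAddCommGroup F₂] [NormedSpace ℝ F₂]
    [NormedAddCommGroup F₃] [NormedSpace ℝ F₃] {f : E → F₁ →L[ℝ] F₂ →L[ℝ] F₃} {s : Set E}
    (hf : ContDiffOn ℝ ∞ f s) : ContDiffOn ℝ ∞ (fun x => (f x).flip) s :=
  (ContinuousLinearMap.flipₗᵢ ℝ F₁ F₂ F₃).contDiff.comp_contDiffOn hf

lemma two_le_infty : (2 : ℕ∞ω) ≤ ∞ :=
  WithTop.coe_le_coe.mpr (le_top : (2 : ℕ∞) ≤ ⊤)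

/-- A smooth Lorentzian metric on an open set of the plane, with a smooth null frame. -/
structure IsNullFramedMetric (D : Set (EuclideanSpace ℝ (Fin 2)))
    (G : EuclideanSpace ℝ (Fin 2) →
      EuclideanSpace ℝ (Fin 2) →L[ℝ] EuclideanSpace ℝ (Fin 2) →L[ℝ] ℝ)
    (p q : EuclideanSpace ℝ (Fin 2) → EuclideanSpace ℝ (Fin 2)) : Prop where
  isOpen : IsOpen D
  smooth : ContDiffOn ℝ ∞ G D
  symm : ∀ y ∈ D, ∀ v w, G y v w = G y w v
  smooth_p : ContDiffOn ℝ ∞ p D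
  smooth_q : ContDiffOn ℝ ∞ q D
  pp : ∀ y ∈ D, G y (p y) (p y) = 0
  qq : ∀ y ∈ D, G y (q y) (q y) = 0
  pq : ∀ y ∈ D, G y (p y) (q y) = -1

namespace IsNullFramedMetric

variable {D : Set (EuclideanSpace ℝ (Fin 2))}
  {G : EuclideanSpace ℝ (Fin 2) →
    EuclideanSpace ℝ (Fin 2) →L[ℝ] EuclideanSpace ℝ (Fin 2) →L[ℝ] ℝ}
  {p q : EuclideanSpace ℝ (Fin 2) → EuclideanSpace ℝ (Fin 2)}
  {y : EuclideanSpace ℝ (Fin 2)}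

lemma qp (h : IsNullFramedMetric D G p q) : ∀ y ∈ D, G y (q y) (p y) = -1 := fun y hy => by
  rw [h.symm y hy, h.pq y hy]

lemma swap (h : IsNullFramedMetric D G p q) : IsNullFramedMetric D G q p where
  isOpen := h.isOpen
  smooth := h.smooth
  symm := h.symm
  smooth_p := h.smooth_q
  smooth_q := h.smooth_p
  pp := h.qq
  qq := h.pp
  pq := h.qp

lemma isInvertible (h : IsNullFramedMetric D G p q) : ∀ y ∈ D, (G y).IsInvertible := fun y hy =>
  isInvertible_of_nondegenerate fun t ht =>
    null_ext (h.symm y hy) (h.pp y hy) (h.qq y hy) (h.pq y hy)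
      (by rw [h.symm y hy, ht, map_zero]) (by rw [h.symm y hy, ht, map_zero])

lemma smooth_christoffel (h : IsNullFramedMetric D G p q) : ContDiffOn ℝ ∞ (christoffelL G) D :=
  contDiffOn_christoffelL h.isOpen h.smooth h.isInvertible

/-- The covariant derivative of a vector field, as a linear map. -/
def covariant (G : EuclideanSpace ℝ (Fin 2) →
    EuclideanSpace ℝ (Fin 2) →L[ℝ] EuclideanSpace ℝ (Fin 2) →L[ℝ] ℝ)
    (p : EuclideanSpace ℝ (Fin 2) → EuclideanSpace ℝ (Fin 2)) (y : EuclideanSpace ℝ (Fin 2)) :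
    EuclideanSpace ℝ (Fin 2) →L[ℝ] EuclideanSpace ℝ (Fin 2) :=
  fderiv ℝ p y + (christoffelL G y).flip (p y)

lemma covariant_apply (p : EuclideanSpace ℝ (Fin 2) → EuclideanSpace ℝ (Fin 2))
    (v : EuclideanSpace ℝ (Fin 2)) :
    covariant G p y v = fderiv ℝ p y v + christoffel G y v (p y) := by
  simp [covariant, christoffelL_apply]

lemma _root_.ContDiffOn.hasFDerivAt' {E F : Type*} [NormedAddCommGroup E] [NormedSpace ℝ E]
    [NormedAddCommGroup F] [NormedSpace ℝ F] {f : E → F} {s : Set E} (hf : ContDiffOn ℝ ∞ f s)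
    (hs : IsOpen s) {x : E} (hx : x ∈ s) : HasFDerivAt f (fderiv ℝ f x) x :=
  ((hf.contDiffAt (hs.mem_nhds hx)).differentiableAt (by simp)).hasFDerivAt

/-- The connection is metric. -/
lemma metric_compat (h : IsNullFramedMetric D G p q)
    {r s : EuclideanSpace ℝ (Fin 2) → EuclideanSpace ℝ (Fin 2)} (hr : ContDiffOn ℝ ∞ r D)
    (hs : ContDiffOn ℝ ∞ s D) {c : ℝ} (hc : ∀ y ∈ D, G y (r y) (s y) = c) (hy : y ∈ D)
    (v : EuclideanSpace ℝ (Fin 2)) :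
    G y (covariant G r y v) (s y) + G y (r y) (covariant G s y v) = 0 := by
  have h1 := ((h.smooth.hasFDerivAt' h.isOpen hy).clm_apply (hr.hasFDerivAt' h.isOpen hy)).clm_apply
    (hs.hasFDerivAt' h.isOpen hy)
  have h2 := h1.unique ((hasFDerivAt_const c y).congr_of_eventuallyEq
    (Filter.eventually_of_mem (h.isOpen.mem_nhds hy) hc))
  have h3 := congrArg (fun A => A v) h2
  simp at h3
  rw [fderiv_metric h.isOpen (h.smooth.differentiableOn (by simp)) h.symm (h.isInvertible y hy)
    hy] at h3
  simp only [covariant_apply, map_add, add_apply]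
  linear_combination h3

/-- The connection form of the null frame. -/
def connForm (G : EuclideanSpace ℝ (Fin 2) →
    EuclideanSpace ℝ (Fin 2) →L[ℝ] EuclideanSpace ℝ (Fin 2) →L[ℝ] ℝ)
    (p q : EuclideanSpace ℝ (Fin 2) → EuclideanSpace ℝ (Fin 2)) (y : EuclideanSpace ℝ (Fin 2)) :
    EuclideanSpace ℝ (Fin 2) →L[ℝ] ℝ :=
  -(G y (q y)).comp (covariant G p y)

lemma covariant_p (h : IsNullFramedMetric D G p q) (hy : y ∈ D) (v : EuclideanSpace ℝ (Fin 2)) :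
    covariant G p y v = connForm G p q y v • p y := by
  have h1 := h.metric_compat h.smooth_p h.smooth_p h.pp hy v
  rw [h.symm y hy] at h1
  refine null_ext (h.symm y hy) (h.pp y hy) (h.qq y hy) (h.pq y hy) ?_ ?_
  · simp [h.pp y hy]; linarith
  · simp [h.qp y hy, connForm]

lemma covariant_q (h : IsNullFramedMetric D G p q) (hy : y ∈ D) (v : EuclideanSpace ℝ (Fin 2)) :
    covariant G q y v = -connForm G p q y v • q y := by
  have h1 := h.metric_compat h.smooth_p h.smooth_q h.pq hy v
  rw [h.symm y hy (covariant G p y v)] at h1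
  rw [h.swap.covariant_p hy]
  congr 1
  simp [connForm]
  linarith

lemma smooth_covariant (h : IsNullFramedMetric D G p q) : ContDiffOn ℝ ∞ (covariant G p) D := by
  exact (h.smooth_p.fderiv_of_isOpen h.isOpen (by simp)).add
    (h.smooth_christoffel.clm_flip.clm_apply h.smooth_p)

lemma smooth_connForm (h : IsNullFramedMetric D G p q) : ContDiffOn ℝ ∞ (connForm G p q) D :=
  ((h.smooth.clm_apply h.smooth_q).clm_comp h.smooth_covariant).neg

set_option synthInstance.maxHeartbeats 100000 in
/-- The connection form of a flat metric is closed. -/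
lemma connForm_closed (h : IsNullFramedMetric D G p q) (hy : y ∈ D)
    (hflat : ∀ u v w, curvature G y u v w = 0) (v w : EuclideanSpace ℝ (Fin 2)) :
    fderiv ℝ (connForm G p q) y v w = fderiv ℝ (connForm G p q) y w v := by
  have hp := h.smooth_p.hasFDerivAt' h.isOpen hy
  have hp' := (h.smooth_p.fderiv_of_isOpen (m := ∞) h.isOpen (by simp)).hasFDerivAt' h.isOpen hy
  have hΓ := h.smooth_christoffel.hasFDerivAt' h.isOpen hy
  have hw := h.smooth_connForm.hasFDerivAt' h.isOpen hy
  have hcov : ∀ v, fderiv ℝ p y v = connForm G p q y v • p y - christoffelL G y v (p y) := fun v => by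
    rw [← h.covariant_p hy, covariant_apply, christoffelL_apply, add_sub_cancel_right]
  -- This is the derivative along v of ∇_w p = ω(w) p, where ω is the connection form.
  -- Antisymmetrising in v and w yields R(v, w)p = dω(v, w) p, so flatness gives dω = 0.
  have key : ∀ v w, fderiv ℝ (fderiv ℝ p) y v w + (fderiv ℝ (christoffelL G) y v w (p y)
      + christoffelL G y w (fderiv ℝ p y v))
      = fderiv ℝ (connForm G p q) y v w • p y + connForm G p q y w • fderiv ℝ p y v := fun v w => by
    have hl := (hp'.clm_apply (hasFDerivAt_const w y)).add
      ((hΓ.clm_apply (hasFDerivAt_const w y)).clm_apply hp)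
    have hr := (hw.clm_apply (hasFDerivAt_const w y)).smul hp
    have := hl.unique (hr.congr_of_eventuallyEq (Filter.eventually_of_mem (h.isOpen.mem_nhds hy)
      fun x hx => by
        have := h.covariant_p hx w
        rw [covariant_apply, ← christoffelL_apply] at this
        exact this))
    have := congrArg (fun A => A v) this
    simp at this
    rw [add_comm (christoffelL G y w _)] at this
    rw [this, add_comm]
  have hsymm : fderiv ℝ (fderiv ℝ p) y v w = fderiv ℝ (fderiv ℝ p) y w v :=
    ((h.smooth_p.contDiffAt (h.isOpen.mem_nhds hy)).isSymmSndFDerivAt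
      (by rw [minSmoothness_of_isRCLikeNormedField]; exact two_le_infty)).eq v w
  have h1 := key v w
  have h2 := key w v
  have h3 := hflat v w (p y)
  rw [curvature_eq h.isOpen h.smooth h.isInvertible hy] at h3
  rw [hcov, map_sub, map_smul] at h1 h2
  have h4 : (fderiv ℝ (connForm G p q) y v w - fderiv ℝ (connForm G p q) y w v) • p y = 0 := by
    rw [← h3]
    have h5 : fderiv ℝ (connForm G p q) y v w • p y = _ := (sub_eq_of_eq_add h1).symm
    have h6 : fderiv ℝ (connForm G p q) y w v • p y = _ := (sub_eq_of_eq_add h2).symm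
    rw [sub_smul, h5, h6, hsymm]
    module
  have h7 := congrArg (G y (q y)) h4
  simp [h.qp y hy] at h7
  linarith

/-- Rescaling a null frame by a primitive of its connection form makes it parallel. -/
lemma exists_parallel (h : IsNullFramedMetric D G p q) (hD : Convex ℝ D)
    (hflat : ∀ y ∈ D, ∀ u v w, curvature G y u v w = 0) :
    ∃ P Q, IsNullFramedMetric D G P Q ∧ (∀ y ∈ D, covariant G P y = 0) ∧
      ∀ y ∈ D, covariant G Q y = 0 := by
  obtain ⟨f, hf⟩ := hD.exists_forall_hasFDerivAt_of_fderiv_symmetric h.isOpen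
    (h.smooth_connForm.differentiableOn (by simp))
    (fun y hy v w => h.connForm_closed hy (hflat y hy) v w)
  have hfs : ContDiffOn ℝ ∞ f D := by
    rw [contDiffOn_infty_iff_fderiv_of_isOpen h.isOpen]
    exact ⟨fun y hy => (hf y hy).differentiableAt.differentiableWithinAt,
      h.smooth_connForm.congr fun y hy => (hf y hy).fderiv⟩
  refine ⟨fun y => Real.exp (-f y) • p y, fun y => Real.exp (f y) • q y,
    ⟨h.isOpen, h.smooth, h.symm, hfs.neg.exp.smul h.smooth_p, hfs.exp.smul h.smooth_q,
      fun y hy => by simp [h.pp y hy], fun y hy => by simp [h.qq y hy],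
      fun y hy => by simp [h.pq y hy, ← Real.exp_add]⟩, fun y hy => ?_, fun y hy => ?_⟩
  · ext1 v
    have h1 := h.covariant_p hy v
    rw [covariant_apply, ← christoffelL_apply] at h1
    have h2 : HasFDerivAt (fun y => Real.exp (-f y) • p y) _ y :=
      (hf y hy).neg.exp.smul (h.smooth_p.hasFDerivAt' h.isOpen hy)
    rw [covariant_apply, h2.fderiv, ← christoffelL_apply]
    simp
    rw [add_right_comm, ← smul_add, h1]
    module
  · ext1 v
    have h1 := h.covariant_q hy v
    rw [covariant_apply, ← christoffelL_apply] at h1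
    have h2 : HasFDerivAt (fun y => Real.exp (f y) • q y) _ y :=
      (hf y hy).exp.smul (h.smooth_q.hasFDerivAt' h.isOpen hy)
    rw [covariant_apply, h2.fderiv, ← christoffelL_apply]
    simp
    rw [add_right_comm, ← smul_add, h1]
    module

/-- The metric dual of a parallel vector field is exact. -/
lemma exists_primitive (h : IsNullFramedMetric D G p q) (hD : Convex ℝ D)
    (hp : ∀ y ∈ D, covariant G p y = 0) :
    ∃ f : EuclideanSpace ℝ (Fin 2) → ℝ, ContDiffOn ℝ ∞ f D ∧
      ∀ y ∈ D, HasFDerivAt f (-G y (p y)) y := by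
  have hs : ContDiffOn ℝ ∞ (fun y => -G y (p y)) D := (h.smooth.clm_apply h.smooth_p).neg
  obtain ⟨f, hf⟩ := hD.exists_forall_hasFDerivAt_of_fderiv_symmetric h.isOpen
    (hs.differentiableOn (by simp)) (fun y hy v w => by
      have hd := h.smooth.differentiableOn (by simp : (∞ : ℕ∞ω) ≠ 0)
      have h1 : ∀ v, fderiv ℝ p y v = -christoffel G y v (p y) := fun v => by
        have := covariant_apply (G := G) p (y := y) v
        rw [hp y hy] at this
        exact eq_neg_of_add_eq_zero_left this.symm
      -- Since p is parallel, metric compatibility leaves only a Christoffel term, and absence of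
      -- torsion makes it symmetric.
      have h2 : ∀ v w, fderiv ℝ (fun y => -G y (p y)) y v w
          = -G y (p y) (christoffel G y v w) := fun v w => by
        have h3 : HasFDerivAt (fun y => -G y (p y)) _ y :=
          ((h.smooth.hasFDerivAt' h.isOpen hy).clm_apply (h.smooth_p.hasFDerivAt' h.isOpen hy)).neg
        rw [h3.fderiv]
        simp [h1, fderiv_metric h.isOpen hd h.symm (h.isInvertible y hy) hy]
      rw [h2, h2, christoffel_symm h.isOpen hd h.symm hy])
  refine ⟨f, ?_, hf⟩
  rw [contDiffOn_infty_iff_fderiv_of_isOpen h.isOpen]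
  exact ⟨fun y hy => (hf y hy).differentiableAt.differentiableWithinAt,
    hs.congr fun y hy => (hf y hy).fderiv⟩

end IsNullFramedMetric

end Flat

/-- A flat Lorentzian metric in the plane has local null coordinates in which it is
`-(dx ⊗ dy + dy ⊗ dx)`. -/
theorem exists_flat_null_coordinates {D : Set (EuclideanSpace ℝ (Fin 2))}
    {G : EuclideanSpace ℝ (Fin 2) →
      EuclideanSpace ℝ (Fin 2) →L[ℝ] EuclideanSpace ℝ (Fin 2) →L[ℝ] ℝ}
    (hD : IsOpen D) (hG : ContDiffOn ℝ ∞ G D) (hs : ∀ y ∈ D, ∀ v w, G y v w = G y w v)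
    (hflat : ∀ y ∈ D, ∀ u v w, curvature G y u v w = 0) {x a b : EuclideanSpace ℝ (Fin 2)}
    (hx : x ∈ D) (haa : G x a a = 0) (hbb : G x b b = 0) (hab : G x a b = -1) :
    ∃ e : OpenPartialHomeomorph (EuclideanSpace ℝ (Fin 2)) (EuclideanSpace ℝ (Fin 2)),
      x ∈ e.source ∧ e.source ⊆ D ∧ ContDiffOn ℝ ∞ e e.source ∧ ContDiffOn ℝ ∞ e.symm e.target ∧
      ∀ y ∈ e.source, ∀ v w, G y v w
        = -(fderiv ℝ e y v 0 * fderiv ℝ e y w 1 + fderiv ℝ e y v 1 * fderiv ℝ e y w 0) := by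
  obtain ⟨D', p₀, q₀, hD', hx', hsub, hp₀, hq₀, hnull⟩ :=
    exists_smooth_null_frame hD hG hs hx haa hbb hab
  obtain ⟨r, hr, hball⟩ := Metric.isOpen_iff.mp hD' x hx'
  set B := Metric.ball x r
  have h₀ : IsNullFramedMetric B G p₀ q₀ :=
    { isOpen := Metric.isOpen_ball
      smooth := hG.mono (hball.trans hsub)
      symm := fun y hy => hs y (hsub (hball hy))
      smooth_p := hp₀.mono hball
      smooth_q := hq₀.mono hball
      pp := fun y hy => (hnull y (hball hy)).1
      qq := fun y hy => (hnull y (hball hy)).2.1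
      pq := fun y hy => (hnull y (hball hy)).2.2 }
  obtain ⟨p, q, h, hp, hq⟩ := h₀.exists_parallel (convex_ball x r)
    fun y hy => hflat y (hsub (hball hy))
  -- The first coordinate must have as differential the coefficient along p, which is -G(q, ·); this
  -- is why q supplies f and p supplies g.
  obtain ⟨f, hf, hf'⟩ := h.swap.exists_primitive (convex_ball x r) hq
  obtain ⟨g, hg, hg'⟩ := h.exists_primitive (convex_ball x r) hp
  set F : EuclideanSpace ℝ (Fin 2) → EuclideanSpace ℝ (Fin 2) := fun y =>
    f y • EuclideanSpace.single 0 (1 : ℝ) + g y • EuclideanSpace.single 1 (1 : ℝ)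
  have hF : ContDiffOn ℝ ∞ F B := (hf.smul contDiffOn_const).add (hg.smul contDiffOn_const)
  let A : EuclideanSpace ℝ (Fin 2) → EuclideanSpace ℝ (Fin 2) →L[ℝ] EuclideanSpace ℝ (Fin 2) :=
    fun y => (-G y (q y)).smulRight (EuclideanSpace.single 0 (1 : ℝ))
      + (-G y (p y)).smulRight (EuclideanSpace.single 1 (1 : ℝ))
  have hA0 : ∀ y v, A y v 0 = -G y (q y) v := fun y v => by simp [A]
  have hA1 : ∀ y v, A y v 1 = -G y (p y) v := fun y v => by simp [A]
  have hexp : ∀ y ∈ B, ∀ v, gradMap (p y) (q y) (A y v) = v := fun y hy v => by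
    rw [gradMap_apply, hA0, hA1]
    exact (null_expand (h.symm y hy) (h.pp y hy) (h.qq y hy) (h.pq y hy) v).symm
  have hexp' : ∀ y ∈ B, ∀ v, A y (gradMap (p y) (q y) v) = v := fun y hy v => by
    ext i
    fin_cases i
    · change A y _ 0 = v 0
      rw [hA0, gradMap_apply]
      simp [h.qp y hy, h.qq y hy]
    · change A y _ 1 = v 1
      rw [hA1, gradMap_apply]
      simp [h.pq y hy, h.pp y hy]
  have hFA : ∀ y ∈ B, HasFDerivAt F (A y) y := fun y hy =>
    ((hf' y hy).smul_const _).add ((hg' y hy).smul_const _)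
  have hequiv : ∀ y (hy : y ∈ B), HasFDerivAt F ((ContinuousLinearEquiv.equivOfInverse (A y)
      (gradMap (p y) (q y)) (hexp y hy) (hexp' y hy) : _ ≃L[ℝ] _) :
      EuclideanSpace ℝ (Fin 2) →L[ℝ] EuclideanSpace ℝ (Fin 2)) y := fun y hy => by
    convert hFA y hy using 1
    ext1 v; rfl
  have hxB : x ∈ B := Metric.mem_ball_self hr
  have hFx : ContDiffAt ℝ ∞ F x := hF.contDiffAt (h.isOpen.mem_nhds hxB)
  let e₀ := hFx.toOpenPartialHomeomorph F (hequiv x hxB) (by simp)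
  let e := e₀.restrOpen B h.isOpen
  have hsource : e.source = e₀.source ∩ B := rfl
  have he : ∀ y, e y = F y := fun y => rfl
  have hB : ∀ y ∈ e.source, y ∈ B := fun y hy => hy.2
  refine ⟨e, ⟨hFx.mem_toOpenPartialHomeomorph_source (hequiv x hxB) (by simp), hxB⟩,
    fun y hy => hsub (hball (hB y hy)), hF.mono hB, fun y hy => ?_, fun y hy v w => ?_⟩
  · have hy' := hB _ (e.map_target hy)
    exact (e.contDiffAt_symm hy (hequiv _ hy')
      (hF.contDiffAt (h.isOpen.mem_nhds hy'))).contDiffWithinAt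
  · have hy' := hB y hy
    have h1 : fderiv ℝ e y = A y := (hFA y hy').fderiv
    rw [h1, hA0, hA0, hA1, hA1]
    have h2 := null_expand (h.symm y hy') (h.pp y hy') (h.qq y hy') (h.pq y hy') v
    conv_lhs => rw [h2]
    simp
    ring

/-! ### Metrics obtained by projecting lifts to the pseudosphere -/

section Lift

variable {E : Type*} [NormedAddCommGroup E] [NormedSpace ℝ E]

/-- The pull-back by `z` of the connection form of the Hopf fibration. -/
def hopfForm (z : E → Fin 3 → ℂ) (x : E) : E →L[ℝ] ℂ := (hermL (z x)).comp (fderiv ℝ z x)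

/-- The horizontal part of the derivative of `z`. -/
def hderiv (z : E → Fin 3 → ℂ) (x : E) : E →L[ℝ] Fin 3 → ℂ :=
  fderiv ℝ z x - ((ContinuousLinearMap.lsmul ℝ ℂ : ℂ →L[ℝ] _).flip (z x)).comp (hopfForm z x)

/-- The metric induced by the composition of `z` with the Hopf fibration. -/
def hmetric (z : E → Fin 3 → ℂ) (x : E) : E →L[ℝ] E →L[ℝ] ℝ :=
  reHerm.bilinearComp (hderiv z x) (hderiv z x)

lemma hopfForm_apply (z : E → Fin 3 → ℂ) (x v : E) :
    hopfForm z x v = herm (z x) (fderiv ℝ z x v) := rfl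

lemma hderiv_apply (z : E → Fin 3 → ℂ) (x v : E) :
    hderiv z x v = fderiv ℝ z x v - hopfForm z x v • z x := rfl

lemma hmetric_apply (z : E → Fin 3 → ℂ) (x v w : E) :
    hmetric z x v w = (herm (hderiv z x v) (hderiv z x w)).re := rfl

lemma hmetric_symm (z : E → Fin 3 → ℂ) (x v w : E) : hmetric z x v w = hmetric z x w v := by
  rw [hmetric_apply, hmetric_apply, herm_re_comm]

variable {z : E → Fin 3 → ℂ} {D : Set E} {x : E}

lemma smooth_hopfForm (hD : IsOpen D) (hz : ContDiffOn ℝ ∞ z D) :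
    ContDiffOn ℝ ∞ (hopfForm z) D :=
  (hermL.contDiff.comp_contDiffOn hz).clm_comp (hz.fderiv_of_isOpen hD (by simp))

lemma smooth_hderiv (hD : IsOpen D) (hz : ContDiffOn ℝ ∞ z D) :
    ContDiffOn ℝ ∞ (hderiv z) D := by
  have h1 : ContDiffOn ℝ ∞ (fun y => (ContinuousLinearMap.lsmul ℝ ℂ :
      ℂ →L[ℝ] (Fin 3 → ℂ) →L[ℝ] (Fin 3 → ℂ)).flip (z y)) D :=
    (ContinuousLinearMap.contDiff _).comp_contDiffOn hz
  exact (hz.fderiv_of_isOpen hD (by simp)).sub (h1.clm_comp (smooth_hopfForm hD hz))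

lemma smooth_hmetric [FiniteDimensional ℝ E] (hD : IsOpen D) (hz : ContDiffOn ℝ ∞ z D) :
    ContDiffOn ℝ ∞ (hmetric z) D := by
  refine contDiffOn_clm_apply.mpr fun v => contDiffOn_clm_apply.mpr fun w => ?_
  have h : ∀ u, ContDiffOn ℝ ∞ (fun y => hderiv z y u) D := fun u =>
    (smooth_hderiv hD hz).clm_apply contDiffOn_const
  have h1 : ContDiffOn ℝ ∞ (fun y => hermL (hderiv z y v)) D :=
    hermL.contDiff.comp_contDiffOn (h v)
  have h2 : ContDiffOn ℝ ∞ (fun y => (hermL (hderiv z y v) (hderiv z y w)).re) D :=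
    Complex.reCLM.contDiff.comp_contDiffOn (h1.clm_apply (h w))
  exact h2

lemma herm_hderiv (h1 : herm (z x) (z x) = 1) (v : E) : herm (z x) (hderiv z x v) = 0 := by
  rw [hderiv_apply, herm_sub_right, herm_smul_right, h1, hopfForm_apply]; ring

lemma conj_hopfForm (hD : IsOpen D) (hz : ContDiffOn ℝ ∞ z D) (h1 : ∀ y ∈ D, herm (z y) (z y) = 1)
    (hx : x ∈ D) (v : E) : conj (hopfForm z x v) = -hopfForm z x v := by
  have hz' := hz.hasFDerivAt' hD hx
  have h2 := (hermL.hasFDerivAt_of_bilinear hz' hz').unique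
    ((hasFDerivAt_const (1 : ℂ) x).congr_of_eventuallyEq
      (Filter.eventually_of_mem (hD.mem_nhds hx) h1))
  have h3 := congrArg (fun A => A v) h2
  simp at h3
  rw [hopfForm_apply, conj_herm]
  linear_combination h3

/-- The symmetric part of the horizontal second derivative of `z`. -/
def hsecond (z : E → Fin 3 → ℂ) (x v w : E) : Fin 3 → ℂ :=
  fderiv ℝ (fderiv ℝ z) x v w - hopfForm z x w • hderiv z x v - hopfForm z x v • hderiv z x w

lemma hsecond_symm (hD : IsOpen D) (hz : ContDiffOn ℝ ∞ z D) (hx : x ∈ D) (v w : E) :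
    hsecond z x v w = hsecond z x w v := by
  have h : fderiv ℝ (fderiv ℝ z) x v w = fderiv ℝ (fderiv ℝ z) x w v :=
    ((hz.contDiffAt (hD.mem_nhds hx)).isSymmSndFDerivAt
      (by rw [minSmoothness_of_isRCLikeNormedField]; exact two_le_infty)).eq v w
  rw [hsecond, hsecond, h]
  abel

/-- The term `hopfForm z x v • hderiv z x w` records the motion of z along the Hopf fibre, under
which horizontal lifts are multiplied by the same phase. Once it and a multiple of z are removed,
the rest is symmetric in v and w, which is the absence of torsion downstairs. -/
lemma fderiv_hderiv (hD : IsOpen D) (hz : ContDiffOn ℝ ∞ z D) (hx : x ∈ D) (v w : E) :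
    ∃ c : ℂ, fderiv ℝ (hderiv z) x v w
      = hsecond z x v w + hopfForm z x v • hderiv z x w + c • z x := by
  have h1 := ((smooth_hderiv hD hz).hasFDerivAt' hD hx).clm_apply (hasFDerivAt_const w x)
  have h2 := (((hz.fderiv_of_isOpen (m := ∞) hD (by simp)).hasFDerivAt' hD hx).clm_apply
    (hasFDerivAt_const w x)).sub ((((smooth_hopfForm hD hz).hasFDerivAt' hD hx).clm_apply
      (hasFDerivAt_const w x)).smul (hz.hasFDerivAt' hD hx))
  have h3 := congrArg (fun A => A v) (h1.unique h2)
  simp at h3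
  have h4 : fderiv ℝ z x v = hderiv z x v + hopfForm z x v • z x := by
    rw [hderiv_apply, sub_add_cancel]
  refine ⟨-(hopfForm z x w * hopfForm z x v) - fderiv ℝ (hopfForm z) x v w, ?_⟩
  rw [h3, hsecond, h4]
  module

lemma herm_fderiv_hderiv (hD : IsOpen D) (hz : ContDiffOn ℝ ∞ z D)
    (h1 : ∀ y ∈ D, herm (z y) (z y) = 1) (hx : x ∈ D) (v w u : E) :
    herm (fderiv ℝ (hderiv z) x v w - hopfForm z x v • hderiv z x w) (hderiv z x u)
      = herm (hsecond z x v w) (hderiv z x u) := by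
  obtain ⟨c, hc⟩ := fderiv_hderiv hD hz hx v w
  rw [hc, add_sub_right_comm, add_sub_cancel_right, herm_add_left, herm_smul_left,
    herm_hderiv (h1 x hx), mul_zero, add_zero]

/-- The Hopf form is imaginary, so the phase motion it contributes to both factors cancels in the
real part of b. -/
lemma fderiv_hmetric [FiniteDimensional ℝ E] (hD : IsOpen D) (hz : ContDiffOn ℝ ∞ z D)
    (h1 : ∀ y ∈ D, herm (z y) (z y) = 1) (hx : x ∈ D) (v w u : E) :
    fderiv ℝ (hmetric z) x v w u = (herm (hsecond z x v w) (hderiv z x u)).re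
      + (herm (hsecond z x v u) (hderiv z x w)).re := by
  have h2 := (smooth_hderiv hD hz).hasFDerivAt' hD hx
  have h3 := hermL.hasFDerivAt_of_bilinear (h2.clm_apply (hasFDerivAt_const w x))
    (h2.clm_apply (hasFDerivAt_const u x))
  have h4 := Complex.reCLM.hasFDerivAt.comp x h3
  have h5 := (((smooth_hmetric hD hz).hasFDerivAt' hD hx).clm_apply
    (hasFDerivAt_const w x)).clm_apply (hasFDerivAt_const u x)
  have h6 := congrArg (fun A => A v) (h5.unique h4)
  simp at h6
  rw [h6, herm_re_comm (hderiv z x w)]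
  have hw := congrArg Complex.re (herm_fderiv_hderiv hD hz h1 hx v w u)
  have hu := congrArg Complex.re (herm_fderiv_hderiv hD hz h1 hx v u w)
  have ha := congrArg Complex.re (conj_hopfForm hD hz h1 hx v)
  have hb := congrArg Complex.im (conj_herm (hderiv z x w) (hderiv z x u))
  have hb' := congrArg Complex.re (conj_herm (hderiv z x w) (hderiv z x u))
  simp [herm_sub_left, herm_smul_left] at hw hu ha hb hb'
  have ha' : (hopfForm z x v).re = 0 := by linarith
  rw [ha'] at hw hu
  rw [← hw, ← hu, ← hb]
  ring

/-- The Levi-Civita connection of the base is the horizontal part of the derivative. -/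
lemma hmetric_christoffel [FiniteDimensional ℝ E] (hD : IsOpen D) (hz : ContDiffOn ℝ ∞ z D)
    (h1 : ∀ y ∈ D, herm (z y) (z y) = 1) (hx : x ∈ D) (hi : (hmetric z x).IsInvertible)
    (v w u : E) :
    hmetric z x (christoffel (hmetric z) x v w) u
      = (herm (fderiv ℝ (hderiv z) x v w - hopfForm z x v • hderiv z x w) (hderiv z x u)).re := by
  rw [herm_fderiv_hderiv hD hz h1 hx, christoffel_koszul hi]
  simp only [fderiv_hmetric hD hz h1 hx]
  -- The Koszul expression has six terms in `hsecond`; by symmetry four cancel in pairs and the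
  -- other two coincide.
  rw [hsecond_symm hD hz hx w v, hsecond_symm hD hz hx u v, hsecond_symm hD hz hx u w]
  ring

end Lift

/-! ### The unit section of the Hopf fibration over an affine chart -/

/-- The section of the Hopf fibration whose values are positive multiples of `homog k w`. -/
def unitSection (k : Fin 2) (w : ℂ × ℂ) : Fin 3 → ℂ := (Real.sqrt (lenSq k w))⁻¹ • homog k w

lemma unitSection_eq (k : Fin 2) {w : ℂ × ℂ} (hw : 0 < lenSq k w) :
    unitSection k w = (unitPoint k w).1 := by
  rw [unitPoint_val k hw, unitSection, ← Complex.coe_smul, Complex.ofReal_inv]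

lemma herm_unitSection (k : Fin 2) {w : ℂ × ℂ} (hw : 0 < lenSq k w) :
    herm (unitSection k w) (unitSection k w) = 1 := by
  rw [unitSection_eq k hw]; exact (unitPoint k w).2

lemma isOpen_lenSq_pos (k : Fin 2) : IsOpen {w | 0 < lenSq k w} :=
  isOpen_lt continuous_const (continuous_lenSq k)

lemma contDiff_lenSq (k : Fin 2) : ContDiff ℝ ∞ (lenSq k) := by
  have h1 : ContDiff ℝ ∞ (fun w => hermL (homog k w)) := hermL.contDiff.comp (contDiff_homog k)
  have h2 : ContDiff ℝ ∞ (fun w => (hermL (homog k w) (homog k w)).re) :=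
    Complex.reCLM.contDiff.comp (h1.clm_apply (contDiff_homog k))
  exact h2

lemma smooth_invSqrt_lenSq (k : Fin 2) :
    ContDiffOn ℝ ∞ (fun w => (Real.sqrt (lenSq k w))⁻¹) {w | 0 < lenSq k w} :=
  ((contDiff_lenSq k).contDiffOn.sqrt fun _ hw => ne_of_gt hw).inv
    fun _ hw => (Real.sqrt_pos.mpr hw).ne'

lemma smooth_unitSection (k : Fin 2) : ContDiffOn ℝ ∞ (unitSection k) {w | 0 < lenSq k w} :=
  (smooth_invSqrt_lenSq k).smul (contDiff_homog k).contDiffOn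

lemma hasFDerivAt_homog (k : Fin 2) (w : ℂ × ℂ) :
    HasFDerivAt (homog k) ((LinearMap.toContinuousLinearMap (planeIncl k)).restrictScalars ℝ) w :=
  (((LinearMap.toContinuousLinearMap (planeIncl k)).restrictScalars ℝ).hasFDerivAt).add_const _

lemma horizontalLift_apply (k : Fin 2) (w v : ℂ × ℂ) :
    horizontalLift k w v = ((Real.sqrt (lenSq k w) : ℂ)⁻¹) •
        (planeIncl k v - (herm (homog k w) (planeIncl k v) / lenSq k w) • homog k w) := rfl

lemma horizontalLift_smul (k : Fin 2) (w v : ℂ × ℂ) (c : ℂ) :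
    horizontalLift k w (c • v) = c • horizontalLift k w v := by
  simp only [horizontalLift_apply, map_smul, herm_smul_right]
  module

lemma hderiv_unitSection (k : Fin 2) {w : ℂ × ℂ} (hw : 0 < lenSq k w) :
    hderiv (unitSection k) w = horizontalLift k w := by
  refine ContinuousLinearMap.ext fun v => ?_
  set r : ℝ := (Real.sqrt (lenSq k w))⁻¹ with hr
  have hr2 : (r : ℂ) ^ 2 * lenSq k w = 1 := by
    rw [hr, ← Complex.ofReal_pow, ← Complex.ofReal_mul, inv_pow, Real.sq_sqrt hw.le,
      inv_mul_cancel₀ hw.ne', Complex.ofReal_one]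
  have hN : (lenSq k w : ℂ) ≠ 0 := Complex.ofReal_ne_zero.mpr hw.ne'
  have h1 : HasFDerivAt (unitSection k) _ w :=
    ((smooth_invSqrt_lenSq k).hasFDerivAt' (isOpen_lenSq_pos k) hw).smul (hasFDerivAt_homog k w)
  have h2 : herm (homog k w) (homog k w) = lenSq k w := herm_self _
  have h3 : fderiv ℝ (unitSection k) w v = (r : ℂ) • planeIncl k v
      + ((fderiv ℝ (fun w => (Real.sqrt (lenSq k w))⁻¹) w v : ℝ) : ℂ) • homog k w := by
    rw [h1.fderiv]
    simp [hr]
    rw [← Complex.coe_smul, Complex.ofReal_inv]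
  -- The derivative t of the normalising factor only contributes a multiple of `homog k w`, which
  -- the horizontal projection discards; its value is never needed.
  generalize fderiv ℝ (fun w => (Real.sqrt (lenSq k w))⁻¹) w v = t at h3
  have h4 : unitSection k w = (r : ℂ) • homog k w := by
    rw [Complex.coe_smul]; rfl
  rw [hderiv_apply, hopfForm_apply, h3, h4, horizontalLift_apply, ← Complex.ofReal_inv, ← hr]
  simp only [herm_smul_left, herm_add_right, herm_smul_right, h2, Complex.conj_ofReal]
  have h5 : (r : ℂ) * (herm (homog k w) (planeIncl k v) / lenSq k w)
      = r ^ 3 * herm (homog k w) (planeIncl k v) := by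
    field_simp
    linear_combination -(r * herm (homog k w) (planeIncl k v)) * hr2
  match_scalars
  · ring
  · linear_combination -(t : ℂ) * hr2 + h5

lemma fubiniStudy_eq (k : Fin 2) {w : ℂ × ℂ} (hw : 0 < lenSq k w) :
    fubiniStudy k w = hmetric (unitSection k) w := by
  rw [fubiniStudy, hmetric, hderiv_unitSection k hw]

lemma fubiniStudy_apply (k : Fin 2) (w u v : ℂ × ℂ) :
    fubiniStudy k w u v = (herm (horizontalLift k w u) (horizontalLift k w v)).re := rfl

lemma fubiniStudy_eventuallyEq (k : Fin 2) {w : ℂ × ℂ} (hw : 0 < lenSq k w) :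
    fubiniStudy k =ᶠ[nhds w] hmetric (unitSection k) :=
  Filter.eventually_of_mem ((isOpen_lenSq_pos k).mem_nhds hw) fun _ h => fubiniStudy_eq k h

lemma christoffel_congr {E : Type*} [NormedAddCommGroup E] [NormedSpace ℝ E]
    {G G' : E → E →L[ℝ] E →L[ℝ] ℝ} {x : E} (h : G =ᶠ[nhds x] G') (v w : E) :
    christoffel G x v w = christoffel G' x v w := by
  rw [christoffel, christoffel, h.fderiv_eq, h.eq_of_nhds]

lemma exists_planeIncl_add (k : Fin 2) (w : ℂ × ℂ) (x : Fin 3 → ℂ) :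
    ∃ (v : ℂ × ℂ) (c : ℂ), x = planeIncl k v + c • homog k w := by
  have h : ∀ y : Fin 3 → ℂ, y k.succ = 0 → ∃ v, y = planeIncl k v := by
    intro y hy
    fin_cases k
    · exact ⟨(y 0, y 2), by ext i; fin_cases i <;> simp_all [planeIncl]⟩
    · exact ⟨(y 0, y 1), by ext i; fin_cases i <;> simp_all [planeIncl]⟩
  obtain ⟨v, hv⟩ := h (x - x k.succ • homog k w) (by simp [homog_succ])
  exact ⟨v, x k.succ, by rw [← hv, sub_add_cancel]⟩

lemma herm_homog_horizontalLift (k : Fin 2) {w : ℂ × ℂ} (hw : 0 < lenSq k w) (v : ℂ × ℂ) :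
    herm (homog k w) (horizontalLift k w v) = 0 := by
  have h2 : herm (homog k w) (homog k w) = lenSq k w := herm_self _
  have hN : (lenSq k w : ℂ) ≠ 0 := Complex.ofReal_ne_zero.mpr hw.ne'
  rw [horizontalLift_apply, herm_smul_right, herm_sub_right, herm_smul_right, h2,
    div_mul_cancel₀ _ hN, sub_self, mul_zero]

/-- Upgrades orthogonality for the real metric to orthogonality for b whenever the test vectors are
closed under multiplication by i, as horizontal lifts are. -/
lemma herm_eq_zero_of_re {x y : Fin 3 → ℂ} (h1 : (herm x y).re = 0)
    (h2 : (herm x (Complex.I • y)).re = 0) : herm x y = 0 := by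
  rw [herm_smul_right] at h2
  simp at h2
  exact Complex.ext h1 h2

lemma planeIncl_injective (k : Fin 2) : Function.Injective (planeIncl k) := by
  rw [injective_iff_map_eq_zero]
  intro v hv
  fin_cases k
  · exact Prod.ext (by simpa [planeIncl] using congrFun hv 0)
      (by simpa [planeIncl] using congrFun hv 2)
  · exact Prod.ext (by simpa [planeIncl] using congrFun hv 0)
      (by simpa [planeIncl] using congrFun hv 1)

lemma planeIncl_succ (k : Fin 2) (v : ℂ × ℂ) : planeIncl k v k.succ = 0 := by
  fin_cases k <;> simp [planeIncl]

/-- A horizontal vector orthogonal to all horizontal vectors is also orthogonal to `homog k w`,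
hence to all of ℂ³, and b is nondegenerate. -/
lemma fubiniStudy_isInvertible (k : Fin 2) {w : ℂ × ℂ} (hw : 0 < lenSq k w) :
    (fubiniStudy k w).IsInvertible := by
  refine isInvertible_of_nondegenerate fun t ht => ?_
  have hr : (Real.sqrt (lenSq k w) : ℂ) ≠ 0 :=
    Complex.ofReal_ne_zero.mpr (Real.sqrt_pos.mpr hw).ne'
  have hs : herm (horizontalLift k w t) (homog k w) = 0 := by
    rw [← conj_herm, herm_homog_horizontalLift k hw, map_zero]
  have h1 : ∀ u, herm (horizontalLift k w t) (horizontalLift k w u) = 0 := fun u =>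
    herm_eq_zero_of_re (ht u) (by rw [← horizontalLift_smul]; exact ht _)
  have h2 : ∀ x, herm (horizontalLift k w t) x = 0 := fun x => by
    obtain ⟨v, c, rfl⟩ := exists_planeIncl_add k w x
    have h3 := h1 v
    rw [horizontalLift_apply k w v, herm_smul_right, herm_sub_right, herm_smul_right, hs, mul_zero,
      sub_zero] at h3
    rw [herm_add_right, herm_smul_right, hs, mul_zero, add_zero]
    exact (mul_eq_zero.mp h3).resolve_left (inv_ne_zero hr)
  have h3 : horizontalLift k w t = 0 := by
    have e0 := h2 (Pi.single 0 1)
    have e1 := h2 (Pi.single 1 1)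
    have e2 := h2 (Pi.single 2 1)
    simp [herm] at e0 e1 e2
    ext i; fin_cases i <;> simp [*]
  rw [horizontalLift_apply, smul_eq_zero] at h3
  have h4 := h3.resolve_left (inv_ne_zero hr)
  have h5 := congrFun h4 k.succ
  simp [planeIncl_succ, homog_succ, hw.ne'] at h5
  rw [h5, zero_div, zero_smul, sub_zero] at h4
  exact planeIncl_injective k (by rw [h4, map_zero])

/-- The case of `hmetric_christoffel` in which the lift is the unit section over the affine chart
itself. -/
lemma fubiniStudy_christoffel (k : Fin 2) {w : ℂ × ℂ} (hw : 0 < lenSq k w) (u v t : ℂ × ℂ) :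
    fubiniStudy k w (christoffel (fubiniStudy k) w u v) t
      = (herm (fderiv ℝ (hderiv (unitSection k)) w u v
          - hopfForm (unitSection k) w u • hderiv (unitSection k) w v)
        (hderiv (unitSection k) w t)).re := by
  rw [christoffel_congr (fubiniStudy_eventuallyEq k hw), fubiniStudy_eq k hw]
  exact hmetric_christoffel (isOpen_lenSq_pos k) (smooth_unitSection k)
    (fun y hy => herm_unitSection k hy) hw
    (by rw [← fubiniStudy_eq k hw]; exact fubiniStudy_isInvertible k hw) u v t

/-! ### Surfaces in an affine chart and their lifts -/

section Surface

/-- A smooth map from an open set of the plane into an affine chart of `CP21`. -/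
structure IsChartSurface (k : Fin 2) (D : Set (EuclideanSpace ℝ (Fin 2)))
    (f : EuclideanSpace ℝ (Fin 2) → ℂ × ℂ) : Prop where
  isOpen : IsOpen D
  smooth : ContDiffOn ℝ ∞ f D
  pos : ∀ y ∈ D, 0 < lenSq k (f y)

/-- The lift of a surface to the pseudosphere. -/
def surfaceLift (k : Fin 2) (f : EuclideanSpace ℝ (Fin 2) → ℂ × ℂ)
    (y : EuclideanSpace ℝ (Fin 2)) : Fin 3 → ℂ := unitSection k (f y)

namespace IsChartSurface

variable {k : Fin 2} {D : Set (EuclideanSpace ℝ (Fin 2))}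
  {f : EuclideanSpace ℝ (Fin 2) → ℂ × ℂ} {y : EuclideanSpace ℝ (Fin 2)}

lemma smooth_lift (h : IsChartSurface k D f) : ContDiffOn ℝ ∞ (surfaceLift k f) D :=
  (smooth_unitSection k).comp h.smooth h.pos

lemma herm_lift (h : IsChartSurface k D f) :
    ∀ y ∈ D, herm (surfaceLift k f y) (surfaceLift k f y) = 1 :=
  fun y hy => herm_unitSection k (h.pos y hy)

lemma fderiv_lift (h : IsChartSurface k D f) (hy : y ∈ D) (v : EuclideanSpace ℝ (Fin 2)) :
    fderiv ℝ (surfaceLift k f) y v = fderiv ℝ (unitSection k) (f y) (fderiv ℝ f y v) := by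
  have h1 : HasFDerivAt (surfaceLift k f) _ y :=
    ((smooth_unitSection k).hasFDerivAt' (isOpen_lenSq_pos k) (h.pos y hy)).comp y
      (h.smooth.hasFDerivAt' h.isOpen hy)
  rw [h1.fderiv]; rfl

lemma hopfForm_lift (h : IsChartSurface k D f) (hy : y ∈ D) (v : EuclideanSpace ℝ (Fin 2)) :
    hopfForm (surfaceLift k f) y v = hopfForm (unitSection k) (f y) (fderiv ℝ f y v) := by
  rw [hopfForm_apply, h.fderiv_lift hy]; rfl

lemma hderiv_lift (h : IsChartSurface k D f) (hy : y ∈ D) (v : EuclideanSpace ℝ (Fin 2)) :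
    hderiv (surfaceLift k f) y v = horizontalLift k (f y) (fderiv ℝ f y v) := by
  rw [← hderiv_unitSection k (h.pos y hy), hderiv_apply, h.fderiv_lift hy, h.hopfForm_lift hy]
  rfl

lemma inducedMetric_eq (h : IsChartSurface k D f) (hy : y ∈ D) :
    inducedMetric (fubiniStudy k) f y = hmetric (surfaceLift k f) y := by
  refine ContinuousLinearMap.ext fun v => ContinuousLinearMap.ext fun w => ?_
  rw [hmetric_apply, h.hderiv_lift hy, h.hderiv_lift hy]
  rfl

lemma smooth_inducedMetric (h : IsChartSurface k D f) :
    ContDiffOn ℝ ∞ (inducedMetric (fubiniStudy k) f) D :=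
  (smooth_hmetric h.isOpen h.smooth_lift).congr fun _ hy => h.inducedMetric_eq hy

lemma inducedMetric_symm (h : IsChartSurface k D f) (hy : y ∈ D)
    (v w : EuclideanSpace ℝ (Fin 2)) :
    inducedMetric (fubiniStudy k) f y v w = inducedMetric (fubiniStudy k) f y w v := by
  rw [h.inducedMetric_eq hy, hmetric_symm]

/-- The ambient covariant derivative along the surface is computed by the lift. -/
lemma fubiniStudy_covariant (h : IsChartSurface k D f) (hy : y ∈ D)
    (v w : EuclideanSpace ℝ (Fin 2)) (t : ℂ × ℂ) :
    fubiniStudy k (f y) (fderiv ℝ (fun x => fderiv ℝ f x w) y v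
        + christoffel (fubiniStudy k) (f y) (fderiv ℝ f y v) (fderiv ℝ f y w)) t
      = (herm (fderiv ℝ (fun x => hderiv (surfaceLift k f) x w) y v
          - hopfForm (surfaceLift k f) y v • hderiv (surfaceLift k f) y w)
        (horizontalLift k (f y) t)).re := by
  have hpos := h.pos y hy
  have h1 := ((smooth_hderiv (isOpen_lenSq_pos k) (smooth_unitSection k)).hasFDerivAt'
    (isOpen_lenSq_pos k) hpos).comp y (h.smooth.hasFDerivAt' h.isOpen hy)
  have h2 := (h.smooth.fderiv_apply_const h.isOpen w).hasFDerivAt' h.isOpen hy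
  have h3 : HasFDerivAt (fun x => hderiv (surfaceLift k f) x w) _ y :=
    (h1.clm_apply h2).congr_of_eventuallyEq
      (Filter.eventually_of_mem (h.isOpen.mem_nhds hy) fun x hx => by
        change hderiv (surfaceLift k f) x w = hderiv (unitSection k) (f x) (fderiv ℝ f x w)
        rw [h.hderiv_lift hx, ← hderiv_unitSection k (h.pos x hx)])
  rw [h3.fderiv, h.hopfForm_lift hy, h.hderiv_lift hy, map_add, add_apply,
    fubiniStudy_christoffel k hpos, fubiniStudy_apply, ← hderiv_unitSection k hpos,
    ← Complex.add_re, ← herm_add_left]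
  congr 2
  simp
  abel

lemma christoffel_symm' (h : IsChartSurface k D f) (hy : y ∈ D) (u v : ℂ × ℂ) :
    christoffel (fubiniStudy k) (f y) u v = christoffel (fubiniStudy k) (f y) v u := by
  have hpos := h.pos y hy
  rw [christoffel_congr (fubiniStudy_eventuallyEq k hpos),
    christoffel_congr (fubiniStudy_eventuallyEq k hpos)]
  exact christoffel_symm (isOpen_lenSq_pos k)
    ((smooth_hmetric (isOpen_lenSq_pos k) (smooth_unitSection k)).differentiableOn (by simp))
    (fun x _ v w => hmetric_symm _ x v w) hpos u v

lemma second_fderiv_symm (h : IsChartSurface k D f) (hy : y ∈ D)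
    (v w : EuclideanSpace ℝ (Fin 2)) :
    fderiv ℝ (fun x => fderiv ℝ f x w) y v = fderiv ℝ (fun x => fderiv ℝ f x v) y w := by
  have h1 := (h.smooth.fderiv_of_isOpen (m := ∞) h.isOpen (by simp)).hasFDerivAt' h.isOpen hy
  have h2 : ∀ v w, fderiv ℝ (fun x => fderiv ℝ f x w) y v = fderiv ℝ (fderiv ℝ f) y v w :=
    fun v w => by
      rw [(h1.clm_apply (hasFDerivAt_const w y)).fderiv]; simp
  rw [h2, h2]
  exact ((h.smooth.contDiffAt (h.isOpen.mem_nhds hy)).isSymmSndFDerivAt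
    (by rw [minSmoothness_of_isRCLikeNormedField]; exact two_le_infty)).eq v w

/-- In flat null coordinates, the mean curvature vector is `-h(∂x, ∂y)`. -/
lemma mixed_eq_zero (h : IsChartSurface k D f) (hy : y ∈ D)
    (hflat : ∀ y ∈ D, ∀ v w, inducedMetric (fubiniStudy k) f y v w = -(v 0 * w 1 + v 1 * w 0))
    (hmin : meanCurvature (fubiniStudy k) f y = 0) :
    fderiv ℝ (fun x => fderiv ℝ f x (EuclideanSpace.single 1 1)) y (EuclideanSpace.single 0 1)
      + christoffel (fubiniStudy k) (f y) (fderiv ℝ f y (EuclideanSpace.single 0 1))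
        (fderiv ℝ f y (EuclideanSpace.single 1 1)) = 0 := by
  have hmat : (Matrix.of fun k' l : Fin 2 => inducedMetric (fubiniStudy k) f y
      (EuclideanSpace.single k' 1) (EuclideanSpace.single l 1))⁻¹ = !![0, -1; -1, 0] := by
    apply Matrix.inv_eq_right_inv
    ext i j
    fin_cases i <;> fin_cases j <;> simp [Matrix.mul_apply, hflat y hy]
  -- The metric coefficients are constant, so the intrinsic Christoffel terms vanish and the second
  -- fundamental form is the full ambient derivative.
  have hconst : inducedMetric (fubiniStudy k) f =ᶠ[nhds y]
      fun _ => inducedMetric (fubiniStudy k) f y :=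
    Filter.eventually_of_mem (h.isOpen.mem_nhds hy) fun x hx =>
      ContinuousLinearMap.ext fun v => ContinuousLinearMap.ext fun w => by
        rw [hflat x hx, hflat y hy]
  have hΓ : ∀ v w, christoffel (inducedMetric (fubiniStudy k) f) y v w = 0 := fun v w => by
    rw [christoffel_congr hconst, christoffel]
    simp
  have hsf : ∀ v w, secondFundamentalForm (fubiniStudy k) f y v w
      = secondFundamentalForm (fubiniStudy k) f y w v := fun v w => by
    simp only [secondFundamentalForm, hΓ]
    rw [h.second_fderiv_symm hy, h.christoffel_symm' hy]
  rw [meanCurvature, hmat] at hmin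
  simp [Fin.sum_univ_two] at hmin
  rw [hsf (EuclideanSpace.single 1 1), ← neg_add, neg_eq_zero, ← two_smul ℝ, smul_eq_zero] at hmin
  have h2 := hmin.resolve_left (by norm_num)
  rw [secondFundamentalForm, hΓ, map_zero, sub_zero] at h2
  exact (smul_eq_zero.mp h2).resolve_left (by norm_num)

lemma herm_re_I_smul_left (x y : Fin 3 → ℂ) : (herm (Complex.I • x) y).re = (herm x y).im := by
  rw [herm_smul_left]; simp

lemma herm_self_im (x : Fin 3 → ℂ) : (herm x x).im = 0 := by
  rw [herm_self]; simp

/-- The square of the Kähler angle function of a surface with Wirtinger angle `α`. -/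
lemma kaehler_sq (h : IsChartSurface k D f) (hy : y ∈ D)
    (hflat : ∀ y ∈ D, ∀ v w, inducedMetric (fubiniStudy k) f y v w = -(v 0 * w 1 + v 1 * w 0))
    {α : ℝ} (hα : IsWirtingerAngle α (fubiniStudy k) f y) :
    (herm (hderiv (surfaceLift k f) y (EuclideanSpace.single 0 1))
      (hderiv (surfaceLift k f) y (EuclideanSpace.single 1 1))).im ^ 2 = Real.sinh α ^ 2 := by
  obtain ⟨e₁, e₂, h11, h22, h12, hJ, -⟩ := hα
  have hJ2 := hJ e₂
  have h0 : fubiniStudy k (f y) (fderiv ℝ f y (Real.sinh α • e₁)) (fderiv ℝ f y e₂)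
      = Real.sinh α • inducedMetric (fubiniStudy k) f y e₁ e₂ := by
    change inducedMetric (fubiniStudy k) f y (Real.sinh α • e₁) e₂ = _
    rw [map_smul, smul_apply]
  rw [map_sub, sub_apply, h0] at hJ2
  rw [h12, fubiniStudy_apply, horizontalLift_smul, ← h.hderiv_lift hy, ← h.hderiv_lift hy,
    herm_re_I_smul_left, map_plane _ e₁, map_plane _ e₂] at hJ2
  rw [hflat y hy] at h11 h22 h12
  set X := hderiv (surfaceLift k f) y (EuclideanSpace.single 0 1)
  set Y := hderiv (surfaceLift k f) y (EuclideanSpace.single 1 1)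
  have hYX : (herm Y X).im = -(herm X Y).im := by rw [← conj_herm, Complex.conj_im]
  simp only [herm_add_left, herm_add_right, herm_real_smul_left, herm_real_smul_right,
    Complex.add_im, Complex.im_ofReal_mul, herm_self_im, hYX,
    smul_eq_mul] at hJ2
  -- The change from coordinate null vectors to e₁, e₂ has determinant ±1. The Kähler form is
  -- multiplied by this determinant, so the Wirtinger angle controls it only up to sign.
  have hdet : (e₁ 0 * e₂ 1 - e₁ 1 * e₂ 0) ^ 2 = 1 := by
    linear_combination (-(e₁ 0 * e₂ 1 + e₁ 1 * e₂ 0) - 1) * h12 + 2 * e₂ 0 * e₂ 1 * h11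
  have hk : (e₁ 0 * e₂ 1 - e₁ 1 * e₂ 0) * (herm X Y).im = -Real.sinh α := by
    linear_combination hJ2
  calc (herm X Y).im ^ 2 = (e₁ 0 * e₂ 1 - e₁ 1 * e₂ 0) ^ 2 * (herm X Y).im ^ 2 := by
        rw [hdet, one_mul]
    _ = ((e₁ 0 * e₂ 1 - e₁ 1 * e₂ 0) * (herm X Y).im) ^ 2 := by ring
    _ = Real.sinh α ^ 2 := by rw [hk, neg_sq]

/-- Removes the sign ambiguity of `kaehler_sq`: for c ≠ 0, differentiating g² = c gives g dg = 0
with g nonzero. -/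
lemma exists_const_of_sq_eq {g : EuclideanSpace ℝ (Fin 2) → ℝ} {c : ℝ} (hD : IsOpen D)
    (hconv : Convex ℝ D) (hne : D.Nonempty) (hg : ContDiffOn ℝ ∞ g D)
    (hc : ∀ y ∈ D, g y ^ 2 = c) : ∃ b, b ^ 2 = c ∧ ∀ y ∈ D, g y = b := by
  obtain ⟨x, hx⟩ := hne
  refine ⟨g x, hc x hx, fun y hy => ?_⟩
  by_cases h0 : c = 0
  · subst h0
    rw [pow_eq_zero_iff (by norm_num) |>.mp (hc x hx), pow_eq_zero_iff (by norm_num) |>.mp (hc y hy)]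
  · refine eq_of_grad_eq_zero hconv (fun u hu => ?_) hy hx
    have h1 := hg.hasGradAt hD hu
    have h2 := (h1.bilin (ContinuousLinearMap.lsmul ℝ ℝ) h1).eq_zero_of_const hD hu (c := c)
      fun v hv => by simpa [sq] using hc v hv
    simp at h2
    have h3 : g u ≠ 0 := fun h => h0 (by rw [← hc u hu, h]; norm_num)
    refine h1.congr ?_ ?_ <;> apply mul_left_cancel₀ h3 <;> linarith

/-- A minimal slant surface in flat null coordinates satisfies the structure equations. -/
lemma isMinimalSlantLift (h : IsChartSurface k D f) (hconv : Convex ℝ D) (hne : D.Nonempty)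
    (hflat : ∀ y ∈ D, ∀ v w, inducedMetric (fubiniStudy k) f y v w = -(v 0 * w 1 + v 1 * w 0))
    (hmin : ∀ y ∈ D, meanCurvature (fubiniStudy k) f y = 0) {α : ℝ}
    (hα : ∀ y ∈ D, IsWirtingerAngle α (fubiniStudy k) f y) :
    ∃ κ : ℝ, κ ^ 2 = Real.sinh α ^ 2 ∧ IsMinimalSlantLift D κ (surfaceLift k f)
      (fun y => hderiv (surfaceLift k f) y (EuclideanSpace.single 0 1))
      (fun y => hderiv (surfaceLift k f) y (EuclideanSpace.single 1 1))
      (fun y => hopfForm (surfaceLift k f) y (EuclideanSpace.single 0 1))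
      (fun y => hopfForm (surfaceLift k f) y (EuclideanSpace.single 1 1)) := by
  have hz := h.smooth_lift
  have hH := fun v : EuclideanSpace ℝ (Fin 2) =>
    (smooth_hderiv h.isOpen hz).clm_apply (contDiffOn_const (c := v))
  have ha := fun v : EuclideanSpace ℝ (Fin 2) =>
    (smooth_hopfForm h.isOpen hz).clm_apply (contDiffOn_const (c := v))
  have hκs : ContDiffOn ℝ ∞ (fun y => (hermL
      (hderiv (surfaceLift k f) y (EuclideanSpace.single 0 1))
      (hderiv (surfaceLift k f) y (EuclideanSpace.single 1 1))).im) D :=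
    Complex.imCLM.contDiff.comp_contDiffOn
      ((hermL.contDiff.comp_contDiffOn (hH _)).clm_apply (hH _))
  obtain ⟨κ, hκ, hconst⟩ := exists_const_of_sq_eq h.isOpen hconv hne hκs
    fun y hy => h.kaehler_sq hy hflat (hα y hy)
  have hre : ∀ y ∈ D, ∀ v w, (herm (hderiv (surfaceLift k f) y v)
      (hderiv (surfaceLift k f) y w)).re = -(v 0 * w 1 + v 1 * w 0) := fun y hy v w => by
    rw [← hmetric_apply, ← h.inducedMetric_eq hy, hflat y hy]
  -- Minimality makes the real part of this pairing vanish for every horizontal vector; complex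
  -- linearity of the horizontal lift then removes the imaginary part.
  have hmixed : ∀ y ∈ D, ∀ t, herm
      (fderiv ℝ (fun x => hderiv (surfaceLift k f) x (EuclideanSpace.single 1 1)) y
        (EuclideanSpace.single 0 1) - hopfForm (surfaceLift k f) y (EuclideanSpace.single 0 1)
          • hderiv (surfaceLift k f) y (EuclideanSpace.single 1 1))
      (horizontalLift k (f y) t) = 0 := fun y hy t => by
    have h1 : ∀ t, (herm
      (fderiv ℝ (fun x => hderiv (surfaceLift k f) x (EuclideanSpace.single 1 1)) y
        (EuclideanSpace.single 0 1) - hopfForm (surfaceLift k f) y (EuclideanSpace.single 0 1)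
          • hderiv (surfaceLift k f) y (EuclideanSpace.single 1 1))
      (horizontalLift k (f y) t)).re = 0 := fun t => by
      rw [← h.fubiniStudy_covariant hy, h.mixed_eq_zero hy hflat (hmin y hy), map_zero,
        zero_apply]
    exact herm_eq_zero_of_re (h1 t) (by rw [← horizontalLift_smul]; exact h1 _)
  refine ⟨κ, hκ, h.isOpen, hH _, hH _, ha _, ha _, fun y hy => ?_, fun y hy => ?_,
    fun y hy => ?_, fun y hy => ?_⟩
  · refine ⟨h.herm_lift y hy, herm_hderiv (h.herm_lift y hy) _, herm_hderiv (h.herm_lift y hy) _,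
      ?_, ?_, ?_⟩
    · exact Complex.ext (by simp [hre y hy]) (herm_self_im _)
    · exact Complex.ext (by simp [hre y hy]) (herm_self_im _)
    · exact Complex.ext (by simp [hre y hy]) (by simpa using hconst y hy)
  · exact (hz.hasGradAt h.isOpen hy).congr (by rw [hderiv_apply, sub_add_cancel])
      (by rw [hderiv_apply, sub_add_cancel])
  · rw [← conj_herm, h.hderiv_lift hy (EuclideanSpace.single 0 1), hmixed y hy, map_zero]
  · conv_lhs => rw [← conj_herm]
    have := hmixed y hy (fderiv ℝ f y (EuclideanSpace.single 1 1))
    rw [← h.hderiv_lift hy] at this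
    rw [this, map_zero]

end IsChartSurface

end Surface

/-! ### Local model charts -/

section Local

/-- The null coordinates of a flat Lorentzian metric may be taken on a convex set. -/
theorem exists_convex_flat_null_coordinates {D : Set (EuclideanSpace ℝ (Fin 2))}
    {G : EuclideanSpace ℝ (Fin 2) →
      EuclideanSpace ℝ (Fin 2) →L[ℝ] EuclideanSpace ℝ (Fin 2) →L[ℝ] ℝ}
    (hD : IsOpen D) (hG : ContDiffOn ℝ ∞ G D) (hs : ∀ y ∈ D, ∀ v w, G y v w = G y w v)
    (hflat : ∀ y ∈ D, ∀ u v w, curvature G y u v w = 0) {x a b : EuclideanSpace ℝ (Fin 2)}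
    (hx : x ∈ D) (haa : G x a a = 0) (hbb : G x b b = 0) (hab : G x a b = -1) :
    ∃ e : OpenPartialHomeomorph (EuclideanSpace ℝ (Fin 2)) (EuclideanSpace ℝ (Fin 2)),
      x ∈ e.source ∧ e.source ⊆ D ∧ Convex ℝ e.target ∧
      ContDiffOn ℝ ∞ e e.source ∧ ContDiffOn ℝ ∞ e.symm e.target ∧
      ∀ y ∈ e.source, ∀ v w, G y v w
        = -(fderiv ℝ e y v 0 * fderiv ℝ e y w 1 + fderiv ℝ e y v 1 * fderiv ℝ e y w 0) := by
  obtain ⟨e, hxe, hsub, hsm, hsm', he⟩ := exists_flat_null_coordinates hD hG hs hflat hx haa hbb hab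
  obtain ⟨r, hr, hball⟩ := Metric.isOpen_iff.mp e.open_target (e x) (e.map_source hxe)
  generalize hB : Metric.ball (e x) r = B at hball
  have hBo : IsOpen B := hB ▸ Metric.isOpen_ball
  have hsrc : (e ≫ₕ OpenPartialHomeomorph.ofSet B hBo).source ⊆ e.source := by
    rw [OpenPartialHomeomorph.trans_source]; exact Set.inter_subset_left
  have htgt : (e ≫ₕ OpenPartialHomeomorph.ofSet B hBo).target = B := by
    rw [OpenPartialHomeomorph.trans_target]; exact Set.inter_eq_left.mpr hball
  refine ⟨e ≫ₕ OpenPartialHomeomorph.ofSet B hBo, ?_, hsrc.trans hsub, ?_,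
    hsm.mono hsrc, ?_, fun y hy => he y (hsrc hy)⟩
  · rw [OpenPartialHomeomorph.trans_source]
    exact ⟨hxe, show e x ∈ B from hB ▸ Metric.mem_ball_self hr⟩
  · rw [htgt, ← hB]; exact convex_ball _ _
  · rw [htgt]; exact hsm'.mono hball

/-- A surface in flat null coordinates obtained by a change of coordinates. -/
lemma IsChartSurface.inducedMetric_comp_symm {k : Fin 2} {D : Set (EuclideanSpace ℝ (Fin 2))}
    {f : EuclideanSpace ℝ (Fin 2) → ℂ × ℂ} (h : IsChartSurface k D f)
    {e : OpenPartialHomeomorph (EuclideanSpace ℝ (Fin 2)) (EuclideanSpace ℝ (Fin 2))}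
    (hsub : e.source ⊆ D) (hsm : ContDiffOn ℝ ∞ e e.source)
    (hsm' : ContDiffOn ℝ ∞ e.symm e.target)
    (he : ∀ y ∈ e.source, ∀ v w, inducedMetric (fubiniStudy k) f y v w
        = -(fderiv ℝ e y v 0 * fderiv ℝ e y w 1 + fderiv ℝ e y v 1 * fderiv ℝ e y w 0))
    {y : EuclideanSpace ℝ (Fin 2)} (hy : y ∈ e.target) (v w : EuclideanSpace ℝ (Fin 2)) :
    inducedMetric (fubiniStudy k) (f ∘ e.symm) y v w = -(v 0 * w 1 + v 1 * w 0) := by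
  have hys := e.map_target hy
  have h1 := hsm'.hasFDerivAt' e.open_target hy
  have h2 := hsm.hasFDerivAt' e.open_source hys
  have h3 : HasFDerivAt (f ∘ e.symm) _ y := (h.smooth.hasFDerivAt' h.isOpen (hsub hys)).comp y h1
  have h4 : (fderiv ℝ e (e.symm y)).comp (fderiv ℝ e.symm y)
      = ContinuousLinearMap.id ℝ (EuclideanSpace ℝ (Fin 2)) :=
    (h2.comp y h1).unique ((hasFDerivAt_id y).congr_of_eventuallyEq
      (Filter.eventually_of_mem (e.open_target.mem_nhds hy) fun u hu => e.right_inv hu))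
  have h5 : ∀ v, fderiv ℝ e (e.symm y) (fderiv ℝ e.symm y v) = v := fun v =>
    DFunLike.congr_fun h4 v
  have h6 : inducedMetric (fubiniStudy k) (f ∘ e.symm) y v w
      = inducedMetric (fubiniStudy k) f (e.symm y) (fderiv ℝ e.symm y v)
        (fderiv ℝ e.symm y w) := by
    simp only [inducedMetric, h3.fderiv]; rfl
  rw [h6, he _ hys, h5, h5]

variable {M : Type*} [TopologicalSpace M] [ChartedSpace (EuclideanSpace ℝ (Fin 2)) M]
  {L : M → CP21}

lemma isChartSurface_of_contMDiff (hL : ContMDiff (𝓡 2) 𝓘(ℝ, ℂ × ℂ) ∞ L)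
    {φ : OpenPartialHomeomorph M (EuclideanSpace ℝ (Fin 2))}
    (hφ : φ ∈ IsManifold.maximalAtlas (𝓡 2) ∞ M) (k : Fin 2) :
    IsChartSurface k (φ.target ∩ φ.symm ⁻¹' (L ⁻¹' affineDomain k))
      (fun y => affineChart k (L (φ.symm y))) where
  isOpen := φ.symm.isOpen_inter_preimage ((isOpen_affineDomain k).preimage hL.continuous)
  smooth := by
    have h1 : affineChart k ∈ IsManifold.maximalAtlas 𝓘(ℝ, ℂ × ℂ) ∞ CP21 :=
      IsManifold.subset_maximalAtlas (Set.mem_range_self k)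
    refine contMDiffOn_iff_contDiffOn.mp ?_
    exact (contMDiffOn_of_mem_maximalAtlas h1).comp
      (hL.comp_contMDiffOn ((contMDiffOn_symm_of_mem_maximalAtlas hφ).mono Set.inter_subset_left))
      fun y hy => hy.2
  pos y hy := (affineChart k).map_source hy.2

/-- A slant surface whose Wirtinger angle vanishes is Lagrangian. -/
lemma isLagrangian_of_sinh_eq_zero (hL : ContMDiff (𝓡 2) 𝓘(ℝ, ℂ × ℂ) ∞ L) {θ : ℝ}
    (hslant : InCharts L (IsWirtingerAngle θ)) (hθ : Real.sinh θ = 0) : IsLagrangian L := by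
  intro φ hφ k u hu hk X Y
  have h := isChartSurface_of_contMDiff hL hφ k
  obtain ⟨e₁, e₂, h11, h22, h12, h1, h2⟩ := hslant φ hφ k u hu hk
  have h1 := h1 Y
  have h2 := h2 Y
  rw [null_expand (fun v w => h.inducedMetric_symm ⟨hu, hk⟩ v w) h11 h22 h12 X]
  simp only [hθ, neg_zero, zero_smul, map_zero, sub_zero] at h1 h2
  simp only [map_add, map_smul, smul_add, smul_comm Complex.I, add_apply, smul_apply, h1, h2,
    smul_zero, add_zero]

variable [IsManifold (𝓡 2) ∞ M]

/-- A chart followed by a diffeomorphism of open sets of the plane is a chart. -/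
lemma trans_mem_maximalAtlas {φ : OpenPartialHomeomorph M (EuclideanSpace ℝ (Fin 2))}
    (hφ : φ ∈ IsManifold.maximalAtlas (𝓡 2) ∞ M)
    {e : OpenPartialHomeomorph (EuclideanSpace ℝ (Fin 2)) (EuclideanSpace ℝ (Fin 2))}
    (hsm : ContDiffOn ℝ ∞ e e.source) (hsm' : ContDiffOn ℝ ∞ e.symm e.target) :
    φ ≫ₕ e ∈ IsManifold.maximalAtlas (𝓡 2) ∞ M := by
  rw [IsManifold.mem_maximalAtlas_iff_contMDiffOn] at hφ ⊢
  rw [OpenPartialHomeomorph.trans_source, OpenPartialHomeomorph.trans_target]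
  exact ⟨(contMDiffOn_iff_contDiffOn.mpr hsm).comp (hφ.1.mono Set.inter_subset_left)
      fun _ hx => hx.2,
    hφ.2.comp ((contMDiffOn_iff_contDiffOn.mpr hsm').mono Set.inter_subset_left) fun _ hx => hx.2⟩

lemma trans_equiv_mem_maximalAtlas {φ : OpenPartialHomeomorph M (EuclideanSpace ℝ (Fin 2))}
    (hφ : φ ∈ IsManifold.maximalAtlas (𝓡 2) ∞ M)
    {e : EuclideanSpace ℝ (Fin 2) ≃ₜ EuclideanSpace ℝ (Fin 2)}
    (hsm : ContDiff ℝ ∞ e) (hsm' : ContDiff ℝ ∞ e.symm) :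
    φ ≫ₕ e.toOpenPartialHomeomorph ∈ IsManifold.maximalAtlas (𝓡 2) ∞ M :=
  trans_mem_maximalAtlas hφ hsm.contDiffOn hsm'.contDiffOn

lemma eq_hopf_unitPoint {k : Fin 2} {l : CP21} (hl : l ∈ affineDomain k) :
    l = hopf (unitPoint k (affineChart k l)) :=
  ((affineChart k).left_inv hl).symm

/-- A chart in which the surface is the model surface, moved by `A`. -/
structure IsModelChart (L : M → CP21) (A : U12)
    (φ : OpenPartialHomeomorph M (EuclideanSpace ℝ (Fin 2))) : Prop where
  mem_atlas : φ ∈ IsManifold.maximalAtlas (𝓡 2) ∞ M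
  eq_model : ∀ q ∈ φ.source, L q = A.congruence (hopf (Ltilde 1 (φ q 0) (φ q 1)))

/-- A minimal flat slant surface has flat null coordinates near every point. -/
lemma exists_null_chart (hL : ContMDiff (𝓡 2) 𝓘(ℝ, ℂ × ℂ) ∞ L) {θ : ℝ}
    (hslant : InCharts L (IsWirtingerAngle θ)) (hflat : IsFlat L) (p : M) :
    ∃ (k : Fin 2) (ψ : OpenPartialHomeomorph M (EuclideanSpace ℝ (Fin 2))),
      ψ ∈ IsManifold.maximalAtlas (𝓡 2) ∞ M ∧ p ∈ ψ.source ∧ Convex ℝ ψ.target ∧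
      (∀ y ∈ ψ.target, L (ψ.symm y) ∈ affineDomain k) ∧
      ∀ y ∈ ψ.target, ∀ v w, inducedMetric (fubiniStudy k)
        (fun y => affineChart k (L (ψ.symm y))) y v w = -(v 0 * w 1 + v 1 * w 0) := by
  obtain ⟨k, hk⟩ := exists_mem_affineDomain (L p)
  set φ := chartAt (EuclideanSpace ℝ (Fin 2)) p
  have hφ : φ ∈ IsManifold.maximalAtlas (𝓡 2) ∞ M := IsManifold.chart_mem_maximalAtlas p
  have hpφ : p ∈ φ.source := mem_chart_source _ p
  have h := isChartSurface_of_contMDiff hL hφ k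
  have hu : φ p ∈ φ.target ∩ φ.symm ⁻¹' (L ⁻¹' affineDomain k) :=
    ⟨φ.map_source hpφ, by simpa [φ.left_inv hpφ] using hk⟩
  -- The slant condition enters here through its null frame, which shows that the metric is
  -- Lorentzian.
  obtain ⟨e₁, e₂, h11, h22, h12, -⟩ := hslant φ hφ k (φ p) hu.1 hu.2
  obtain ⟨e, hpe, hsub, hconv, hsm, hsm', he⟩ := exists_convex_flat_null_coordinates h.isOpen
    h.smooth_inducedMetric (fun y hy => h.inducedMetric_symm hy)
    (fun y hy => hflat φ hφ k y hy.1 hy.2) hu h11 h22 h12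
  have htgt : (φ ≫ₕ e).target = e.target := by
    rw [OpenPartialHomeomorph.trans_target]
    exact Set.inter_eq_left.mpr fun y hy => (hsub (e.map_target hy)).1
  refine ⟨k, φ ≫ₕ e, trans_mem_maximalAtlas hφ hsm hsm', ?_, htgt ▸ hconv, ?_, ?_⟩
  · rw [OpenPartialHomeomorph.trans_source]
    exact ⟨hpφ, hpe⟩
  · rw [htgt]
    exact fun y hy => (hsub (e.map_target hy)).2
  · rw [htgt]
    exact fun y hy => h.inducedMetric_comp_symm hsub hsm hsm' he hy

/-- A minimal flat slant surface has Wirtinger angle zero and a model chart at every point. -/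
lemma exists_isModelChart (hL : ContMDiff (𝓡 2) 𝓘(ℝ, ℂ × ℂ) ∞ L) {θ : ℝ}
    (hslant : InCharts L (IsWirtingerAngle θ)) (hmin : IsMinimal L) (hflat : IsFlat L) (p : M) :
    Real.sinh θ = 0 ∧ ∃ A φ, p ∈ φ.source ∧ IsModelChart L A φ := by
  obtain ⟨k, ψ, hψ, hp, hconv, hdom, hnull⟩ := exists_null_chart hL hslant hflat p
  have h := isChartSurface_of_contMDiff hL hψ k
  have hsub : ψ.target ∩ ψ.symm ⁻¹' (L ⁻¹' affineDomain k) = ψ.target :=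
    Set.inter_eq_left.mpr hdom
  rw [hsub] at h
  have hne : ψ.target.Nonempty := ⟨_, ψ.map_source hp⟩
  obtain ⟨κ, hκ, hlift⟩ := h.isMinimalSlantLift hconv hne hnull
    (fun y hy => hmin ψ hψ k y hy (hdom y hy)) (fun y hy => hslant ψ hψ k y hy (hdom y hy))
  -- Integrability forces κ = 0, and κ² = sinh²θ then gives the vanishing of sinh θ.
  obtain rfl := hlift.slant_eq_zero hne
  obtain ⟨s, hs, A, hA⟩ := hlift.exists_congruence hconv hne
  refine ⟨by simpa using hκ.symm, A,
    ψ ≫ₕ (planeScale s hs).symm.toHomeomorph.toOpenPartialHomeomorph, ?_,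
    trans_equiv_mem_maximalAtlas hψ (planeScale s hs).symm.contDiff (planeScale s hs).contDiff,
    fun q hq => ?_⟩
  · simpa using hp
  · have hq : q ∈ ψ.source := by simpa using hq
    change L q = A.congruence (hopf (Ltilde 1 ((planeScale s hs).symm (ψ q) 0)
      ((planeScale s hs).symm (ψ q) 1)))
    obtain ⟨c, hc, hcA⟩ := hA ((planeScale s hs).symm (ψ q))
      (by simpa using ψ.map_source hq)
    have h1 := hdom _ (ψ.map_source hq)
    have h2 := h.pos _ (ψ.map_source hq)
    rw [ContinuousLinearEquiv.apply_symm_apply, modelCurve_eq_Ltilde, surfaceLift,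
      unitSection_eq k h2] at hcA
    rw [ψ.left_inv hq] at h1 hcA
    rw [eq_hopf_unitPoint h1, U12.congruence_hopf]
    exact hopf_eq_iff.mpr ⟨c, hc, hcA⟩

end Local

/-! ### Globalization -/

section Global

variable {M : Type*} [TopologicalSpace M] [ChartedSpace (EuclideanSpace ℝ (Fin 2)) M]
  [IsManifold (𝓡 2) ∞ M] {L : M → CP21}

/-- Two model charts which overlap are related by an affine change of coordinates. -/
lemma IsModelChart.of_overlap {A B : U12}
    {φ ψ : OpenPartialHomeomorph M (EuclideanSpace ℝ (Fin 2))} (hφ : IsModelChart L A φ)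
    (hψ : IsModelChart L B ψ) {r : M} (hr : r ∈ φ.source) (hr' : r ∈ ψ.source) :
    ∃ χ, χ.source = φ.source ∧ IsModelChart L B χ := by
  have hD : IsOpen (φ.symm ≫ₕ ψ).source := (φ.symm ≫ₕ ψ).open_source
  have hT : ContDiffOn ℝ ∞ (φ.symm ≫ₕ ψ) (φ.symm ≫ₕ ψ).source := by
    refine contMDiffOn_iff_contDiffOn.mp ?_
    rw [OpenPartialHomeomorph.trans_source]
    exact (contMDiffOn_of_mem_maximalAtlas hψ.mem_atlas).comp
      ((contMDiffOn_symm_of_mem_maximalAtlas hφ.mem_atlas).mono Set.inter_subset_left)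
      fun _ hx => hx.2
  have hne : (φ.symm ≫ₕ ψ).source.Nonempty := by
    refine ⟨φ r, ?_⟩
    rw [OpenPartialHomeomorph.trans_source]
    exact ⟨φ.map_source hr, by simpa [φ.left_inv hr] using hr'⟩
  -- Both model parametrisations are defined on the entire plane, so the affine relation found on
  -- the overlap holds on all of the target of φ and the source of φ need not shrink.
  obtain ⟨R, b, c, hc, hRb⟩ := ((isModelSolution_modelCurve Set.univ).map A).exists_affine_change
    ((isModelSolution_modelCurve Set.univ).map B) hD hT hne fun u hu => by
      rw [OpenPartialHomeomorph.trans_source] at hu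
      have h1 := hφ.eq_model _ (φ.map_target hu.1)
      rw [hψ.eq_model _ hu.2, φ.right_inv hu.1] at h1
      obtain ⟨c, -, h2⟩ := hopf_eq_iff.mp h1
      refine ⟨c, ?_⟩
      rw [modelCurve_eq_Ltilde, modelCurve_eq_Ltilde]
      exact h2
  refine ⟨φ ≫ₕ (R.toHomeomorph.trans (Homeomorph.addRight b)).toOpenPartialHomeomorph,
    by simp, trans_equiv_mem_maximalAtlas hφ.mem_atlas (R.contDiff.add contDiff_const)
      (R.symm.contDiff.comp (contDiff_id.add contDiff_const)), fun q hq => ?_⟩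
  have hq : q ∈ φ.source := by simpa using hq
  change L q = B.congruence (hopf (Ltilde 1 ((R (φ q) + b) 0) ((R (φ q) + b) 1)))
  have h1 := hRb (φ q)
  rw [modelCurve_eq_Ltilde, modelCurve_eq_Ltilde] at h1
  rw [hφ.eq_model q hq]
  exact (hopf_eq_iff.mpr ⟨c, hc, h1⟩).symm

/-- On a connected surface, the same congruence serves for all points. -/
lemma exists_global_congruence [ConnectedSpace M]
    (h : ∀ p : M, ∃ A φ, p ∈ φ.source ∧ IsModelChart L A φ) :
    ∃ A : U12, ∀ p : M, ∃ φ, p ∈ φ.source ∧ IsModelChart L A φ := by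
  obtain ⟨p₀⟩ := (inferInstance : Nonempty M)
  obtain ⟨A, φ₀, hp₀, hφ₀⟩ := h p₀
  refine ⟨A, fun p => ?_⟩
  have hU : IsClopen {p : M | ∃ φ, p ∈ φ.source ∧ IsModelChart L A φ} := by
    constructor
    · rw [← isOpen_compl_iff, isOpen_iff_mem_nhds]
      intro p hp
      obtain ⟨B, ψ, hpψ, hψ⟩ := h p
      refine Filter.mem_of_superset (ψ.open_source.mem_nhds hpψ) ?_
      -- Closedness: if a model chart ψ around p met the set, the overlap would convert ψ into a
      -- model chart for A and put p in the set.
      rintro r hr ⟨φ, hrφ, hφ⟩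
      obtain ⟨χ, hχ, hχA⟩ := hψ.of_overlap hφ hr hrφ
      exact hp ⟨χ, hχ ▸ hpψ, hχA⟩
    · rw [isOpen_iff_mem_nhds]
      rintro p ⟨φ, hp, hφ⟩
      exact Filter.mem_of_superset (φ.open_source.mem_nhds hp) fun q hq => ⟨φ, hq, hφ⟩
  have := hU.eq_univ ⟨p₀, φ₀, hp₀, hφ₀⟩
  exact (Set.eq_univ_iff_forall.mp this) p

end Global

end SlantCP

end

/-! ### The main theorem -/

theorem theorem6p1 {M : Type*} [TopologicalSpace M]
    [ChartedSpace (EuclideanSpace ℝ (Fin 2)) M] [IsManifold (𝓡 2) ∞ M] [ConnectedSpace M]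
    (L : M → SlantCP.CP21) (hL : ContMDiff (𝓡 2) 𝓘(ℝ, ℂ × ℂ) ∞ L)
    (hslant : SlantCP.IsSlant L) (hmin : SlantCP.IsMinimal L) (hflat : SlantCP.IsFlat L) :
    SlantCP.IsLagrangian L ∧
      ∃ a : ℝ, a ≠ 0 ∧ ∃ A : SlantCP.U12, ∀ p : M,
        ∃ φ ∈ IsManifold.maximalAtlas (𝓡 2) ∞ M, p ∈ φ.source ∧
          ∀ q ∈ φ.source,
            L q = A.congruence (SlantCP.hopf (SlantCP.Ltilde a (φ q 0) (φ q 1))) := by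
  obtain ⟨θ, hθ⟩ := hslant
  have hloc := SlantCP.exists_isModelChart hL hθ hmin hflat
  obtain ⟨p₀⟩ := (inferInstance : Nonempty M)
  obtain ⟨A, hA⟩ := SlantCP.exists_global_congruence fun p => (hloc p).2
  -- The value a = 1 always suffices: `Ltilde a x y` equals `Ltilde 1 (x / a) (a * y)`, so the
  -- parameter is absorbed by the choice of coordinates.
  refine ⟨SlantCP.isLagrangian_of_sinh_eq_zero hL hθ (hloc p₀).1, 1, one_ne_zero, A, fun p => ?_⟩
  obtain ⟨φ, hp, hφ⟩ := hA p
  exact ⟨φ, hφ.mem_atlas, hp, hφ.eq_model⟩
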